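/- Let $n\ge 2$, $m\ge 1$, let $\mathcal G$ be a finite directed graph with node set $\mathcal U$ and edge set $\mathcal E$, each edge $e$ having a source $s(e)$, a target $t(e)$ and a label $\sigma(e)\in\{1,\dots,m\}$, and let $\mathcal A=\{A_1,\dots,A_m\}\subset\mathbb R^{n\times n}$. For $k\ge1$ let $\mathcal L_{\mathcal G,k}$ be the set of words $(\sigma(e_0),\dots,\sigma(e_{k-1}))$ with $t(e_i)=s(e_{i+1})$ for $0\le i\le k-2$; for such a word $\sigma=(\sigma_0,\dots,\sigma_{k-1})$ put $A_\sigma=A_{\sigma_{k-1}}\cdots A_{\sigma_0}$. The constrained joint spectral radius is $$\rho(\mathcal G,\mathcal A)=\lim_{k\to\infty}\max_{\sigma\in\mathcal L_{\mathcal G,k}}\|A_\sigma\|^{1/k}$$ (with the Euclidean operator norm; the maximum over an empty set is $0$). Fix $l\ge1$ with $\mathcal L_{\mathcal G,l}\ne\emptyset$, $W>0$, and a probability measure $\mu^w$ on the ball $\{w\in\mathbb R^n:\|w\|\le W\}$ that is absolutely continuous with respect to Lebesgue measure. A sample is a triple $(x,\sigma,w)$ with law $\pi=\mu^x\times\mu^\sigma\times\mu^w$,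 where $\mu^x$ is the uniform probability measure on the unit sphere of $\mathbb R^n$ and $\mu^\sigma$ is uniform on $\mathcal L_{\mathcal G,l}$. Let $d=n(n+1)/2$, $N\ge d$, and let $\omega=\{(x_i,\sigma_i,w_i)\}_{i\le N}$ be $N$ independent samples, so that $\omega$ has law $\pi^N$. Let $C\ge\sqrt n$, and let $(\lambda^*(\omega),P^*(\omega))$ be the optimal solution of the program $$\min_{\lambda\ge0,\;P\in\mathbb R^{n\times n}}(\lambda,\|P\|_F)\quad\text{(lexicographically)}\quad\text{s.t. } P\succeq I,\ \ \|P\|_F\le C,\ \ \|A_{\sigma_i}x_i+w_i\|_P\le\lambda^l\|x_i\|_P\ \ (1\le i\le N),$$ where $P\succeq I$ means that $P$ is symmetric and $P-I$ is positive semidefinite, and $\|x\|_P=\sqrt{x^{T}Px}$. This optimal solution exists and is unique for every $\omega$. Let $\Phi(\cdot\,;a,b)$ be the regularized incomplete beta function on $[0,1]$, and $\Phi^{-1}(\cdot\,;a,b)$ its inverse, with $\Phi^{-1}(y;a,b)=1$ for $y\ge1$. For $\beta\in(0,1)$ put $\varepsilon(\beta,N)=\Phi^{-1}(1-\beta;\,d,\,N-d+1)$,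 i.e. the $\varepsilon$ with $\sum_{i=0}^{d-1}\binom Ni\varepsilon^i(1-\varepsilon)^{N-i}=\beta$; further $$\kappa(P)=\sqrt{\frac{\det P}{\lambda^{\min}(P)^n}},\qquad \delta(x)=\sqrt{1-\Phi^{-1}\!\left(2x;\tfrac{n-1}2,\tfrac12\right)},\qquad \overline\lambda(\omega)=\lambda^*(\omega)^l+\sqrt{\frac{\lambda^{\max}(P^*(\omega))}{\lambda^{\min}(P^*(\omega))}}\;W .$$ Then, for every $\beta\in(0,1)$, $$\pi^N\bigl(\{\omega:\rho(\mathcal G,\mathcal A)\le\overline\rho(\omega)\}\bigr)\ge1-\beta,\qquad \overline\rho(\omega)=\left(\frac{\overline\lambda(\omega)}{\delta\bigl(\varepsilon(\beta,N)\,|\mathcal L_{\mathcal G,l}|\,\kappa(P^*(\omega))/2\bigr)}\right)^{1/l},$$ where $\overline\rho(\omega)=+\infty$ if $\delta(\cdot)=0$, that is, if $\varepsilon(\beta,N)\,|\mathcal L_{\mathcal G,l}|\,\kappa(P^*(\omega))\ge1$. -/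

import Mathlib

open MeasureTheory Filter Topology
open scoped ENNReal

noncomputable section

namespace CSLS

/-- A labeled graph with nodes `U`, edges `E` and labels in `{1, …, m}` (indexed by `Fin m`). -/
structure LabeledGraph (U E : Type*) (m : ℕ) where
  source : E → U
  target : E → U
  label : E → Fin m

/-- The words of length `l` read along paths `e₀, …, e_{l-1}` of the graph. -/
def LabeledGraph.language {U E : Type*} {m : ℕ} (G : LabeledGraph U E m) (l : ℕ) :
    Set (Fin l → Fin m) :=
  {s | ∃ e : Fin l → E,
    (∀ i j : Fin l, (j : ℕ) = i + 1 → G.target (e i) = G.source (e j)) ∧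
    ∀ i, s i = G.label (e i)}

/-- The product `A_{s(l-1)} ⋯ A_{s(0)}` along the word `s`. -/
def wordProd {n m l : ℕ} (A : Fin m → Matrix (Fin n) (Fin n) ℝ) (s : Fin l → Fin m) :
    Matrix (Fin n) (Fin n) ℝ :=
  (List.ofFn fun i => A (s i)).reverse.prod

/-- The operator norm of a matrix induced by the Euclidean norm. -/
def opNorm {n : ℕ} (M : Matrix (Fin n) (Fin n) ℝ) : ℝ :=
  ‖Matrix.toEuclideanCLM (n := Fin n) (𝕜 := ℝ) M‖

/-- The constrained joint spectral radius: the limit, as `k → ∞`, of the maximum over the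
finitely many words of length `k` of `‖A_{s(k-1)} ⋯ A_{s(0)}‖ ^ (1/k)`
(the maximum over an empty set of words being `0`). -/
def cjsr {U E : Type*} {n m : ℕ} (G : LabeledGraph U E m)
    (A : Fin m → Matrix (Fin n) (Fin n) ℝ) : ℝ :=
  limUnder atTop fun k : ℕ =>
    ⨆ s : G.language k, opNorm (wordProd A s.1) ^ (1 / (k : ℝ))

/-- The quadratic norm `‖x‖_P = √(xᵀ P x)`. -/
def quadNorm {n : ℕ} (P : Matrix (Fin n) (Fin n) ℝ) (x : EuclideanSpace ℝ (Fin n)) : ℝ :=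
  √(inner ℝ x (Matrix.toEuclideanCLM (n := Fin n) (𝕜 := ℝ) P x))

/-- The Frobenius norm. -/
def frobNorm {n : ℕ} (P : Matrix (Fin n) (Fin n) ℝ) : ℝ :=
  √(∑ i, ∑ j, P i j ^ 2)

/-- The largest (real) eigenvalue. -/
def eigMax {n : ℕ} (P : Matrix (Fin n) (Fin n) ℝ) : ℝ := sSup (spectrum ℝ P)

/-- The smallest (real) eigenvalue. -/
def eigMin {n : ℕ} (P : Matrix (Fin n) (Fin n) ℝ) : ℝ := sInf (spectrum ℝ P)

/-- A sample `(x, σ, w)`: an initial state on the unit sphere, a word of length `l`, a noise. -/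
abbrev Sample (n m l : ℕ) : Type :=
  Metric.sphere (0 : EuclideanSpace ℝ (Fin n)) 1 × (Fin l → Fin m) × EuclideanSpace ℝ (Fin n)

/-- The uniform probability measure on the unit sphere: the normalized surface measure. -/
def sphereUniform (n : ℕ) : Measure (Metric.sphere (0 : EuclideanSpace ℝ (Fin n)) 1) :=
  ((volume : Measure (EuclideanSpace ℝ (Fin n))).toSphere Set.univ)⁻¹ •
    (volume : Measure (EuclideanSpace ℝ (Fin n))).toSphere

/-- The law of one sample: uniform state, uniform word of length `l`, noise of law `μw`,
all independent. -/
def sampleLaw {U E : Type*} {n m : ℕ} (G : LabeledGraph U E m) (l : ℕ)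
    (μw : Measure (EuclideanSpace ℝ (Fin n))) : Measure (Sample n m l) :=
  (sphereUniform n).prod ((ProbabilityTheory.uniformOn (G.language l)).prod μw)

/-- Feasible points `(lam, P)` of the sampled program. -/
def IsFeasible {n m l N : ℕ} (A : Fin m → Matrix (Fin n) (Fin n) ℝ) (C : ℝ)
    (ω : Fin N → Sample n m l) (q : ℝ × Matrix (Fin n) (Fin n) ℝ) : Prop :=
  0 ≤ q.1 ∧ (q.2 - 1).PosSemidef ∧ frobNorm q.2 ≤ C ∧
    ∀ i, quadNorm q.2
        (Matrix.toEuclideanCLM (n := Fin n) (𝕜 := ℝ) (wordProd A (ω i).2.1) (ω i).1.1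
          + (ω i).2.2)
      ≤ q.1 ^ l * quadNorm q.2 (ω i).1.1

/-- Optimal solutions of the sampled program: feasible points that minimize
`(lam, ‖P‖_F)` in the lexicographic order. -/
def IsOptimal {n m l N : ℕ} (A : Fin m → Matrix (Fin n) (Fin n) ℝ) (C : ℝ)
    (ω : Fin N → Sample n m l) (q : ℝ × Matrix (Fin n) (Fin n) ℝ) : Prop :=
  IsFeasible A C ω q ∧ ∀ q', IsFeasible A C ω q' →
    q.1 < q'.1 ∨ (q.1 = q'.1 ∧ frobNorm q.2 ≤ frobNorm q'.2)

/-- The regularized incomplete beta function `I_t(a, b)`, for `a, b > 0` and `t ∈ [0, 1]`. -/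
def regBeta (t a b : ℝ) : ℝ :=
  (∫ u in (0 : ℝ)..t, u ^ (a - 1) * (1 - u) ^ (b - 1)) /
    ∫ u in (0 : ℝ)..1, u ^ (a - 1) * (1 - u) ^ (b - 1)

/-- The inverse of `t ↦ I_t(a, b)` on `[0, 1]`, extended by the value `1` for `y ≥ 1`. -/
def regBetaInv (y a b : ℝ) : ℝ := sSup {t ∈ Set.Icc (0 : ℝ) 1 | regBeta t a b ≤ y}

/-- The number `d = n(n+1)/2` of free entries of a symmetric matrix. -/
def symDim (n : ℕ) : ℕ := n * (n + 1) / 2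

/-- The violation level: the `ε` with `I_ε(d, N - d + 1) = 1 - β`, that is, with
`∑_{i < d} (N choose i) ε^i (1 - ε)^(N - i) = β`. -/
def epsLevel (n N : ℕ) (β : ℝ) : ℝ :=
  regBetaInv (1 - β) (symDim n) ((N : ℝ) - symDim n + 1)

/-- `δ(x) = √(1 - I⁻¹(2x; (n-1)/2, 1/2))`; it vanishes for `x ≥ 1/2`. -/
def deltaFun (n : ℕ) (x : ℝ) : ℝ :=
  √(1 - regBetaInv (2 * x) (((n : ℝ) - 1) / 2) (1 / 2))

/-- `κ(P) = √(det P / λ_min(P)^n)`. -/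
def kappa {n : ℕ} (P : Matrix (Fin n) (Fin n) ℝ) : ℝ := √(P.det / eigMin P ^ n)

/-- `λ^l + √(λ_max(P) / λ_min(P)) W`. -/
def lamBar {n : ℕ} (l : ℕ) (W : ℝ) (q : ℝ × Matrix (Fin n) (Fin n) ℝ) : ℝ :=
  q.1 ^ l + √(eigMax q.2 / eigMin q.2) * W

/-- The bound `(lamBar / δ(ε(β,N) K κ(P) / 2)) ^ (1/l)`, where `K` is the number of words. It is
valued in `[0, ∞]`: it is `∞` when `δ` vanishes. -/
def rhoBar {n : ℕ} (l N K : ℕ) (W β : ℝ) (q : ℝ × Matrix (Fin n) (Fin n) ℝ) : ℝ≥0∞ :=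
  (ENNReal.ofReal (lamBar l W q) /
    ENNReal.ofReal (deltaFun n (epsLevel n N β * K * kappa q.2 / 2))) ^ (1 / (l : ℝ))

end CSLS

end

/-! The argument has a probabilistic and a deterministic half, joined by the violation probability V
of a point (λ, P): the mass of the samples whose constraint fails there.

Probabilistic half (scenario approach). For fixed λ the squared constraint is linear in P, so the
matrices that improve on the optimum as far as one sample is concerned form a convex cone. Cutting
these cones with the symmetric matrices of trace one, an affine space of dimension d - 1, and
applying Helly's theorem shows that some d samples already determine the optimum
(`OptimalOn.exists_card_eq`). Since the noise is absolutely continuous, almost surely no sample is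
active at the optimum of other samples (`ae_nondegenerate`). Hence at most d samples are active, and
filling them up with the samples of largest noise coordinate singles out one stable subfamily of
size d (`Nondegenerate.existsUnique`). Taking expectations in "exactly one of the (d + k choose d)
subfamilies is stable" for every k gives all moments of the probability that a fresh sample leaves a
family of d samples undisturbed. Its law therefore has density d (1 - x)^(d-1) on [0, 1], that of
the minimum of d uniform variables (`map_keepProb_eq_minLaw`). Summing over the (N choose d)
subfamilies bounds the probability of V > ε by 1 - I_ε(d, N - d + 1), which is at most β.

Deterministic half. Let V ≤ ε and let K be the number of words. On the unit sphere bounded noise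
costs at most √(λmax/λmin) W in the rate, and every word has weight 1/K, so for each word s the
inequality ‖A_s x‖_P ≤ λbar ‖x‖_P fails on a proportion at most ε K of the sphere. With P = BᵀB and
T = B A_s B⁻¹, passing to the coordinates B x enlarges this proportion by a factor at most κ(P). If
‖T‖ > λbar, the failing directions contain a double spherical cap, whose measure is an incomplete
beta function; comparing the two gives δ ‖T‖ ≤ λbar (`deltaFun_mul_quadNorm_le`). A common
contraction rate of all words of length l in one norm bounds ρ by its l-th root (`cjsr_le_rpow`). -/

noncomputable section

namespace CSLS

/-! ### The sampled program: convexity, existence and uniqueness of the optimum, active constraints.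
-/

section

variable {n m l : ℕ}

/-! ### Quadratic forms and the Frobenius norm -/

/-- The quadratic form `xᵀ P x`. -/
def quadForm (P : Matrix (Fin n) (Fin n) ℝ) (x : EuclideanSpace ℝ (Fin n)) : ℝ :=
  inner ℝ x (Matrix.toEuclideanCLM (n := Fin n) (𝕜 := ℝ) P x)

lemma quadNorm_eq_sqrt (P : Matrix (Fin n) (Fin n) ℝ) (x : EuclideanSpace ℝ (Fin n)) :
    quadNorm P x = √(quadForm P x) := rfl

lemma quadForm_add (P Q : Matrix (Fin n) (Fin n) ℝ) (x : EuclideanSpace ℝ (Fin n)) :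
    quadForm (P + Q) x = quadForm P x + quadForm Q x := by
  simp [quadForm, inner_add_right]

lemma quadForm_smul (c : ℝ) (P : Matrix (Fin n) (Fin n) ℝ) (x : EuclideanSpace ℝ (Fin n)) :
    quadForm (c • P) x = c * quadForm P x := by
  simp [quadForm, inner_smul_right]

lemma quadForm_one (x : EuclideanSpace ℝ (Fin n)) : quadForm 1 x = ‖x‖ ^ 2 := by
  simp [quadForm]

lemma quadForm_eq_dotProduct (P : Matrix (Fin n) (Fin n) ℝ) (x : EuclideanSpace ℝ (Fin n)) :
    quadForm P x = star x.ofLp ⬝ᵥ P.mulVec x.ofLp := by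
  rw [quadForm, EuclideanSpace.inner_eq_star_dotProduct, Matrix.ofLp_toEuclideanCLM,
    dotProduct_comm]

lemma quadForm_nonneg {P : Matrix (Fin n) (Fin n) ℝ} (hP : P.PosSemidef)
    (x : EuclideanSpace ℝ (Fin n)) : 0 ≤ quadForm P x := by
  rw [quadForm_eq_dotProduct]
  exact hP.dotProduct_mulVec_nonneg _

lemma sq_norm_le_quadForm {P : Matrix (Fin n) (Fin n) ℝ} (hP : (P - 1).PosSemidef)
    (x : EuclideanSpace ℝ (Fin n)) : ‖x‖ ^ 2 ≤ quadForm P x := by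
  have h := quadForm_nonneg hP x
  have h2 := quadForm_add (P - 1) 1 x
  rw [sub_add_cancel, quadForm_one] at h2
  linarith

lemma continuous_quadForm {X : Type*} [TopologicalSpace X] {f : X → Matrix (Fin n) (Fin n) ℝ}
    {g : X → EuclideanSpace ℝ (Fin n)} (hf : Continuous f) (hg : Continuous g) :
    Continuous fun p => quadForm (f p) (g p) := by
  simp only [quadForm_eq_dotProduct]
  have h2 : Continuous fun p => (g p).ofLp := (PiLp.continuous_ofLp 2 _).comp hg
  exact (h2.star).dotProduct (hf.matrix_mulVec h2)

/-- The entries of a matrix as a Euclidean vector. -/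
def frobVec : Matrix (Fin n) (Fin n) ℝ →ₗ[ℝ] EuclideanSpace ℝ (Fin n × Fin n) where
  toFun P := WithLp.toLp 2 fun p => P p.1 p.2
  map_add' P Q := by ext p; simp
  map_smul' c P := by ext p; simp

lemma frobNorm_eq (P : Matrix (Fin n) (Fin n) ℝ) : frobNorm P = ‖frobVec P‖ := by
  rw [EuclideanSpace.norm_eq, frobNorm, Fintype.sum_prod_type]
  simp [frobVec]

lemma frobVec_injective : Function.Injective (frobVec (n := n)) := by
  intro P Q h
  ext i j
  exact congrFun (congrArg WithLp.ofLp h) (i, j)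

lemma continuous_frobNorm : Continuous (frobNorm (n := n)) := by
  unfold frobNorm
  refine Real.continuous_sqrt.comp ?_
  refine continuous_finsetSum _ fun i _ => continuous_finsetSum _ fun j _ => ?_
  exact ((continuous_apply j).comp (continuous_apply i)).pow 2

lemma frobNorm_combo_le {a b : ℝ} (ha : 0 ≤ a) (hb : 0 ≤ b) (P Q : Matrix (Fin n) (Fin n) ℝ) :
    frobNorm (a • P + b • Q) ≤ a * frobNorm P + b * frobNorm Q := by
  simp only [frobNorm_eq, map_add, map_smul]
  refine (norm_add_le _ _).trans ?_
  rw [norm_smul, norm_smul, Real.norm_of_nonneg ha, Real.norm_of_nonneg hb]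

lemma frobNorm_smul {a : ℝ} (ha : 0 ≤ a) (P : Matrix (Fin n) (Fin n) ℝ) :
    frobNorm (a • P) = a * frobNorm P := by
  simp only [frobNorm_eq, map_smul, norm_smul, Real.norm_of_nonneg ha]

lemma frobNorm_one : frobNorm (1 : Matrix (Fin n) (Fin n) ℝ) = √(n : ℝ) := by
  simp [frobNorm, Matrix.one_apply]

lemma abs_le_frobNorm (P : Matrix (Fin n) (Fin n) ℝ) (i j : Fin n) : |P i j| ≤ frobNorm P := by
  rw [frobNorm_eq]
  exact PiLp.norm_apply_le (frobVec P) (i, j)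

/-- Strict convexity of the Frobenius norm, by the parallelogram law. It makes the second
lexicographic objective select a single matrix. -/
lemma eq_of_frobNorm_midpoint {P Q : Matrix (Fin n) (Fin n) ℝ} (h : frobNorm P = frobNorm Q)
    (hm : frobNorm P ≤ frobNorm ((1 / 2 : ℝ) • P + (1 / 2 : ℝ) • Q)) : P = Q := by
  apply frobVec_injective
  rw [← smul_add, frobNorm_smul (by norm_num)] at hm
  simp only [frobNorm_eq, map_add] at h hm
  have hp := parallelogram_law_with_norm ℝ (frobVec P) (frobVec Q)
  rw [← h] at hp
  have h0 := norm_nonneg (frobVec P)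
  have h1 := norm_nonneg (frobVec P - frobVec Q)
  have : ‖frobVec P - frobVec Q‖ = 0 := by nlinarith
  exact sub_eq_zero.mp (norm_eq_zero.mp this)

/-! ### The admissible matrices -/

/-- The matrices `P ⪰ I` with `‖P‖_F ≤ C`. -/
def admissible (n : ℕ) (C : ℝ) : Set (Matrix (Fin n) (Fin n) ℝ) :=
  {P | (P - 1).PosSemidef ∧ frobNorm P ≤ C}

/-- The shifts s and t are kept apart because the cones used for Helly's theorem contain matrices
admissible at different scales. -/
lemma posSemidef_combo {a b : ℝ} (ha : 0 ≤ a) (hb : 0 ≤ b) {P Q : Matrix (Fin n) (Fin n) ℝ}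
    {s t : ℝ} (hP : (P - s • (1 : Matrix (Fin n) (Fin n) ℝ)).PosSemidef)
    (hQ : (Q - t • (1 : Matrix (Fin n) (Fin n) ℝ)).PosSemidef) :
    (a • P + b • Q - (a * s + b * t) • (1 : Matrix (Fin n) (Fin n) ℝ)).PosSemidef := by
  have := (hP.smul ha).add (hQ.smul hb)
  convert this using 1
  module

lemma admissible_combo {C a b : ℝ} (ha : 0 ≤ a) (hb : 0 ≤ b) (hab : a + b = 1)
    {P Q : Matrix (Fin n) (Fin n) ℝ} (hP : P ∈ admissible n C) (hQ : Q ∈ admissible n C) :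
    a • P + b • Q ∈ admissible n C := by
  constructor
  · have := posSemidef_combo (s := 1) (t := 1) ha hb (by simpa using hP.1) (by simpa using hQ.1)
    simpa [hab] using this
  · refine (frobNorm_combo_le ha hb P Q).trans ?_
    have h1 := mul_le_mul_of_nonneg_left hP.2 ha
    have h2 := mul_le_mul_of_nonneg_left hQ.2 hb
    calc _ ≤ a * C + b * C := add_le_add h1 h2
      _ = C := by rw [← add_mul, hab, one_mul]

lemma one_mem_admissible {C : ℝ} (hC : √(n : ℝ) ≤ C) :
    (1 : Matrix (Fin n) (Fin n) ℝ) ∈ admissible n C :=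
  ⟨by simpa using Matrix.PosSemidef.zero, by rwa [frobNorm_one]⟩

lemma isClosed_setOf_posSemidef : IsClosed {P : Matrix (Fin n) (Fin n) ℝ | P.PosSemidef} := by
  simp only [Matrix.posSemidef_iff_dotProduct_mulVec, Set.ofPred_and, Set.ofPred_forall]
  refine IsClosed.inter ?_ (isClosed_iInter fun x => ?_)
  · exact isClosed_eq (continuous_id.matrix_conjTranspose) continuous_id
  · exact isClosed_le continuous_const
      (continuous_const.dotProduct (continuous_id.matrix_mulVec continuous_const))

lemma isClosed_admissible (C : ℝ) : IsClosed (admissible n C) :=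
  (isClosed_setOf_posSemidef.preimage (continuous_id.sub continuous_const)).inter
    (isClosed_le continuous_frobNorm continuous_const)

lemma isCompact_admissible (C : ℝ) : IsCompact (admissible n C) := by
  have hK : IsCompact (Set.pi Set.univ fun _ : Fin n => Set.pi Set.univ fun _ : Fin n =>
      Set.Icc (-C) C) :=
    isCompact_univ_pi fun _ => isCompact_univ_pi fun _ => isCompact_Icc
  refine IsCompact.of_isClosed_subset hK (isClosed_admissible C) ?_
  intro P hP i _ j _
  exact abs_le.mp ((abs_le_frobNorm P i j).trans hP.2)

/-! ### The sampled program over a set of samples -/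

/-- The end point `A_σ x + w` of the sampled trajectory. -/
def response (A : Fin m → Matrix (Fin n) (Fin n) ℝ) (z : Sample n m l) :
    EuclideanSpace ℝ (Fin n) :=
  Matrix.toEuclideanCLM (n := Fin n) (𝕜 := ℝ) (wordProd A z.2.1) z.1.1 + z.2.2

/-- The slack of the constraint of the sample `z`; it is linear in `P`. -/
def slack (A : Fin m → Matrix (Fin n) (Fin n) ℝ) (z : Sample n m l) (lam : ℝ)
    (P : Matrix (Fin n) (Fin n) ℝ) : ℝ :=
  quadForm P (response A z) - (lam ^ l) ^ 2 * quadForm P z.1.1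

variable (A : Fin m → Matrix (Fin n) (Fin n) ℝ) {C : ℝ}

lemma slack_combo (z : Sample n m l) (lam a b : ℝ) (P Q : Matrix (Fin n) (Fin n) ℝ) :
    slack A z lam (a • P + b • Q) = a * slack A z lam P + b * slack A z lam Q := by
  simp only [slack, quadForm_add, quadForm_smul]
  ring

lemma slack_smul (z : Sample n m l) (lam a : ℝ) (P : Matrix (Fin n) (Fin n) ℝ) :
    slack A z lam (a • P) = a * slack A z lam P := by
  simp only [slack, quadForm_smul]
  ring

lemma one_le_quadForm_state {P : Matrix (Fin n) (Fin n) ℝ} (hP : (P - 1).PosSemidef)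
    (z : Sample n m l) : 1 ≤ quadForm P z.1.1 := by
  have := sq_norm_le_quadForm hP z.1.1
  simpa using this

/-- Both sides are nonnegative, so squaring loses nothing and yields a condition linear in P. -/
lemma quadNorm_le_iff_slack {P : Matrix (Fin n) (Fin n) ℝ} (hP : (P - 1).PosSemidef)
    {lam : ℝ} (hlam : 0 ≤ lam) (z : Sample n m l) :
    quadNorm P (response A z) ≤ lam ^ l * quadNorm P z.1.1 ↔ slack A z lam P ≤ 0 := by
  have h1 := one_le_quadForm_state hP z
  have h2 := (sq_nonneg _).trans (sq_norm_le_quadForm hP (response A z))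
  rw [quadNorm_eq_sqrt, quadNorm_eq_sqrt, Real.sqrt_le_left (by positivity), mul_pow,
    Real.sq_sqrt (by linarith), slack, sub_nonpos]

/-- Strictness comes from the state lying on the unit sphere, where xᵀ P x ≥ 1. -/
lemma slack_lt_slack (hl : 0 < l) {P : Matrix (Fin n) (Fin n) ℝ} (hP : (P - 1).PosSemidef)
    {s t : ℝ} (hs : 0 ≤ s) (hst : s < t) (z : Sample n m l) :
    slack A z t P < slack A z s P := by
  have h1 := one_le_quadForm_state hP z
  have h2 : s ^ l < t ^ l := pow_lt_pow_left₀ hst hs hl.ne'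
  have h3 : (s ^ l) ^ 2 < (t ^ l) ^ 2 := pow_lt_pow_left₀ h2 (by positivity) two_ne_zero
  unfold slack
  nlinarith

lemma continuous_response : Continuous (response A : Sample n m l → _) := by
  have h : Continuous fun p : (Fin l → Fin m) × EuclideanSpace ℝ (Fin n) =>
      Matrix.toEuclideanCLM (n := Fin n) (𝕜 := ℝ) (wordProd A p.1) p.2 :=
    continuous_prod_of_discrete_left.mpr fun s =>
      (Matrix.toEuclideanCLM (n := Fin n) (𝕜 := ℝ) (wordProd A s)).continuous
  have h2 : Continuous fun z : Sample n m l => (z.2.1, z.1.1) := by fun_prop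
  have h3 : Continuous fun z : Sample n m l => z.2.2 := by fun_prop
  exact (h.comp h2).add h3

lemma continuous_slack {X : Type*} [TopologicalSpace X] {f : X → Sample n m l} {g : X → ℝ}
    {h : X → Matrix (Fin n) (Fin n) ℝ} (hf : Continuous f) (hg : Continuous g)
    (hh : Continuous h) : Continuous fun x => slack A (f x) (g x) (h x) := by
  have h1 : Continuous fun x => response A (f x) := (continuous_response A).comp hf
  have h2 : Continuous fun x => (f x).1.1 := by fun_prop
  exact (continuous_quadForm hh h1).sub (((hg.pow l).pow 2).mul (continuous_quadForm hh h2))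

/-- Feasible points for the constraints of the samples in `T`. -/
def FeasibleOn (C : ℝ) (T : Set (Sample n m l)) (q : ℝ × Matrix (Fin n) (Fin n) ℝ) : Prop :=
  0 ≤ q.1 ∧ q.2 ∈ admissible n C ∧ ∀ z ∈ T, slack A z q.1 q.2 ≤ 0

/-- Lexicographically optimal points for the constraints of the samples in `T`. -/
def OptimalOn (C : ℝ) (T : Set (Sample n m l)) (q : ℝ × Matrix (Fin n) (Fin n) ℝ) : Prop :=
  FeasibleOn A C T q ∧ ∀ q', FeasibleOn A C T q' →
    q.1 < q'.1 ∨ (q.1 = q'.1 ∧ frobNorm q.2 ≤ frobNorm q'.2)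

lemma isFeasible_iff {N : ℕ} (ω : Fin N → Sample n m l) (q : ℝ × Matrix (Fin n) (Fin n) ℝ) :
    IsFeasible A C ω q ↔ FeasibleOn A C (Set.range ω) q := by
  simp only [IsFeasible, FeasibleOn, admissible, Set.mem_ofPred_eq, Set.forall_mem_range]
  constructor
  · rintro ⟨h0, h1, h2, h3⟩
    exact ⟨h0, ⟨h1, h2⟩, fun i => (quadNorm_le_iff_slack A h1 h0 _).mp (h3 i)⟩
  · rintro ⟨h0, ⟨h1, h2⟩, h3⟩
    exact ⟨h0, h1, h2, fun i => (quadNorm_le_iff_slack A h1 h0 _).mpr (h3 i)⟩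

lemma isOptimal_iff {N : ℕ} (ω : Fin N → Sample n m l) (q : ℝ × Matrix (Fin n) (Fin n) ℝ) :
    IsOptimal A C ω q ↔ OptimalOn A C (Set.range ω) q := by
  simp only [IsOptimal, OptimalOn, isFeasible_iff]

/-- Two optima share λ and the Frobenius norm. Their midpoint is feasible for the same λ because the
slack is linear in P, and strict convexity of the norm forces equality. -/
lemma OptimalOn.unique {T : Set (Sample n m l)} {q q' : ℝ × Matrix (Fin n) (Fin n) ℝ}
    (h : OptimalOn A C T q) (h' : OptimalOn A C T q') : q = q' := by
  have hle := h.2 q' h'.1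
  have hle' := h'.2 q h.1
  have h1 : q.1 = q'.1 := by rcases hle with a | a <;> rcases hle' with b | b <;> linarith [a, b]
  have h2 : frobNorm q.2 = frobNorm q'.2 := by
    rcases hle with a | a
    · exact absurd a (by simp [h1])
    rcases hle' with b | b
    · exact absurd b (by simp [h1])
    exact le_antisymm a.2 b.2
  have hmid : FeasibleOn A C T (q.1, (1 / 2 : ℝ) • q.2 + (1 / 2 : ℝ) • q'.2) := by
    refine ⟨h.1.1, admissible_combo (by norm_num) (by norm_num) (by norm_num) h.1.2.1 h'.1.2.1,
      fun z hz => ?_⟩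
    have a := h.1.2.2 z hz
    have b := h'.1.2.2 z hz
    rw [← h1] at b
    rw [slack_combo]
    linarith
  refine Prod.ext h1 (eq_of_frobNorm_midpoint h2 ?_)
  rcases h.2 _ hmid with a | a
  · exact absurd a (lt_irrefl _)
  · exact a.2

lemma exists_feasibleOn (hl : 0 < l) (hC : √(n : ℝ) ≤ C) {T : Set (Sample n m l)}
    (hT : T.Finite) : ∃ lam, FeasibleOn A C T (lam, 1) := by
  obtain ⟨c, hc⟩ := (hT.image fun z : Sample n m l => quadForm 1 (response A z)).bddAbove
  -- With P = I and λ = max(c, 1) one has λ^(2l) ≥ λ ≥ c, where c bounds the finitely many squared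
  -- responses.
  refine ⟨max c 1, by positivity, one_mem_admissible hC, fun z hz => ?_⟩
  have h1 := hc (Set.mem_image_of_mem _ hz)
  have h3 : (1 : ℝ) ≤ max c 1 := le_max_right _ _
  have h4 : max c 1 ≤ (max c 1) ^ l := le_self_pow₀ h3 hl.ne'
  have h5 : (max c 1) ^ l ≤ ((max c 1) ^ l) ^ 2 := le_self_pow₀ (h3.trans h4) two_ne_zero
  have h6 : quadForm 1 z.1.1 = 1 := by rw [quadForm_one]; simp
  have h7 := le_max_left c 1
  simp only [slack, h6]
  linarith

lemma isClosed_feasibleOn (T : Set (Sample n m l)) : IsClosed {q | FeasibleOn A C T q} := by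
  simp only [FeasibleOn, Set.ofPred_and, Set.ofPred_forall]
  refine (isClosed_le continuous_const continuous_fst).inter
    (((isClosed_admissible C).preimage continuous_snd).inter ?_)
  refine isClosed_iInter fun z => isClosed_iInter fun _ => ?_
  exact isClosed_le (continuous_slack A continuous_const continuous_fst continuous_snd)
    continuous_const

/-- Two successive minimizations over compact sets: λ is cut off at a known feasible value b, and
the norm is minimized over the optimal slice. -/
lemma exists_optimalOn (hl : 0 < l) (hC : √(n : ℝ) ≤ C) {T : Set (Sample n m l)}
    (hT : T.Finite) : ∃ q, OptimalOn A C T q := by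
  obtain ⟨b, hb⟩ := exists_feasibleOn A hl hC hT
  have hK : IsCompact ({q | FeasibleOn A C T q} ∩ Set.Icc 0 b ×ˢ admissible n C) :=
    (isCompact_Icc.prod (isCompact_admissible C)).inter_left (isClosed_feasibleOn A T)
  obtain ⟨p, hp, hpmin⟩ := hK.exists_isMinOn ⟨(b, 1), hb, ⟨hb.1, le_rfl⟩, hb.2.1⟩
    continuous_fst.continuousOn
  have hpmin' : ∀ q, FeasibleOn A C T q → p.1 ≤ q.1 := by
    intro q hq
    by_cases hqb : q.1 ≤ b
    · exact hpmin ⟨hq, ⟨hq.1, hqb⟩, hq.2.1⟩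
    · exact hp.2.1.2.trans (not_le.mp hqb).le
  have hK2 : IsCompact ({q | FeasibleOn A C T q} ∩ {p.1} ×ˢ admissible n C) :=
    (isCompact_singleton.prod (isCompact_admissible C)).inter_left (isClosed_feasibleOn A T)
  obtain ⟨q, hq, hqmin⟩ := hK2.exists_isMinOn ⟨p, hp.1, rfl, hp.1.2.1⟩
    (continuous_frobNorm.comp continuous_snd).continuousOn
  refine ⟨q, hq.1, fun q' hq' => ?_⟩
  have hqp : q.1 = p.1 := hq.2.1
  rw [hqp]
  rcases (hpmin' q' hq').lt_or_eq with h | h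
  · exact Or.inl h
  · exact Or.inr ⟨h, hqmin ⟨hq', h.symm, hq'.2.1⟩⟩

theorem existsUnique_optimalOn (hl : 0 < l) (hC : √(n : ℝ) ≤ C) {T : Set (Sample n m l)}
    (hT : T.Finite) : ∃! q, OptimalOn A C T q := by
  obtain ⟨q, hq⟩ := exists_optimalOn A hl hC hT
  exact ⟨q, hq, fun q' hq' => OptimalOn.unique A hq' hq⟩

/-- Some admissible matrix improves lexicographically on the value `(lam, r)`. -/
def Improvable (C : ℝ) (T : Set (Sample n m l)) (lam r : ℝ) : Prop :=
  ∃ Q ∈ admissible n C, (0 < lam ∧ ∀ z ∈ T, slack A z lam Q < 0) ∨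
    ((∀ z ∈ T, slack A z lam Q ≤ 0) ∧ frobNorm Q < r)

/-- Finitely many strict inequalities survive a small decrease of λ, and 0 < λ keeps the decreased
value nonnegative. Improvement can thus be tested at the current λ, where everything is convex in P.
-/
lemma OptimalOn.not_improvable {T : Set (Sample n m l)} (hT : T.Finite)
    {q : ℝ × Matrix (Fin n) (Fin n) ℝ} (h : OptimalOn A C T q) :
    ¬ Improvable A C T q.1 (frobNorm q.2) := by
  rintro ⟨Q, hQ, ⟨hpos, hlt⟩ | ⟨hle, hr⟩⟩
  · have hev : ∀ᶠ t in 𝓝[<] q.1, ∀ z ∈ T, slack A z t Q < 0 := by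
      refine (hT.eventually_all).mpr fun z hz => ?_
      have hc : Continuous fun t => slack A z t Q :=
        continuous_slack A continuous_const continuous_id continuous_const
      exact nhdsWithin_le_nhds ((hc.tendsto q.1).eventually_lt_const (hlt z hz))
    have hev2 : ∀ᶠ t in 𝓝[<] q.1, 0 < t := nhdsWithin_le_nhds (lt_mem_nhds hpos)
    obtain ⟨t, ⟨h1, h2⟩, h3⟩ := ((hev.and hev2).and self_mem_nhdsWithin).exists
    have h3' : t < q.1 := h3
    rcases h.2 (t, Q) ⟨h2.le, hQ, fun z hz => (h1 z hz).le⟩ with a | a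
    · exact absurd a (not_lt.mpr h3'.le)
    · exact absurd a.1 h3'.ne'
  · rcases h.2 (q.1, Q) ⟨h.1.1, hQ, hle⟩ with a | a
    · exact absurd a (lt_irrefl _)
    · exact absurd a.2 (not_le.mpr hr)

/-- Conversely, a competitor with smaller λ has strict slack at the current λ by `slack_lt_slack`.
-/
lemma FeasibleOn.optimalOn (hl : 0 < l) {T : Set (Sample n m l)}
    {q : ℝ × Matrix (Fin n) (Fin n) ℝ} (hq : FeasibleOn A C T q)
    (h : ¬ Improvable A C T q.1 (frobNorm q.2)) : OptimalOn A C T q := by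
  refine ⟨hq, fun q' hq' => ?_⟩
  by_contra hcon
  push Not at hcon
  refine h ⟨q'.2, hq'.2.1, ?_⟩
  rcases hcon.1.lt_or_eq with hlt | heq
  · exact Or.inl ⟨hq'.1.trans_lt hlt, fun z hz =>
      (slack_lt_slack A hl hq'.2.1.1 hq'.1 hlt z).trans_le (hq'.2.2 z hz)⟩
  · refine Or.inr ⟨fun z hz => ?_, hcon.2 heq.symm⟩
    rw [← heq]
    exact hq'.2.2 z hz

lemma OptimalOn.mono {S T : Set (Sample n m l)} (hST : S ⊆ T)
    {q : ℝ × Matrix (Fin n) (Fin n) ℝ} (h : OptimalOn A C S q)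
    (hq : ∀ z ∈ T, slack A z q.1 q.2 ≤ 0) : OptimalOn A C T q :=
  ⟨⟨h.1.1, h.1.2.1, hq⟩, fun q' hq' =>
    h.2 q' ⟨hq'.1, hq'.2.1, fun z hz => hq'.2.2 z (hST hz)⟩⟩

/-- Inactive constraints can be dropped without changing the optimum. -/
lemma OptimalOn.of_active (hl : 0 < l) {S T : Set (Sample n m l)} (hT : T.Finite) (hST : S ⊆ T)
    {q : ℝ × Matrix (Fin n) (Fin n) ℝ} (h : OptimalOn A C T q)
    (hact : ∀ z ∈ T, slack A z q.1 q.2 = 0 → z ∈ S) : OptimalOn A C S q := by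
  refine FeasibleOn.optimalOn A hl ⟨h.1.1, h.1.2.1, fun z hz => h.1.2.2 z (hST hz)⟩ ?_
  rintro ⟨Q, hQ, hcase⟩
  refine OptimalOn.not_improvable A hT h ?_
  -- A small step from the optimum towards an improvement Q for S keeps the strict slack of the
  -- samples outside S, while on S it inherits the improvement by convexity; so it would improve for
  -- all of T.
  have hev : ∀ᶠ t : ℝ in 𝓝[>] 0, ∀ z ∈ T, z ∉ S →
      slack A z q.1 ((1 - t) • q.2 + t • Q) < 0 := by
    refine (hT.eventually_all).mpr fun z hz => ?_
    by_cases hzS : z ∈ S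
    · simp [hzS]
    simp only [hzS, not_false_eq_true, forall_const, slack_combo]
    have hc : Continuous fun t : ℝ => (1 - t) * slack A z q.1 q.2 + t * slack A z q.1 Q := by
      fun_prop
    have hneg : slack A z q.1 q.2 < 0 :=
      (h.1.2.2 z hz).lt_of_ne fun h0 => hzS (hact z hz h0)
    refine nhdsWithin_le_nhds ((hc.tendsto 0).eventually_lt_const (by simpa using hneg))
  have hev1 : ∀ᶠ t : ℝ in 𝓝[>] 0, t < 1 := nhdsWithin_le_nhds (gt_mem_nhds one_pos)
  obtain ⟨t, ⟨ht, ht1⟩, ht0⟩ := ((hev.and hev1).and self_mem_nhdsWithin).exists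
  replace ht0 : 0 < t := ht0
  refine ⟨(1 - t) • q.2 + t • Q,
    admissible_combo (by linarith) ht0.le (by ring) h.1.2.1 hQ, ?_⟩
  rcases hcase with ⟨hpos, hlt⟩ | ⟨hle, hr⟩
  · refine Or.inl ⟨hpos, fun z hz => ?_⟩
    by_cases hzS : z ∈ S
    · rw [slack_combo]
      have := hlt z hzS
      have := h.1.2.2 z hz
      nlinarith
    · exact ht z hz hzS
  · refine Or.inr ⟨fun z hz => ?_, ?_⟩
    · by_cases hzS : z ∈ S
      · rw [slack_combo]
        have := hle z hzS
        have := h.1.2.2 z hz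
        nlinarith
      · exact (ht z hz hzS).le
    · refine (frobNorm_combo_le (by linarith) ht0.le _ _).trans_lt ?_
      nlinarith

end

section

variable {n m l : ℕ}

/-! ### A basis of at most `n(n+1)/2` constraints -/

/-- The symmetric matrix with the given entries on unordered pairs. -/
def symMatrix (n : ℕ) : (Sym2 (Fin n) → ℝ) →ₗ[ℝ] Matrix (Fin n) (Fin n) ℝ where
  toFun p := Matrix.of fun i j => p s(i, j)
  map_add' p q := by ext i j; simp
  map_smul' c p := by ext i j; simp

lemma exists_symMatrix_eq {P : Matrix (Fin n) (Fin n) ℝ} (hP : P.IsHermitian) :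
    ∃ p, symMatrix n p = P := by
  refine ⟨Sym2.lift ⟨fun i j => P i j, fun i j => ?_⟩, ?_⟩
  · simpa using hP.apply j i
  · ext i j
    simp [symMatrix]

lemma finrank_sym2 (n : ℕ) : Module.finrank ℝ (Sym2 (Fin n) → ℝ) = symDim n := by
  rw [Module.finrank_fintype_fun_eq_card, Sym2.card, Fintype.card_fin, Nat.choose_two_right,
    Nat.add_sub_cancel, symDim, mul_comm]

lemma symDim_pos (hn : 0 < n) : 0 < symDim n := by
  rw [symDim]
  exact Nat.div_pos (by nlinarith) two_pos

/-- The trace of a symmetric matrix given by its entries on unordered pairs. -/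
def symTrace (n : ℕ) : (Sym2 (Fin n) → ℝ) →ₗ[ℝ] ℝ :=
  (Matrix.traceLinearMap (Fin n) ℝ ℝ).comp (symMatrix n)

lemma symTrace_apply (p : Sym2 (Fin n) → ℝ) : symTrace n p = (symMatrix n p).trace := rfl

/-- The trace-one slice has dimension d - 1, so its Helly number is d. Without this normalization
one would get d + 1. -/
lemma finrank_ker_symTrace (hn : 0 < n) :
    Module.finrank ℝ (LinearMap.ker (symTrace n)) + 1 = symDim n := by
  rw [← finrank_sym2]
  refine Module.Dual.finrank_ker_add_one_of_ne_zero (f := symTrace n) fun h => ?_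
  obtain ⟨p, hp⟩ := exists_symMatrix_eq (Matrix.isHermitian_one (n := Fin n) (α := ℝ))
  have := symTrace_apply p
  rw [h, hp, Matrix.trace_one, Fintype.card_fin, LinearMap.zero_apply] at this
  exact hn.ne (by exact_mod_cast this)

variable (A : Fin m → Matrix (Fin n) (Fin n) ℝ) {C : ℝ}

/-- The matrices proportional to an admissible matrix that improves on `(lam, r)` as far as the
sample `z` is concerned. -/
def improvingCone (C lam r : ℝ) (z : Sample n m l) : Set (Matrix (Fin n) (Fin n) ℝ) :=
  {P | ∃ s : ℝ, 0 < s ∧ (P - s • (1 : Matrix (Fin n) (Fin n) ℝ)).PosSemidef ∧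
    frobNorm P ≤ C * s ∧
    ((0 < lam ∧ slack A z lam P < 0) ∨ (slack A z lam P ≤ 0 ∧ frobNorm P < r * s))}

/-- The disjunction survives convex combinations with positive weights: if either matrix has strict
slack, so has the mixture; otherwise both norm inequalities are strict and add up. -/
lemma convex_improvingCone (C lam r : ℝ) (z : Sample n m l) :
    Convex ℝ (improvingCone A C lam r z) := by
  rw [convex_iff_forall_pos]
  rintro P ⟨s, hs, hPs, hPC, hP⟩ Q ⟨t, ht, hQt, hQC, hQ⟩ a b ha hb hab
  have hnorm := frobNorm_combo_le ha.le hb.le P Q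
  refine ⟨a * s + b * t, by positivity, posSemidef_combo ha.le hb.le hPs hQt, ?_, ?_⟩
  · refine hnorm.trans ?_
    have h1 := mul_le_mul_of_nonneg_left hPC ha.le
    have h2 := mul_le_mul_of_nonneg_left hQC hb.le
    linarith
  · rw [slack_combo]
    rcases hP with ⟨hlam, hP⟩ | ⟨hP, hPr⟩
    · have h1 := mul_neg_of_pos_of_neg ha hP
      have hQ' : slack A z lam Q ≤ 0 := by rcases hQ with h | h <;> linarith [h.1, h.2]
      have h2 := mul_nonpos_of_nonneg_of_nonpos hb.le hQ'
      exact Or.inl ⟨hlam, by linarith⟩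
    · have h1 := mul_nonpos_of_nonneg_of_nonpos ha.le hP
      rcases hQ with ⟨hlam, hQ⟩ | ⟨hQ, hQr⟩
      · have h2 := mul_neg_of_pos_of_neg hb hQ
        exact Or.inl ⟨hlam, by linarith⟩
      · have h2 := mul_nonpos_of_nonneg_of_nonpos hb.le hQ
        have h3 := mul_lt_mul_of_pos_left hPr ha
        have h4 := mul_lt_mul_of_pos_left hQr hb
        exact Or.inr ⟨by linarith, by linarith⟩

lemma smul_mem_improvingCone {C lam r c : ℝ} (hc : 0 < c) {z : Sample n m l}
    {P : Matrix (Fin n) (Fin n) ℝ} (hP : P ∈ improvingCone A C lam r z) :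
    c • P ∈ improvingCone A C lam r z := by
  obtain ⟨s, hs, hPs, hPC, hP⟩ := hP
  refine ⟨c * s, by positivity, ?_, ?_, ?_⟩
  · have := hPs.smul hc.le
    rwa [smul_sub, smul_smul] at this
  · rw [frobNorm_smul hc.le]
    have := mul_le_mul_of_nonneg_left hPC hc.le
    linarith
  · rw [frobNorm_smul hc.le, slack_smul]
    rcases hP with ⟨hlam, hP⟩ | ⟨hP, hPr⟩
    · exact Or.inl ⟨hlam, mul_neg_of_pos_of_neg hc hP⟩
    · have := mul_lt_mul_of_pos_left hPr hc
      exact Or.inr ⟨mul_nonpos_of_nonneg_of_nonpos hc.le hP, by linarith⟩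

/-- Each sample may certify P with its own scale; dividing by the largest scale works for all. If
some sample uses the norm alternative, its strict norm bound passes to the largest scale since r ≥
0; if none does, all slacks are strict. -/
lemma improvable_of_mem_improvingCone {ι : Type*} [Finite ι] [Nonempty ι] {lam r : ℝ}
    (hr : 0 ≤ r) (ω : ι → Sample n m l) {P : Matrix (Fin n) (Fin n) ℝ}
    (hP : ∀ i, P ∈ improvingCone A C lam r (ω i)) :
    Improvable A C (Set.range ω) lam r := by
  choose s hs hPs hPC hcase using hP
  obtain ⟨i₀, hi₀⟩ := Finite.exists_max s
  have hs0 := hs i₀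
  have hinv : 0 < (s i₀)⁻¹ := inv_pos.mpr hs0
  have hnorm : frobNorm ((s i₀)⁻¹ • P) = (s i₀)⁻¹ * frobNorm P := frobNorm_smul hinv.le P
  refine ⟨(s i₀)⁻¹ • P, ⟨?_, ?_⟩, ?_⟩
  · have := (hPs i₀).smul hinv.le
    rwa [smul_sub, smul_smul, inv_mul_cancel₀ hs0.ne', one_smul] at this
  · rw [hnorm, inv_mul_le_iff₀ hs0, mul_comm]
    exact hPC i₀
  · simp only [Set.forall_mem_range, slack_smul, hnorm]
    by_cases hall : ∃ i, slack A (ω i) lam P ≤ 0 ∧ frobNorm P < r * s i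
    · obtain ⟨i, -, hi⟩ := hall
      refine Or.inr ⟨fun j => ?_, ?_⟩
      · refine mul_nonpos_of_nonneg_of_nonpos hinv.le ?_
        rcases hcase j with h | h <;> linarith [h.1, h.2]
      · rw [inv_mul_lt_iff₀ hs0, mul_comm]
        exact hi.trans_le (mul_le_mul_of_nonneg_left (hi₀ i) hr)
    · push Not at hall
      have h1 : ∀ i, 0 < lam ∧ slack A (ω i) lam P < 0 := fun i =>
        (hcase i).resolve_right fun h => absurd h.2 (not_lt.mpr (hall i h.1))
      exact Or.inl ⟨(h1 i₀).1, fun i => mul_neg_of_pos_of_neg hinv (h1 i).2⟩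

/-- Were q optimal for no d samples, it would be improvable on every d of them, being feasible
there. So any d of the improving cones meet, hence all of them do, and q would be improvable for the
whole family. -/
theorem OptimalOn.exists_card_eq (hn : 0 < n) (hl : 0 < l) {ι : Type*} [Fintype ι]
    (ω : ι → Sample n m l) (hcard : symDim n ≤ Fintype.card ι)
    {q : ℝ × Matrix (Fin n) (Fin n) ℝ} (hq : OptimalOn A C (Set.range ω) q) :
    ∃ I : Finset ι, I.card = symDim n ∧ OptimalOn A C (ω '' I) q := by
  by_contra hcon
  push Not at hcon
  have hne : Nonempty ι := Fintype.card_pos_iff.mp ((symDim_pos hn).trans_le hcard)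
  obtain ⟨p₀, hp₀⟩ := exists_symMatrix_eq (P := (n : ℝ)⁻¹ • (1 : Matrix (Fin n) (Fin n) ℝ))
    (by ext i j; simp [Matrix.one_apply, eq_comm])
  have hp₀t : symTrace n p₀ = 1 := by
    rw [symTrace_apply, hp₀, Matrix.trace_smul, Matrix.trace_one, Fintype.card_fin, smul_eq_mul,
      inv_mul_cancel₀ (by positivity)]
  set r := frobNorm q.2
  -- Trace-one slices of the cones, translated by the base point p₀ into the linear space of
  -- trace-free symmetric matrices.
  let F : ι → Set (LinearMap.ker (symTrace n)) := fun i =>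
    {k | symMatrix n (p₀ + k) ∈ improvingCone A C q.1 r (ω i)}
  have hF : ∀ i ∈ Finset.univ, Convex ℝ (F i) := by
    intro i _ k hk k' hk' a b ha hb hab
    have := convex_improvingCone A C q.1 r (ω i) hk hk' ha hb hab
    change symMatrix n _ ∈ improvingCone A C q.1 r (ω i)
    convert this using 1
    rw [← map_smul, ← map_smul, ← map_add]
    congr 1
    have hp : p₀ = (a + b) • p₀ := by rw [hab, one_smul]
    nth_rewrite 1 [hp]
    push_cast
    module
  have hinter : ∀ I ⊆ (Finset.univ : Finset ι),
      I.card = Module.finrank ℝ (LinearMap.ker (symTrace n)) + 1 →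
      (⋂ i ∈ I, F i).Nonempty := by
    intro I _ hI
    rw [finrank_ker_symTrace hn] at hI
    have hnot := hcon I hI
    have himp : Improvable A C (ω '' I) q.1 r := by
      by_contra himp
      refine hnot (FeasibleOn.optimalOn A hl ⟨hq.1.1, hq.1.2.1, ?_⟩ himp)
      rintro _ ⟨i, -, rfl⟩
      exact hq.1.2.2 _ (Set.mem_range_self i)
    obtain ⟨Q, hQ, hcase⟩ := himp
    have hQU : ∀ i ∈ I, Q ∈ improvingCone A C q.1 r (ω i) := by
      intro i hi
      refine ⟨1, one_pos, by simpa using hQ.1, by simpa using hQ.2, ?_⟩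
      rcases hcase with ⟨h0, h⟩ | ⟨h, hr⟩
      · exact Or.inl ⟨h0, h _ ⟨i, hi, rfl⟩⟩
      · exact Or.inr ⟨h _ ⟨i, hi, rfl⟩, by simpa using hr⟩
    -- Q ⪰ I gives trace Q ≥ n > 0, so Q can be rescaled within the cones to trace one.
    have htr : 0 < Q.trace := by
      have h1 : 0 ≤ (Q - 1).trace := hQ.1.trace_nonneg
      rw [Matrix.trace_sub, Matrix.trace_one, Fintype.card_fin] at h1
      have : (0 : ℝ) < n := by exact_mod_cast hn
      linarith
    have hQh : (Q.trace⁻¹ • Q).IsHermitian := by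
      have : Q.IsHermitian := by
        have := hQ.1.1.add (Matrix.isHermitian_one (n := Fin n) (α := ℝ))
        rwa [sub_add_cancel] at this
      ext i j
      simpa using Or.inl (this.apply i j)
    obtain ⟨p, hp⟩ := exists_symMatrix_eq hQh
    have hpk : p - p₀ ∈ LinearMap.ker (symTrace n) := by
      rw [LinearMap.mem_ker, map_sub, hp₀t, symTrace_apply, hp, Matrix.trace_smul, smul_eq_mul,
        inv_mul_cancel₀ htr.ne', sub_self]
    refine ⟨⟨p - p₀, hpk⟩, ?_⟩
    simp only [Set.mem_iInter]
    intro i hi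
    change symMatrix n (p₀ + (p - p₀)) ∈ improvingCone A C q.1 r (ω i)
    rw [add_sub_cancel, hp]
    exact smul_mem_improvingCone A (inv_pos.mpr htr) (hQU i hi)
  obtain ⟨k, hk⟩ := Convex.helly_theorem
    (by rw [finrank_ker_symTrace hn, Finset.card_univ]; exact hcard) hF hinter
  simp only [Finset.mem_univ, Set.iInter_true, Set.mem_iInter] at hk
  exact OptimalOn.not_improvable A (Set.finite_range ω) hq
    (improvable_of_mem_improvingCone A (Real.sqrt_nonneg _) ω hk)

end

section

variable {n m l : ℕ} (A : Fin m → Matrix (Fin n) (Fin n) ℝ) {C : ℝ}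

/-! ### The optimum as a function of the samples, and its measurability -/

instance : SecondCountableTopology (Sample n m l) := inferInstance

instance : BorelSpace (Sample n m l) := inferInstance

/-- The optimal point for the samples in `T`. -/
def optimum (C : ℝ) (T : Set (Sample n m l)) : ℝ × Matrix (Fin n) (Fin n) ℝ :=
  Classical.epsilon fun q => OptimalOn A C T q

lemma optimalOn_optimum (hl : 0 < l) (hC : √(n : ℝ) ≤ C) {T : Set (Sample n m l)}
    (hT : T.Finite) : OptimalOn A C T (optimum A C T) :=
  Classical.epsilon_spec (exists_optimalOn A hl hC hT)

lemma OptimalOn.eq_optimum {T : Set (Sample n m l)} {q : ℝ × Matrix (Fin n) (Fin n) ℝ}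
    (h : OptimalOn A C T q) : optimum A C T = q :=
  OptimalOn.unique A (Classical.epsilon_spec ⟨q, h⟩) h

/-- Projection along a compact factor is a closed map. Measurability of the optimum is reduced to
closed sets of this form. -/
lemma isClosed_setOf_exists_mem {X Y : Type*} [TopologicalSpace X] [TopologicalSpace Y]
    {K : Set Y} (hK : IsCompact K) {F : Set (X × Y)} (hF : IsClosed F) :
    IsClosed {x | ∃ y ∈ K, (x, y) ∈ F} := by
  have : CompactSpace K := isCompact_iff_compactSpace.mp hK
  have hc : Continuous fun p : X × K => (p.1, (p.2 : Y)) := by fun_prop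
  have := isClosedMap_fst_of_compactSpace _ (hF.preimage hc)
  convert this using 1
  ext x
  simp

variable {ι : Type*}

lemma isClosed_setOf_slack_le :
    IsClosed {p : ((ι → Sample n m l) × ℝ) × Matrix (Fin n) (Fin n) ℝ |
      ∀ i, slack A (p.1.1 i) p.1.2 p.2 ≤ 0} := by
  rw [Set.ofPred_forall]
  refine isClosed_iInter fun i => isClosed_le ?_ continuous_const
  exact continuous_slack A (by fun_prop) (by fun_prop) continuous_snd

variable [Fintype ι]

/-- As slack decreases in λ, the optimal λ is at most c exactly when some admissible P is feasible
at c: a closed condition on the samples. -/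
lemma measurable_optimum_fst (hl : 0 < l) (hC : √(n : ℝ) ≤ C) :
    Measurable fun ω : ι → Sample n m l => (optimum A C (Set.range ω)).1 := by
  refine measurable_of_Iic fun c => ?_
  by_cases hc : 0 ≤ c
  · have hcl : IsClosed {ω : ι → Sample n m l | ∃ P ∈ admissible n C,
        (ω, P) ∈ {p : (ι → Sample n m l) × Matrix (Fin n) (Fin n) ℝ |
          ∀ i, slack A (p.1 i) c p.2 ≤ 0}} := by
      refine isClosed_setOf_exists_mem (isCompact_admissible C) ?_
      have hcont : Continuous fun p : (ι → Sample n m l) × Matrix (Fin n) (Fin n) ℝ =>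
        ((p.1, c), p.2) := by fun_prop
      exact (isClosed_setOf_slack_le A).preimage hcont
    convert hcl.measurableSet using 1
    ext ω
    have ho := optimalOn_optimum A hl hC (Set.finite_range ω)
    simp only [Set.mem_preimage, Set.mem_Iic, Set.mem_ofPred_eq]
    constructor
    · intro hle
      refine ⟨_, ho.1.2.1, fun i => ?_⟩
      have h1 := ho.1.2.2 _ (Set.mem_range_self i)
      rcases hle.lt_or_eq with h | h
      · exact (slack_lt_slack A hl ho.1.2.1.1 ho.1.1 h _).le.trans h1
      · rwa [h] at h1
    · rintro ⟨P, hP, h⟩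
      rcases ho.2 (c, P) ⟨hc, hP, by rintro _ ⟨i, rfl⟩; exact h i⟩ with h | h
      · exact h.le
      · exact h.1.le
  · convert MeasurableSet.empty using 1
    ext ω
    have ho := optimalOn_optimum A hl hC (Set.finite_range ω)
    simp only [Set.mem_preimage, Set.mem_Iic, Set.mem_empty_iff_false, iff_false, not_le]
    exact (not_le.mp hc).trans_le ho.1.1

/-- The optimal matrix lies in F exactly when, for every rational c, a feasible matrix of norm at
most c at the optimal λ can also be found in F. For the converse, compactness provides a feasible
matrix in F of minimal norm, and uniqueness identifies it with the optimum. -/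
lemma measurableSet_optimum_snd (hl : 0 < l) (hC : √(n : ℝ) ≤ C)
    {F : Set (Matrix (Fin n) (Fin n) ℝ)} (hF : IsClosed F) :
    MeasurableSet {ω : ι → Sample n m l | (optimum A C (Set.range ω)).2 ∈ F} := by
  let H : Set (Matrix (Fin n) (Fin n) ℝ) → ℚ → Set ((ι → Sample n m l) × ℝ) := fun F c =>
    {x | ∃ P ∈ admissible n C, (x, P) ∈ {p : ((ι → Sample n m l) × ℝ) × _ |
      (∀ i, slack A (p.1.1 i) p.1.2 p.2 ≤ 0) ∧ p.2 ∈ F ∧ frobNorm p.2 ≤ c}}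
  have hHcl : ∀ F, IsClosed F → ∀ c, IsClosed (H F c) := by
    intro F hF c
    refine isClosed_setOf_exists_mem (isCompact_admissible C) ?_
    exact (isClosed_setOf_slack_le A).inter ((hF.preimage continuous_snd).inter
      (isClosed_le (continuous_frobNorm.comp continuous_snd) continuous_const))
  let φ : (ι → Sample n m l) → (ι → Sample n m l) × ℝ := fun ω =>
    (ω, (optimum A C (Set.range ω)).1)
  have hφ : Measurable φ := measurable_id.prodMk (measurable_optimum_fst A hl hC)
  have key : {ω : ι → Sample n m l | (optimum A C (Set.range ω)).2 ∈ F} =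
      ⋂ c : ℚ, ((φ ⁻¹' H Set.univ c)ᶜ ∪ φ ⁻¹' H F c) := by
    ext ω
    have ho := optimalOn_optimum A hl hC (Set.finite_range ω)
    have hos : ∀ i, slack A (ω i) (optimum A C (Set.range ω)).1
      (optimum A C (Set.range ω)).2 ≤ 0 := fun i => ho.1.2.2 _ (Set.mem_range_self i)
    simp only [Set.mem_ofPred_eq, Set.mem_iInter, Set.mem_union, Set.mem_compl_iff,
      Set.mem_preimage, φ, H]
    constructor
    · intro hF c
      by_cases hc : frobNorm (optimum A C (Set.range ω)).2 ≤ c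
      · exact Or.inr ⟨_, ho.1.2.1, hos, hF, hc⟩
      · refine Or.inl ?_
        rintro ⟨P, hP, hs, -, hPc⟩
        rcases ho.2 (_, P) ⟨ho.1.1, hP, by rintro _ ⟨i, rfl⟩; exact hs i⟩ with h | h
        · exact lt_irrefl _ h
        · exact hc (h.2.trans hPc)
    · intro hall
      have hall' : ∀ c : ℚ, frobNorm (optimum A C (Set.range ω)).2 ≤ c →
          ∃ P ∈ admissible n C, (∀ i, slack A (ω i) (optimum A C (Set.range ω)).1 P ≤ 0) ∧
            P ∈ F ∧ frobNorm P ≤ c := fun c hc =>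
        (hall c).resolve_left fun h => h ⟨_, ho.1.2.1, hos, trivial, hc⟩
      have hK : IsCompact (admissible n C ∩
          ({P | ∀ i, slack A (ω i) (optimum A C (Set.range ω)).1 P ≤ 0} ∩ F)) := by
        refine (isCompact_admissible C).inter_right (IsClosed.inter ?_ hF)
        rw [Set.ofPred_forall]
        exact isClosed_iInter fun i => isClosed_le
          (continuous_slack A continuous_const continuous_const continuous_id) continuous_const
      obtain ⟨c₀, hc₀⟩ := exists_rat_gt (frobNorm (optimum A C (Set.range ω)).2)
      obtain ⟨P₀, hP₀, hP₀s, hP₀F, -⟩ := hall' c₀ hc₀.le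
      obtain ⟨P, hP, hmin⟩ := hK.exists_isMinOn ⟨P₀, hP₀, hP₀s, hP₀F⟩
        continuous_frobNorm.continuousOn
      have hPr : frobNorm P ≤ frobNorm (optimum A C (Set.range ω)).2 := by
        refine le_of_forall_gt_imp_ge_of_dense fun a ha => ?_
        obtain ⟨c, hc, hca⟩ := exists_rat_btwn ha
        obtain ⟨Q, hQ, hQs, hQF, hQc⟩ := hall' c hc.le
        exact ((hmin ⟨hQ, hQs, hQF⟩).trans hQc).trans hca.le
      have hopt : OptimalOn A C (Set.range ω) ((optimum A C (Set.range ω)).1, P) := by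
        refine ⟨⟨ho.1.1, hP.1, by rintro _ ⟨i, rfl⟩; exact hP.2.1 i⟩, fun q' hq' => ?_⟩
        exact (ho.2 q' hq').imp id fun h => ⟨h.1, hPr.trans h.2⟩
      rw [OptimalOn.eq_optimum A hopt]
      exact hP.2.2
  rw [key]
  exact MeasurableSet.iInter fun c => ((hφ (hHcl _ isClosed_univ c).measurableSet).compl).union
    (hφ (hHcl F hF c).measurableSet)

/-- No σ-algebra on M is assumed: measurability of g is stated through closed sets and the Borel
σ-algebra is introduced inside the proof. -/
lemma measurable_continuous_comp {X Y M : Type*} [MeasurableSpace X] [TopologicalSpace Y]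
    [MeasurableSpace Y] [OpensMeasurableSpace Y] [SecondCountableTopology Y] [TopologicalSpace M]
    [SecondCountableTopology M] {φ : Y × M → ℝ} (hφ : Continuous φ) {f : X → Y}
    (hf : Measurable f) {g : X → M} (hg : ∀ F, IsClosed F → MeasurableSet (g ⁻¹' F)) :
    Measurable fun x => φ (f x, g x) := by
  let _ : MeasurableSpace M := borel M
  have _ : BorelSpace M := ⟨rfl⟩
  exact hφ.measurable.comp (hf.prodMk (measurable_of_isClosed hg))

lemma measurable_slack_optimum (hl : 0 < l) (hC : √(n : ℝ) ≤ C) {X : Type*} [MeasurableSpace X]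
    {f : X → Sample n m l} (hf : Measurable f) {g : X → ι → Sample n m l} (hg : Measurable g) :
    Measurable fun x => slack A (f x) (optimum A C (Set.range (g x))).1
      (optimum A C (Set.range (g x))).2 := by
  have hM : SecondCountableTopology (Matrix (Fin n) (Fin n) ℝ) :=
    inferInstanceAs (SecondCountableTopology (Fin n → Fin n → ℝ))
  have hc : Continuous fun p : (Sample n m l × ℝ) × Matrix (Fin n) (Fin n) ℝ =>
      slack A p.1.1 p.1.2 p.2 := continuous_slack A (by fun_prop) (by fun_prop) continuous_snd
  have h1 : Measurable fun x => (f x, (optimum A C (Set.range (g x))).1) :=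
    hf.prodMk ((measurable_optimum_fst A hl hC).comp hg)
  exact measurable_continuous_comp hc h1 (g := fun x => (optimum A C (Set.range (g x))).2)
    fun F hF => hg (measurableSet_optimum_snd A hl hC hF)

end

/-! ### Absolutely continuous noise, nondegenerate samples and the canonical stable subfamily. -/

section

variable {n m l : ℕ}

/-! ### Factorization of positive semidefinite matrices -/

open scoped MatrixOrder in
lemma exists_eq_transpose_mul_self {P : Matrix (Fin n) (Fin n) ℝ} (hP : P.PosSemidef) :
    ∃ B : Matrix (Fin n) (Fin n) ℝ, P = B.transpose * B := by
  obtain ⟨B, hB⟩ := CStarAlgebra.nonneg_iff_eq_star_mul_self.mp (Matrix.nonneg_iff_posSemidef.mpr hP)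
  exact ⟨B, by rw [hB, Matrix.star_eq_conjTranspose, Matrix.conjTranspose_eq_transpose_of_trivial]⟩

lemma quadForm_transpose_mul_self (B : Matrix (Fin n) (Fin n) ℝ) (x : EuclideanSpace ℝ (Fin n)) :
    quadForm (B.transpose * B) x = ‖Matrix.toEuclideanCLM (n := Fin n) (𝕜 := ℝ) B x‖ ^ 2 := by
  rw [quadForm_eq_dotProduct, ← real_inner_self_eq_norm_sq,
    EuclideanSpace.inner_eq_star_dotProduct, Matrix.ofLp_toEuclideanCLM, ← Matrix.mulVec_mulVec,
    Matrix.dotProduct_mulVec, star_trivial, star_trivial, Matrix.vecMul_transpose]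

lemma posSemidef_of_sub_one {P : Matrix (Fin n) (Fin n) ℝ} (hP : (P - 1).PosSemidef) :
    P.PosSemidef := by
  simpa using hP.add Matrix.PosSemidef.one

lemma det_ne_zero_of_sub_one {P : Matrix (Fin n) (Fin n) ℝ} (hP : (P - 1).PosSemidef) :
    P.det ≠ 0 := by
  have : P.PosDef := by simpa using Matrix.PosDef.posSemidef_add hP Matrix.PosDef.one
  exact this.det_pos.ne'

lemma det_toEuclideanCLM (B : Matrix (Fin n) (Fin n) ℝ) :
    LinearMap.det (Matrix.toEuclideanCLM (n := Fin n) (𝕜 := ℝ) B : EuclideanSpace ℝ (Fin n) →ₗ[ℝ]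
      EuclideanSpace ℝ (Fin n)) = B.det := by
  rw [Matrix.coe_toEuclideanCLM_eq_toEuclideanLin]
  change LinearMap.det (Matrix.toLpLin 2 2 B) = _
  rw [Matrix.toLpLin_eq_toLin, LinearMap.det_toLin]

/-- Writing P = BᵀB with B invertible, the level set is contained in a translate of the preimage
under B of a sphere, and spheres are null. -/
lemma volume_setOf_quadForm_eq (hn : 0 < n) {P : Matrix (Fin n) (Fin n) ℝ}
    (hP : (P - 1).PosSemidef) (a : EuclideanSpace ℝ (Fin n)) (c : ℝ) :
    volume {w : EuclideanSpace ℝ (Fin n) | quadForm P (a + w) = c} = 0 := by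
  have : Nonempty (Fin n) := ⟨⟨0, hn⟩⟩
  obtain ⟨B, rfl⟩ := exists_eq_transpose_mul_self (posSemidef_of_sub_one hP)
  have hdet : B.det ≠ 0 := by
    intro h
    exact det_ne_zero_of_sub_one hP (by simp [h])
  set f : EuclideanSpace ℝ (Fin n) →ₗ[ℝ] EuclideanSpace ℝ (Fin n) :=
    (Matrix.toEuclideanCLM (n := Fin n) (𝕜 := ℝ) B :
      EuclideanSpace ℝ (Fin n) →ₗ[ℝ] EuclideanSpace ℝ (Fin n)) with hf
  have hsub : {w : EuclideanSpace ℝ (Fin n) | quadForm (B.transpose * B) (a + w) = c} ⊆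
      (fun w => a + w) ⁻¹' (f ⁻¹' Metric.sphere 0 (√c)) := by
    intro w hw
    have hw' : ‖f (a + w)‖ ^ 2 = c := by
      rw [← hw.out, quadForm_transpose_mul_self]; rfl
    simp only [Set.mem_preimage, mem_sphere_zero_iff_norm]
    rw [← hw', Real.sqrt_sq (norm_nonneg _)]
  refine measure_mono_null hsub ?_
  rw [measure_preimage_add, Measure.addHaar_preimage_linearMap volume
    (by rw [hf, det_toEuclideanCLM]; exact hdet), Measure.addHaar_sphere, mul_zero]

lemma volume_setOf_apply_eq (i : Fin n) (c : ℝ) :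
    volume {w : EuclideanSpace ℝ (Fin n) | w i = c} = 0 := by
  have h : {w : EuclideanSpace ℝ (Fin n) | w i = c} =
      (MeasurableEquiv.toLp 2 (Fin n → ℝ)).symm ⁻¹' {v | v i = c} := rfl
  rw [h, (EuclideanSpace.volume_preserving_symm_measurableEquiv_toLp (Fin n)).measure_preimage_equiv]
  exact Measure.pi_hyperplane (fun _ : Fin n => (volume : Measure ℝ)) i c

/-! ### The law of a sample -/

instance instIsProbabilityMeasureSphereUniform [NeZero n] :
    IsProbabilityMeasure (sphereUniform n) := by
  have : Nonempty (Fin n) := ⟨0⟩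
  constructor
  rw [sphereUniform, Measure.smul_apply, smul_eq_mul]
  refine ENNReal.inv_mul_cancel ?_ (measure_ne_top _ _)
  rw [ne_eq, Measure.measure_univ_eq_zero]
  exact Measure.toSphere_ne_zero _

variable {U E : Type*} (G : LabeledGraph U E m)
  (μw : Measure (EuclideanSpace ℝ (Fin n))) [IsProbabilityMeasure μw]

lemma isProbabilityMeasure_uniformOn (hG : (G.language l).Nonempty) :
    IsProbabilityMeasure (ProbabilityTheory.uniformOn (G.language l)) :=
  ProbabilityTheory.isProbabilityMeasure_uniformOn (Set.toFinite _) hG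

lemma isProbabilityMeasure_sampleLaw [NeZero n] (hG : (G.language l).Nonempty) :
    IsProbabilityMeasure (sampleLaw G l μw) := by
  have := isProbabilityMeasure_uniformOn G hG
  unfold sampleLaw
  infer_instance

/-- Fubini with the noise innermost. The law of the words has atoms, so null sets must come from the
noise. -/
lemma sampleLaw_eq_zero [NeZero n] (hG : (G.language l).Nonempty) {S : Set (Sample n m l)}
    (hS : MeasurableSet S) (h : ∀ x s, μw {w | (x, s, w) ∈ S} = 0) :
    sampleLaw G l μw S = 0 := by
  have := isProbabilityMeasure_uniformOn G hG
  unfold sampleLaw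
  rw [Measure.measure_prod_null hS]
  refine Eventually.of_forall fun x => ?_
  refine (Measure.measure_prod_null (measurable_prodMk_left hS)).mpr ?_
  exact Eventually.of_forall fun s => h x s

lemma sampleLaw_slack_eq_zero (A : Fin m → Matrix (Fin n) (Fin n) ℝ) [NeZero n]
    (hG : (G.language l).Nonempty) (hμac : μw ≪ volume) (lam : ℝ)
    {P : Matrix (Fin n) (Fin n) ℝ} (hP : (P - 1).PosSemidef) :
    sampleLaw G l μw {z | slack A z lam P = 0} = 0 := by
  refine sampleLaw_eq_zero G μw hG ?_ fun x s => hμac ?_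
  · have hc : Continuous fun z : Sample n m l => slack A z lam P :=
      continuous_slack A continuous_id continuous_const continuous_const
    exact hc.measurable (measurableSet_singleton 0)
  · refine measure_mono_null ?_ (volume_setOf_quadForm_eq (NeZero.pos n) hP
      (Matrix.toEuclideanCLM (n := Fin n) (𝕜 := ℝ) (wordProd A s) x.1)
      ((lam ^ l) ^ 2 * quadForm P x.1))
    intro w hw
    exact sub_eq_zero.mp hw.out

/-- A coordinate of the noise, used to order the samples. -/
def noiseCoord (i₀ : Fin n) (z : Sample n m l) : ℝ := z.2.2 i₀

lemma measurable_noiseCoord (i₀ : Fin n) :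
    Measurable (noiseCoord i₀ : Sample n m l → ℝ) := by
  have : Continuous (noiseCoord i₀ : Sample n m l → ℝ) := by
    unfold noiseCoord
    fun_prop
  exact this.measurable

lemma sampleLaw_noiseCoord_eq [NeZero n] (hG : (G.language l).Nonempty) (hμac : μw ≪ volume)
    (i₀ : Fin n) (c : ℝ) : sampleLaw G l μw {z | noiseCoord i₀ z = c} = 0 := by
  refine sampleLaw_eq_zero G μw hG
    (measurable_noiseCoord i₀ (measurableSet_singleton c)) fun x s => hμac ?_
  exact volume_setOf_apply_eq i₀ c

lemma pi_eq_zero_of_forall_update {ι Z : Type*} [Fintype ι] [DecidableEq ι] [MeasurableSpace Z]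
    (π : Measure Z) [SigmaFinite π] (i : ι) {S : Set (ι → Z)} (hS : MeasurableSet S)
    (h : ∀ ω, π {z | Function.update ω i z ∈ S} = 0) : Measure.pi (fun _ : ι => π) S = 0 := by
  rcases isEmpty_or_nonempty (ι → Z) with he | ⟨⟨ω₀⟩⟩
  · rw [Set.eq_empty_of_isEmpty S, measure_empty]
  have hm : Measurable (S.indicator (1 : (ι → Z) → ℝ≥0∞)) := measurable_one.indicator hS
  -- Fubini: coordinate i is integrated before all others.
  rw [← lintegral_indicator_one hS, lintegral_eq_lmarginal_univ ω₀,
    lmarginal_erase' _ hm (Finset.mem_univ i)]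
  have h0 : (fun ω : ι → Z => ∫⁻ z, S.indicator (1 : (ι → Z) → ℝ≥0∞) (Function.update ω i z) ∂π)
      = fun _ => 0 := by
    funext ω
    have hSω : MeasurableSet {z | Function.update ω i z ∈ S} := measurable_update ω hS
    rw [← h ω, ← lintegral_indicator_one hSω]
    rfl
  rw [h0]
  simp [lmarginal]

/-! ### Nondegenerate samples -/

variable (A : Fin m → Matrix (Fin n) (Fin n) ℝ) {C : ℝ} {ι : Type*}

/-- No sample is active at the optimum for a set of other samples, and the samples are separated
by the label `u`. -/
def Nondegenerate (C : ℝ) (u : Sample n m l → ℝ) (ω : ι → Sample n m l) : Prop :=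
  (∀ (J : Finset ι), ∀ i ∉ J,
    slack A (ω i) (optimum A C (ω '' J)).1 (optimum A C (ω '' J)).2 ≠ 0) ∧
  ∀ i j, i ≠ j → u (ω i) ≠ u (ω j)

/-- For i outside J, the optimum of the samples in J does not change when sample i is redrawn, so
being active there is a null event for the noise of sample i. Only finitely many J, i and j occur.
-/
lemma ae_nondegenerate [NeZero n] [Fintype ι] (hl : 0 < l) (hC : √(n : ℝ) ≤ C)
    (hG : (G.language l).Nonempty) (hμac : μw ≪ volume) (i₀ : Fin n) :
    ∀ᵐ ω ∂(Measure.pi fun _ : ι => sampleLaw G l μw),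
      Nondegenerate A C (noiseCoord i₀) ω := by
  classical
  have := isProbabilityMeasure_sampleLaw G μw hG
  refine Filter.Eventually.and ?_ ?_
  · refine ae_all_iff.mpr fun J => ae_all_iff.mpr fun i => ?_
    by_cases hi : i ∈ J
    · simp [hi]
    simp only [hi, not_false_eq_true, forall_const]
    rw [ae_iff]
    simp only [ne_eq, not_not]
    refine pi_eq_zero_of_forall_update _ i ?_ fun ω => ?_
    · have himg : ∀ ω : ι → Sample n m l, ω '' J = Set.range fun j : J => ω j := fun ω => by
        ext z; simp
      simp only [himg]
      exact measurable_slack_optimum A hl hC (f := fun ω : ι → Sample n m l => ω i)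
        (measurable_pi_apply i) (g := fun ω (j : J) => ω j)
        (measurable_pi_lambda _ fun j => measurable_pi_apply _) (measurableSet_singleton 0)
    · have himg : ∀ z, Function.update ω i z '' J = ω '' J := fun z =>
        Set.image_congr fun j hj => Function.update_of_ne (ne_of_mem_of_not_mem hj hi) _ _
      simp only [Set.mem_ofPred_eq, Function.update_self, himg]
      exact sampleLaw_slack_eq_zero G μw A hG hμac _
        (optimalOn_optimum A hl hC (J.finite_toSet.image ω)).1.2.1.1
  · refine ae_all_iff.mpr fun i => ae_all_iff.mpr fun j => ?_
    by_cases hij : i = j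
    · simp [hij]
    simp only [ne_eq, hij, not_false_eq_true, forall_const]
    rw [ae_iff]
    simp only [not_not]
    refine pi_eq_zero_of_forall_update _ i ?_ fun ω => ?_
    · exact measurableSet_eq_fun ((measurable_noiseCoord i₀).comp (measurable_pi_apply i))
        ((measurable_noiseCoord i₀).comp (measurable_pi_apply j))
    · simp only [Set.mem_ofPred_eq, Function.update_self, Function.update_of_ne (Ne.symm hij)]
      exact sampleLaw_noiseCoord_eq G μw hG hμac i₀ _

/-- `z` violates the optimum for `T`, or has a larger label than some inactive sample of `T`. -/
def Displaces (C : ℝ) (u : Sample n m l → ℝ) (T : Set (Sample n m l)) (z : Sample n m l) : Prop :=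
  0 < slack A z (optimum A C T).1 (optimum A C T).2 ∨
    ∃ a ∈ T, slack A a (optimum A C T).1 (optimum A C T).2 ≠ 0 ∧ u a < u z

/-- Only the violation clause of `Displaces` matters: an optimum of a subfamily that violates no
remaining constraint is the optimum of all. -/
lemma optimum_eq_of_not_displaces (hl : 0 < l) (hC : √(n : ℝ) ≤ C) [Finite ι]
    {u : Sample n m l → ℝ} {ω : ι → Sample n m l} {J : Finset ι}
    (hJ : ∀ i ∉ J, ¬ Displaces A C u (ω '' J) (ω i)) :
    optimum A C (Set.range ω) = optimum A C (ω '' J) := by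
  have ho := optimalOn_optimum A hl hC (J.finite_toSet.image ω)
  refine OptimalOn.eq_optimum A (OptimalOn.mono A (Set.image_subset_range _ _) ho ?_)
  rintro _ ⟨i, rfl⟩
  by_cases hi : i ∈ J
  · exact ho.1.2.2 _ ⟨i, hi, rfl⟩
  · exact not_lt.mp fun h => hJ i hi (Or.inl h)

/-- Every nondegenerate family of samples has exactly one subfamily of `n(n+1)/2` samples that is
displaced by none of the others. -/
theorem Nondegenerate.existsUnique (hn : 0 < n) (hl : 0 < l) (hC : √(n : ℝ) ≤ C) [Fintype ι]
    (hcard : symDim n ≤ Fintype.card ι) {u : Sample n m l → ℝ} {ω : ι → Sample n m l}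
    (hω : Nondegenerate A C u ω) :
    ∃! J : Finset ι, J.card = symDim n ∧ ∀ i ∉ J, ¬ Displaces A C u (ω '' J) (ω i) := by
  classical
  set q := optimum A C (Set.range ω) with hq
  have ho : OptimalOn A C (Set.range ω) q := optimalOn_optimum A hl hC (Set.finite_range ω)
  set act : Finset ι := Finset.univ.filter fun i => slack A (ω i) q.1 q.2 = 0 with hact
  -- Nondegeneracy: a subfamily with the same optimum must contain every active sample.
  have hact_sub : ∀ J : Finset ι, optimum A C (ω '' J) = q → act ⊆ J := by
    intro J hJ i hi
    by_contra hiJ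
    refine hω.1 J i hiJ ?_
    rw [hJ]
    simpa [hact] using hi
  have hact_card : act.card ≤ symDim n := by
    obtain ⟨I, hI, hoI⟩ := OptimalOn.exists_card_eq A hn hl ω hcard ho
    rw [← hI]
    exact Finset.card_le_card (hact_sub I (OptimalOn.eq_optimum A hoI))
  have hopt_of_sub : ∀ J : Finset ι, act ⊆ J → optimum A C (ω '' J) = q := by
    intro J hJ
    refine OptimalOn.eq_optimum A (OptimalOn.of_active A hl (Set.finite_range ω)
      (Set.image_subset_range _ _) ho ?_)
    rintro _ ⟨i, rfl⟩ h0
    exact ⟨i, hJ (by simpa [hact] using h0), rfl⟩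
  obtain ⟨J₀, hJ₀act, -, hJ₀card⟩ :=
    Finset.exists_subsuperset_card_eq (Finset.subset_univ act) hact_card
      (by rwa [Finset.card_univ])
  -- Maximizing the label sum fills the active samples up with the inactive ones of largest label.
  obtain ⟨J, hJmem, hJmax⟩ := Finset.exists_max_image
    ((Finset.powersetCard (symDim n) Finset.univ).filter fun J : Finset ι => act ⊆ J)
    (fun J => ∑ i ∈ J, u (ω i)) ⟨J₀, by simp [hJ₀card, hJ₀act]⟩
  simp only [Finset.mem_filter, Finset.mem_powersetCard, Finset.subset_univ, true_and] at hJmem hJmax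
  refine ⟨J, ⟨hJmem.1, fun i hi => ?_⟩, ?_⟩
  · have hoJ := hopt_of_sub J hJmem.2
    rintro (h | ⟨_, ⟨j, hj, rfl⟩, hjs, hju⟩)
    · rw [hoJ] at h
      exact absurd (ho.1.2.2 _ (Set.mem_range_self i)) (not_le.mpr h)
    · rw [hoJ] at hjs
      have hj' : j ∈ J := hj
      have hi' : i ∉ J.erase j := fun h => hi (Finset.mem_of_mem_erase h)
      -- Exchanging the inactive j for i would increase the label sum.
      have := hJmax (insert i (J.erase j)) ⟨?_, ?_⟩
      · rw [Finset.sum_insert hi', ← Finset.add_sum_erase J _ hj'] at this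
        linarith
      · rw [Finset.card_insert_of_notMem hi', Finset.card_erase_of_mem hj', hJmem.1]
        have := symDim_pos hn
        omega
      · intro k hk
        refine Finset.mem_insert_of_mem (Finset.mem_erase.mpr ⟨?_, hJmem.2 hk⟩)
        rintro rfl
        exact hjs (by simpa [hact] using hk)
  · rintro J' ⟨hJ'card, hJ'⟩
    -- Uniqueness: a second stable J' contains the active samples too. For b in J' \ J and a in J \
    -- J', stability of J' and separation of labels give u(a) < u(b), so exchanging a for b
    -- contradicts the maximality of J.
    have hoJ' : optimum A C (ω '' J') = q := (optimum_eq_of_not_displaces A hl hC hJ').symm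
    have hJ'act := hact_sub J' hoJ'
    by_contra hne
    obtain ⟨b, hbJ', hbJ⟩ : ∃ b ∈ J', b ∉ J := by
      by_contra hcon
      push Not at hcon
      exact hne (Finset.eq_of_subset_of_card_le hcon (by rw [hJmem.1, hJ'card]))
    obtain ⟨a, haJ, haJ'⟩ : ∃ a ∈ J, a ∉ J' := by
      by_contra hcon
      push Not at hcon
      exact hne (Finset.eq_of_subset_of_card_le hcon (by rw [hJmem.1, hJ'card])).symm
    have hab : a ≠ b := by rintro rfl; exact hbJ haJ
    have hb : slack A (ω b) q.1 q.2 ≠ 0 := fun h =>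
      hbJ (hJmem.2 (by simpa [hact] using h))
    have h1 : u (ω a) ≤ u (ω b) := not_lt.mp fun h =>
      hJ' a haJ' (Or.inr ⟨ω b, ⟨b, hbJ', rfl⟩, by rw [hoJ']; exact hb, h⟩)
    have h1' := lt_of_le_of_ne h1 (hω.2 a b hab)
    have hba : b ∉ J.erase a := fun h => hbJ (Finset.mem_of_mem_erase h)
    have := hJmax (insert b (J.erase a)) ⟨?_, ?_⟩
    · rw [Finset.sum_insert hba, ← Finset.add_sum_erase J _ haJ] at this
      linarith
    · rw [Finset.card_insert_of_notMem hba, Finset.card_erase_of_mem haJ, hJmem.1]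
      have := symDim_pos hn
      omega
    · intro k hk
      refine Finset.mem_insert_of_mem (Finset.mem_erase.mpr ⟨?_, hJmem.2 hk⟩)
      rintro rfl
      exact haJ' (hJ'act hk)

end

/-! ### The scenario bound: from unique stable subfamilies to a beta tail. -/

section

/-! ### Beta integrals with integer parameters and moments -/

/-- Integration by parts trades a factor 1 - x for a factor x, hence the induction on j for all k.
-/
lemma integral_pow_mul_one_sub_pow (k j : ℕ) :
    ∫ x in (0 : ℝ)..1, x ^ k * (1 - x) ^ j =
      (k.factorial * j.factorial : ℝ) / (k + j + 1).factorial := by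
  induction j generalizing k with
  | zero =>
    simp only [pow_zero, mul_one, integral_pow, one_pow, Nat.factorial_zero, Nat.cast_one,
      add_zero, Nat.factorial_succ]
    have : (k.factorial : ℝ) ≠ 0 := by positivity
    push_cast
    field_simp
    simp
  | succ j ih =>
    have h := intervalIntegral.integral_mul_deriv_eq_deriv_mul (a := (0 : ℝ)) (b := 1)
      (u := fun x => (1 - x) ^ (j + 1)) (u' := fun x => -((j + 1 : ℕ) * (1 - x) ^ j))
      (v := fun x => x ^ (k + 1)) (v' := fun x => (k + 1 : ℕ) * x ^ k)
      (fun x _ => by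
        have := ((hasDerivAt_id x).const_sub 1).fun_pow (j + 1)
        simpa using this)
      (fun x _ => by
        have := hasDerivAt_pow (k + 1) x
        simpa using this)
      (Continuous.intervalIntegrable (by fun_prop) _ _)
      (Continuous.intervalIntegrable (by fun_prop) _ _)
    have h1 : ∫ x in (0 : ℝ)..1, (1 - x) ^ (j + 1) * ((k + 1 : ℕ) * x ^ k) =
        (k + 1 : ℕ) * ∫ x in (0 : ℝ)..1, x ^ k * (1 - x) ^ (j + 1) := by
      rw [← intervalIntegral.integral_const_mul]
      congr 1; ext x; ring
    have h2 : ∫ x in (0 : ℝ)..1, -((j + 1 : ℕ) * (1 - x) ^ j) * x ^ (k + 1) =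
        -((j + 1 : ℕ) * ∫ x in (0 : ℝ)..1, x ^ (k + 1) * (1 - x) ^ j) := by
      rw [← intervalIntegral.integral_const_mul, ← intervalIntegral.integral_neg]
      congr 1; ext x; ring
    rw [h1, h2, ih (k + 1)] at h
    have hk : ((k + 1 : ℕ) : ℝ) ≠ 0 := by positivity
    rw [show k + 1 + j + 1 = k + (j + 1) + 1 by ring] at h
    simp only [sub_self, ne_eq, Nat.add_eq_zero_iff, one_ne_zero, and_false, not_false_eq_true,
      zero_pow, zero_mul, mul_zero, sub_zero, zero_sub, neg_neg] at h
    apply mul_left_cancel₀ hk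
    rw [h, Nat.factorial_succ k, Nat.factorial_succ j]
    push_cast
    ring

lemma choose_mul_integral {N d : ℕ} (hd : 0 < d) (hN : d ≤ N) :
    (N.choose d : ℝ) * d * ∫ x in (0 : ℝ)..1, x ^ (N - d) * (1 - x) ^ (d - 1) = 1 := by
  obtain ⟨e, rfl⟩ : ∃ e, d = e + 1 := ⟨d - 1, by omega⟩
  obtain ⟨k, rfl⟩ : ∃ k, N = e + 1 + k := ⟨N - (e + 1), by omega⟩
  rw [integral_pow_mul_one_sub_pow]
  have h := Nat.choose_mul_factorial_mul_factorial hN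
  have h' : (((e + 1 + k).choose (e + 1) : ℝ)) * (e + 1).factorial * k.factorial =
      (e + 1 + k).factorial := by
    rw [Nat.add_sub_cancel_left] at h
    exact_mod_cast h
  rw [Nat.add_sub_cancel_left, Nat.add_sub_cancel, show k + e + 1 = e + 1 + k by ring, ← h']
  have h1 : (((e + 1 + k).choose (e + 1) : ℝ)) ≠ 0 := by
    exact_mod_cast (Nat.choose_pos hN).ne'
  rw [Nat.factorial_succ e]
  have h2 : (e.factorial : ℝ) ≠ 0 := by positivity
  have h3 : (k.factorial : ℝ) ≠ 0 := by positivity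
  push_cast
  field_simp

/-- Finite measures on the unit interval are determined by their moments. -/
lemma measure_ext_of_moments {μ ν : Measure ℝ} [IsFiniteMeasure μ] [IsFiniteMeasure ν]
    (hμ : ∀ᵐ x ∂μ, x ∈ Set.Icc (0 : ℝ) 1) (hν : ∀ᵐ x ∂ν, x ∈ Set.Icc (0 : ℝ) 1)
    (h : ∀ k : ℕ, ∫ x, x ^ k ∂μ = ∫ x, x ^ k ∂ν) : μ = ν := by
  have hintg : ∀ (ρ : Measure ℝ) [IsFiniteMeasure ρ], (∀ᵐ x ∂ρ, x ∈ Set.Icc (0 : ℝ) 1) →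
      ∀ k : ℕ, Integrable (fun x => x ^ k) ρ := by
    intro ρ _ hρ k
    refine Integrable.of_bound (by fun_prop) 1 ?_
    filter_upwards [hρ] with x hx
    rw [Real.norm_of_nonneg (pow_nonneg hx.1 k)]
    exact pow_le_one₀ hx.1 hx.2
  have hpint : ∀ (ρ : Measure ℝ) [IsFiniteMeasure ρ], (∀ᵐ x ∂ρ, x ∈ Set.Icc (0 : ℝ) 1) →
      ∀ p : Polynomial ℝ, Integrable (fun x => p.eval x) ρ := by
    intro ρ _ hρ p
    simp only [Polynomial.eval_eq_sum_range]
    exact integrable_finsetSum _ fun k _ => (hintg ρ hρ k).const_mul _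
  have hpoly : ∀ p : Polynomial ℝ, ∫ x, p.eval x ∂μ = ∫ x, p.eval x ∂ν := by
    intro p
    simp only [Polynomial.eval_eq_sum_range]
    rw [integral_finsetSum _ fun k _ => (hintg μ hμ k).const_mul _,
      integral_finsetSum _ fun k _ => (hintg ν hν k).const_mul _]
    simp only [integral_const_mul, h]
  refine ext_of_forall_integral_eq_of_IsFiniteMeasure fun f => ?_
  have hclose : ∀ (ρ : Measure ℝ) [IsFiniteMeasure ρ], (∀ᵐ x ∂ρ, x ∈ Set.Icc (0 : ℝ) 1) →
      ∀ ε : ℝ, ∀ p : Polynomial ℝ, (∀ x ∈ Set.Icc (0 : ℝ) 1, |p.eval x - f x| < ε) →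
      |∫ x, p.eval x ∂ρ - ∫ x, f x ∂ρ| ≤ ε * ρ.real Set.univ := by
    intro ρ _ hρ ε p hp
    rw [← integral_sub (hpint ρ hρ p) (f.integrable ρ)]
    rw [← Real.norm_eq_abs]
    refine norm_integral_le_of_norm_le_const ?_
    filter_upwards [hρ] with x hx
    exact (hp x hx).le
  have hall : ∀ ε > 0, |∫ x, f x ∂μ - ∫ x, f x ∂ν| ≤
      ε * (μ.real Set.univ + ν.real Set.univ) := by
    intro ε hε
    -- Weierstrass approximation is needed only on [0, 1], where both measures are concentrated.
    obtain ⟨p, hp⟩ := exists_polynomial_near_of_continuousOn 0 1 f f.continuous.continuousOn ε hε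
    have h1 := hclose μ hμ ε p hp
    have h2 := hclose ν hν ε p hp
    rw [hpoly p] at h1
    rw [abs_le] at *
    constructor <;> linarith [h1.1, h1.2, h2.1, h2.2]
  have hlim : Tendsto (fun ε : ℝ => ε * (μ.real Set.univ + ν.real Set.univ)) (𝓝[>] 0) (𝓝 0) := by
    have : Tendsto (fun ε : ℝ => ε * (μ.real Set.univ + ν.real Set.univ)) (𝓝 0)
      (𝓝 (0 * (μ.real Set.univ + ν.real Set.univ))) :=
      (continuous_id.mul continuous_const).tendsto 0
    rw [zero_mul] at this
    exact this.mono_left nhdsWithin_le_nhds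
  have h0 := ge_of_tendsto hlim (by filter_upwards [self_mem_nhdsWithin] with ε hε using hall ε hε)
  exact sub_eq_zero.mp (abs_nonpos_iff.mp h0)

/-! ### The law of the violation probability -/

section Scenario

variable {Z : Type*} [MeasurableSpace Z] (π : Measure Z) [IsProbabilityMeasure π]
  (R : Set Z → Z → Prop)

/-- The probability that a new sample is not in the relation `R` to `T`. -/
def keepProb (T : Set Z) : ℝ≥0∞ := π {z | ¬ R T z}

lemma keepProb_le_one (T : Set Z) : keepProb π R T ≤ 1 := prob_le_one

variable {d : ℕ}

lemma measurable_keepProb (hR : MeasurableSet {p : (Fin d → Z) × Z | R (Set.range p.1) p.2}) :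
    Measurable fun B : Fin d → Z => keepProb π R (Set.range B) :=
  measurable_measure_prodMk_left hR.compl

/-- Conditionally on the samples in J, the remaining ones are independent and each avoids the
relation with probability `keepProb`, whence the power. -/
lemma measure_subfamily_kept {ι : Type*} [Fintype ι]
    (hR : MeasurableSet {p : (Fin d → Z) × Z | R (Set.range p.1) p.2}) {J : Finset ι}
    (hJ : J.card = d) {S : Set ℝ≥0∞} (hS : MeasurableSet S) :
    MeasurableSet {ω : ι → Z | (∀ i ∉ J, ¬ R (ω '' J) (ω i)) ∧ keepProb π R (ω '' J) ∈ S} ∧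
    Measure.pi (fun _ : ι => π)
      {ω | (∀ i ∉ J, ¬ R (ω '' J) (ω i)) ∧ keepProb π R (ω '' J) ∈ S} =
    ∫⁻ B in {B : Fin d → Z | keepProb π R (Set.range B) ∈ S},
      keepProb π R (Set.range B) ^ (Fintype.card ι - d) ∂Measure.pi (fun _ : Fin d => π) := by
  classical
  let e : Fin d ≃ {i // i ∈ J} := (J.equivFinOfCardEq hJ).symm
  let f₁ : ({i // i ∈ J} → Z) → (Fin d → Z) := fun g k => g (e k)
  have hf₁ : MeasurePreserving f₁ (Measure.pi fun _ => π) (Measure.pi fun _ => π) :=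
    (measurePreserving_piCongrLeft (fun _ : {i // i ∈ J} => π) e).symm
  let Φ : (ι → Z) → (Fin d → Z) × ({i // i ∉ J} → Z) := fun ω =>
    (fun k => ω (e k), fun i => ω i)
  have hΦ : MeasurePreserving Φ (Measure.pi fun _ => π)
      ((Measure.pi fun _ => π).prod (Measure.pi fun _ => π)) := by
    have h₁ : MeasurePreserving
        (MeasurableEquiv.piEquivPiSubtypeProd (fun _ : ι => Z) fun i => i ∈ J)
        (Measure.pi fun _ => π) ((Measure.pi fun _ : {i // i ∈ J} => π).prod
          (Measure.pi fun _ : {i // i ∉ J} => π)) := by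
      convert measurePreserving_piEquivPiSubtypeProd (fun _ : ι => π) (fun i => i ∈ J)
    have h₂ := hf₁.prod (MeasurePreserving.id (Measure.pi fun _ : {i // i ∉ J} => π))
    exact h₂.comp h₁
  have hrange : ∀ ω : ι → Z, ω '' J = Set.range fun k => ω (e k) := by
    intro ω
    rw [show (fun k => ω (e k)) = (fun j : {i // i ∈ J} => ω j) ∘ e from rfl,
      e.surjective.range_comp]
    ext z; simp
  let Q : Set ((Fin d → Z) × ({i // i ∉ J} → Z)) :=
    {p | (∀ i, ¬ R (Set.range p.1) (p.2 i)) ∧ keepProb π R (Set.range p.1) ∈ S}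
  have hQ : MeasurableSet Q := by
    have h₁ : {p : (Fin d → Z) × ({i // i ∉ J} → Z) | ∀ i, ¬ R (Set.range p.1) (p.2 i)} =
        ⋂ i, (fun p => (p.1, p.2 i)) ⁻¹' {p : (Fin d → Z) × Z | R (Set.range p.1) p.2}ᶜ := by
      ext p; simp
    have h₂ : MeasurableSet
        {p : (Fin d → Z) × ({i // i ∉ J} → Z) | ∀ i, ¬ R (Set.range p.1) (p.2 i)} := by
      rw [h₁]
      refine MeasurableSet.iInter fun i => ?_
      have : Measurable fun p : (Fin d → Z) × ({i // i ∉ J} → Z) => (p.1, p.2 i) := by fun_prop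
      exact this hR.compl
    exact h₂.inter ((measurable_keepProb π R hR).comp measurable_fst hS)
  have hset : {ω : ι → Z | (∀ i ∉ J, ¬ R (ω '' J) (ω i)) ∧ keepProb π R (ω '' J) ∈ S} =
      Φ ⁻¹' Q := by
    ext ω
    simp only [Set.mem_ofPred_eq, Set.mem_preimage, hrange, Φ, Q, Subtype.forall]
  have hcard : Fintype.card {i // i ∉ J} = Fintype.card ι - d := by
    rw [Fintype.card_subtype_compl, Fintype.card_coe, hJ]
  rw [hset]
  refine ⟨hΦ.measurable hQ, ?_⟩
  have hSm : MeasurableSet {B : Fin d → Z | keepProb π R (Set.range B) ∈ S} :=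
    measurable_keepProb π R hR hS
  rw [hΦ.measure_preimage hQ.nullMeasurableSet, Measure.prod_apply hQ,
    ← lintegral_indicator hSm]
  refine lintegral_congr fun B => ?_
  by_cases hB : keepProb π R (Set.range B) ∈ S
  · rw [Set.indicator_of_mem (by exact hB)]
    have : Prod.mk B ⁻¹' Q = Set.univ.pi fun _ : {i // i ∉ J} => {z | ¬ R (Set.range B) z} := by
      ext y
      simp [Q, hB]
    rw [this, Measure.pi_pi, Finset.prod_const, Finset.card_univ, hcard, keepProb]
  · rw [Set.indicator_of_notMem (by exact hB)]
    have : Prod.mk B ⁻¹' Q = ∅ := by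
      ext y
      simp [Q, hB]
    rw [this, measure_empty]

/-- If almost every family of samples has exactly one `R`-stable subfamily of size `d`, the
moments of the probability of not being in the relation `R` are those of a beta law. -/
lemma choose_mul_lintegral_keepProb
    (hR : MeasurableSet {p : (Fin d → Z) × Z | R (Set.range p.1) p.2})
    (hU : ∀ M, d ≤ M → ∀ᵐ ω ∂Measure.pi (fun _ : Fin M => π),
      ∃! J : Finset (Fin M), J.card = d ∧ ∀ i ∉ J, ¬ R (ω '' J) (ω i)) (k : ℕ) :
    ((d + k).choose d : ℝ≥0∞) * ∫⁻ B : Fin d → Z, keepProb π R (Set.range B) ^ k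
      ∂Measure.pi (fun _ : Fin d => π) = 1 := by
  classical
  let M := d + k
  -- The condition on `keepProb` is void here; it is restricted to a half-line only in the tail
  -- bound.
  let E : Finset (Fin M) → Set (Fin M → Z) := fun J =>
    {ω | (∀ i ∉ J, ¬ R (ω '' J) (ω i)) ∧ keepProb π R (ω '' J) ∈ Set.univ}
  have hE : ∀ J ∈ Finset.powersetCard d (Finset.univ : Finset (Fin M)), MeasurableSet (E J) ∧
      Measure.pi (fun _ : Fin M => π) (E J) =
        ∫⁻ B : Fin d → Z, keepProb π R (Set.range B) ^ k ∂Measure.pi (fun _ : Fin d => π) := by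
    intro J hJ
    have := measure_subfamily_kept π R hR (Finset.mem_powersetCard.mp hJ).2 MeasurableSet.univ
    refine ⟨this.1, this.2.trans ?_⟩
    simp [M]
  -- Almost surely exactly one indicator equals 1. By exchangeability the expectations of the (d + k
  -- choose d) indicators coincide.
  have hsum : ∫⁻ ω, ∑ J ∈ Finset.powersetCard d (Finset.univ : Finset (Fin M)),
      (E J).indicator (1 : (Fin M → Z) → ℝ≥0∞) ω ∂Measure.pi (fun _ : Fin M => π) = 1 := by
    rw [← measure_univ (μ := Measure.pi (fun _ : Fin M => π)), ← lintegral_one]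
    refine lintegral_congr_ae ?_
    filter_upwards [hU M (Nat.le_add_right d k)] with ω hω
    obtain ⟨J, ⟨hJ, hJR⟩, hJu⟩ := hω
    rw [Finset.sum_eq_single J]
    · rw [Set.indicator_of_mem]
      · rfl
      · exact ⟨hJR, trivial⟩
    · intro J' hJ' hne
      refine Set.indicator_of_notMem (fun h => hne (hJu J' ⟨?_, h.1⟩)) _
      exact (Finset.mem_powersetCard.mp hJ').2
    · intro h
      exact absurd (Finset.mem_powersetCard.mpr ⟨Finset.subset_univ _, hJ⟩) h
  rw [lintegral_finsetSum' _ fun J hJ => (measurable_one.indicator (hE J hJ).1).aemeasurable] at hsum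
  rw [← hsum, Finset.sum_congr rfl fun J hJ => (lintegral_indicator_one (hE J hJ).1).trans (hE J hJ).2,
    Finset.sum_const, Finset.card_powersetCard, Finset.card_univ, Fintype.card_fin, nsmul_eq_mul]

/-- The law on `[0, 1]` with density `d (1 - x) ^ (d - 1)`. -/
def minLaw (d : ℕ) : Measure ℝ :=
  (volume.restrict (Set.Ioc (0 : ℝ) 1)).withDensity fun x => ENNReal.ofReal (d * (1 - x) ^ (d - 1))

lemma setLIntegral_minLaw (d k : ℕ) {c : ℝ} (hc : c ∈ Set.Icc (0 : ℝ) 1) :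
    ∫⁻ x in Set.Iic c, ENNReal.ofReal (x ^ k) ∂minLaw d =
      ENNReal.ofReal (d * ∫ x in (0 : ℝ)..c, x ^ k * (1 - x) ^ (d - 1)) := by
  have hm : Measurable fun x : ℝ => ENNReal.ofReal (d * (1 - x) ^ (d - 1)) := by fun_prop
  rw [minLaw, setLIntegral_withDensity_eq_setLIntegral_mul _ hm (by fun_prop) measurableSet_Iic,
    Measure.restrict_restrict measurableSet_Iic]
  have hset : Set.Iic c ∩ Set.Ioc (0 : ℝ) 1 = Set.Ioc 0 c := by
    ext x
    simp only [Set.mem_inter_iff, Set.mem_Iic, Set.mem_Ioc]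
    constructor
    · rintro ⟨h1, h2, -⟩; exact ⟨h2, h1⟩
    · rintro ⟨h1, h2⟩; exact ⟨h2, h1, h2.trans hc.2⟩
  rw [hset, ← intervalIntegral.integral_const_mul, intervalIntegral.integral_of_le hc.1,
    ofReal_integral_eq_lintegral_ofReal]
  · refine setLIntegral_congr_fun measurableSet_Ioc fun x hx => ?_
    have h1 : 0 ≤ 1 - x := by linarith [hx.2, hc.2]
    rw [Pi.mul_apply, ← ENNReal.ofReal_mul (by positivity)]
    congr 1; ring
  · have hcont : Continuous fun x : ℝ => (d : ℝ) * (x ^ k * (1 - x) ^ (d - 1)) := by fun_prop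
    exact (hcont.integrableOn_Icc).mono_set Set.Ioc_subset_Icc_self
  · refine (ae_restrict_iff' measurableSet_Ioc).mpr (Eventually.of_forall fun x hx => ?_)
    have h1 : 0 ≤ 1 - x := by linarith [hx.2, hc.2]
    have h2 := hx.1
    simp only [Pi.zero_apply]
    positivity

lemma ae_minLaw_mem (d : ℕ) : ∀ᵐ x ∂minLaw d, x ∈ Set.Ioc (0 : ℝ) 1 :=
  (withDensity_absolutelyContinuous _ _).ae_le (ae_restrict_mem measurableSet_Ioc)

lemma lintegral_minLaw (d k : ℕ) :
    ∫⁻ x, ENNReal.ofReal (x ^ k) ∂minLaw d =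
      ENNReal.ofReal (d * ∫ x in (0 : ℝ)..1, x ^ k * (1 - x) ^ (d - 1)) := by
  rw [← setLIntegral_minLaw d k ⟨zero_le_one, le_rfl⟩, Measure.restrict_eq_self_of_ae_mem]
  filter_upwards [ae_minLaw_mem d] with x hx using hx.2

/-- Both laws have k-th moment 1 / (d + k choose d). -/
lemma map_keepProb_eq_minLaw (hd : 0 < d)
    (hR : MeasurableSet {p : (Fin d → Z) × Z | R (Set.range p.1) p.2})
    (hU : ∀ M, d ≤ M → ∀ᵐ ω ∂Measure.pi (fun _ : Fin M => π),
      ∃! J : Finset (Fin M), J.card = d ∧ ∀ i ∉ J, ¬ R (ω '' J) (ω i)) :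
    (Measure.pi (fun _ : Fin d => π)).map
      (fun B : Fin d → Z => (keepProb π R (Set.range B)).toReal) = minLaw d := by
  have hX : Measurable fun B : Fin d → Z => (keepProb π R (Set.range B)).toReal :=
    (measurable_keepProb π R hR).ennreal_toReal
  have hmin : ∀ k : ℕ, ((d + k).choose d : ℝ) * (d * ∫ x in (0 : ℝ)..1, x ^ k * (1 - x) ^ (d - 1))
      = 1 := by
    intro k
    have := choose_mul_integral hd (Nat.le_add_right d k)
    rwa [Nat.add_sub_cancel_left, mul_assoc] at this
  have hfin : IsFiniteMeasure (minLaw d) := by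
    constructor
    have := lintegral_minLaw d 0
    simp only [pow_zero, ENNReal.ofReal_one, lintegral_one] at this
    rw [this]
    exact ENNReal.ofReal_lt_top
  have hfin' : IsFiniteMeasure ((Measure.pi (fun _ : Fin d => π)).map
      (fun B : Fin d → Z => (keepProb π R (Set.range B)).toReal)) :=
    Measure.isFiniteMeasure_map _ _
  have hmem : ∀ B : Fin d → Z, (keepProb π R (Set.range B)).toReal ∈ Set.Icc (0 : ℝ) 1 := fun B =>
    ⟨ENNReal.toReal_nonneg, ENNReal.toReal_mono ENNReal.one_ne_top (keepProb_le_one π R _)⟩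
  refine measure_ext_of_moments ?_ ?_ fun k => ?_
  · exact (ae_map_iff hX.aemeasurable measurableSet_Icc).mpr (Eventually.of_forall hmem)
  · filter_upwards [ae_minLaw_mem d] with x hx using Set.Ioc_subset_Icc_self hx
  · rw [integral_map hX.aemeasurable (by fun_prop), integral_eq_lintegral_of_nonneg_ae
      (Eventually.of_forall fun B => pow_nonneg (hmem B).1 k) (hX.pow_const k).aestronglyMeasurable,
      integral_eq_lintegral_of_nonneg_ae ?_ (by fun_prop)]
    · congr 1
      have hc0 : ((d + k).choose d : ℝ≥0∞) ≠ 0 := by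
        exact_mod_cast (Nat.choose_pos (Nat.le_add_right d k)).ne'
      have hct : ((d + k).choose d : ℝ≥0∞) ≠ ⊤ := ENNReal.natCast_ne_top _
      rw [← ENNReal.mul_right_inj hc0 hct, lintegral_minLaw, ← ENNReal.ofReal_natCast,
        ← ENNReal.ofReal_mul (by positivity), hmin, ENNReal.ofReal_one, ENNReal.ofReal_natCast,
        ← choose_mul_lintegral_keepProb π R hR hU k]
      congr 1
      refine lintegral_congr fun B => ?_
      rw [← ENNReal.toReal_pow, ENNReal.ofReal_toReal]
      exact ENNReal.pow_ne_top ((keepProb_le_one π R _).trans_lt ENNReal.one_lt_top).ne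
    · filter_upwards [ae_minLaw_mem d] with x hx using pow_nonneg hx.1.le k

lemma regBeta_natCast {N : ℕ} (hd : 0 < d) (hN : d ≤ N) (t : ℝ) :
    regBeta t d ((N : ℝ) - d + 1) =
      (N.choose d : ℝ) * d * ∫ u in (0 : ℝ)..t, u ^ (d - 1) * (1 - u) ^ (N - d) := by
  have h : ∀ u : ℝ, u ^ ((d : ℝ) - 1) * (1 - u) ^ ((N : ℝ) - d + 1 - 1) =
      u ^ (d - 1) * (1 - u) ^ (N - d) := by
    intro u
    rw [add_sub_cancel_right, ← Nat.cast_sub hN, Real.rpow_natCast, ← Nat.cast_one (R := ℝ),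
      ← Nat.cast_sub hd, Real.rpow_natCast]
  have hsymm : ∫ u in (0 : ℝ)..1, u ^ (d - 1) * (1 - u) ^ (N - d) =
      ∫ x in (0 : ℝ)..1, x ^ (N - d) * (1 - x) ^ (d - 1) := by
    have := intervalIntegral.integral_comp_sub_left (a := (0 : ℝ)) (b := 1)
      (fun x : ℝ => x ^ (N - d) * (1 - x) ^ (d - 1)) 1
    simp only [sub_sub_cancel, sub_self, sub_zero] at this
    rw [← this]
    congr 1; ext x; ring
  have hone := choose_mul_integral hd hN
  simp only [regBeta, h, hsymm]
  have hne : ∫ x in (0 : ℝ)..1, x ^ (N - d) * (1 - x) ^ (d - 1) ≠ 0 := by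
    intro h0
    rw [h0, mul_zero] at hone
    exact zero_ne_one hone
  rw [div_eq_iff hne]
  linear_combination (-∫ u in (0 : ℝ)..t, u ^ (d - 1) * (1 - u) ^ (N - d)) * hone

/-- The tail bound of the scenario approach: a stable subfamily of size `d` has violation
probability above `ε` with probability at most `1 - I_ε(d, N - d + 1)`. -/
theorem measure_exists_stable_lt {N : ℕ} (hd : 0 < d) (hN : d ≤ N)
    (hR : MeasurableSet {p : (Fin d → Z) × Z | R (Set.range p.1) p.2})
    (hU : ∀ M, d ≤ M → ∀ᵐ ω ∂Measure.pi (fun _ : Fin M => π),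
      ∃! J : Finset (Fin M), J.card = d ∧ ∀ i ∉ J, ¬ R (ω '' J) (ω i))
    {ε : ℝ} (hε : ε ∈ Set.Icc (0 : ℝ) 1) :
    Measure.pi (fun _ : Fin N => π) {ω | ∃ J : Finset (Fin N), J.card = d ∧
        (∀ i ∉ J, ¬ R (ω '' J) (ω i)) ∧ keepProb π R (ω '' J) ≤ ENNReal.ofReal (1 - ε)} ≤
      ENNReal.ofReal (1 - regBeta ε d ((N : ℝ) - d + 1)) := by
  classical
  let E : Finset (Fin N) → Set (Fin N → Z) := fun J =>
    {ω | (∀ i ∉ J, ¬ R (ω '' J) (ω i)) ∧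
      keepProb π R (ω '' J) ∈ Set.Iic (ENNReal.ofReal (1 - ε))}
  have hsub : {ω : Fin N → Z | ∃ J : Finset (Fin N), J.card = d ∧
        (∀ i ∉ J, ¬ R (ω '' J) (ω i)) ∧ keepProb π R (ω '' J) ≤ ENNReal.ofReal (1 - ε)} ⊆
      ⋃ J ∈ Finset.powersetCard d (Finset.univ : Finset (Fin N)), E J := by
    rintro ω ⟨J, hJ, h1, h2⟩
    refine Set.mem_biUnion (x := J) ?_ ⟨h1, h2⟩
    exact Finset.mem_powersetCard.mpr ⟨Finset.subset_univ _, hJ⟩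
  have hX : Measurable fun B : Fin d → Z => (keepProb π R (Set.range B)).toReal :=
    (measurable_keepProb π R hR).ennreal_toReal
  have hc : 1 - ε ∈ Set.Icc (0 : ℝ) 1 := ⟨by linarith [hε.2], by linarith [hε.1]⟩
  have hE : ∀ J ∈ Finset.powersetCard d (Finset.univ : Finset (Fin N)),
      Measure.pi (fun _ : Fin N => π) (E J) =
      ENNReal.ofReal (d * ∫ x in (0 : ℝ)..(1 - ε), x ^ (N - d) * (1 - x) ^ (d - 1)) := by
    intro J hJ
    rw [(measure_subfamily_kept π R hR (Finset.mem_powersetCard.mp hJ).2 measurableSet_Iic).2,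
      ← setLIntegral_minLaw d (N - d) hc, ← map_keepProb_eq_minLaw π R hd hR hU,
      setLIntegral_map measurableSet_Iic (by fun_prop) hX, Fintype.card_fin]
    have hset : {B : Fin d → Z | keepProb π R (Set.range B) ∈ Set.Iic (ENNReal.ofReal (1 - ε))} =
        (fun B : Fin d → Z => (keepProb π R (Set.range B)).toReal) ⁻¹' Set.Iic (1 - ε) := by
      ext B
      exact ENNReal.le_ofReal_iff_toReal_le
        ((keepProb_le_one π R _).trans_lt ENNReal.one_lt_top).ne hc.1
    rw [hset]
    refine lintegral_congr fun B => ?_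
    rw [← ENNReal.toReal_pow, ENNReal.ofReal_toReal]
    exact ENNReal.pow_ne_top ((keepProb_le_one π R _).trans_lt ENNReal.one_lt_top).ne
  -- Union bound over the (N choose d) subfamilies, each contributing the same truncated beta
  -- integral.
  refine (measure_mono hsub).trans ((measure_biUnion_finset_le _ _).trans ?_)
  rw [Finset.sum_congr rfl hE, Finset.sum_const, Finset.card_powersetCard, Finset.card_univ,
    Fintype.card_fin, nsmul_eq_mul, ← ENNReal.ofReal_natCast, ← ENNReal.ofReal_mul (by positivity)]
  refine ENNReal.ofReal_le_ofReal (le_of_eq ?_)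
  have hsub1 := intervalIntegral.integral_comp_sub_left (a := (0 : ℝ)) (b := ε)
    (fun x : ℝ => x ^ (N - d) * (1 - x) ^ (d - 1)) 1
  simp only [sub_sub_cancel, sub_zero] at hsub1
  have hcont : Continuous fun x : ℝ => x ^ (N - d) * (1 - x) ^ (d - 1) := by fun_prop
  have hadd := intervalIntegral.integral_add_adjacent_intervals (μ := volume)
    (hcont.intervalIntegrable 0 (1 - ε)) (hcont.intervalIntegrable (1 - ε) 1)
  have hone := choose_mul_integral hd hN
  rw [regBeta_natCast hd hN]
  have hcomm : ∫ u in (0 : ℝ)..ε, u ^ (d - 1) * (1 - u) ^ (N - d) =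
      ∫ x in (1 - ε)..1, x ^ (N - d) * (1 - x) ^ (d - 1) := by
    rw [← hsub1]
    congr 1; ext x; ring
  rw [← hadd] at hone
  rw [hcomm]
  linear_combination hone

end Scenario

end

section

/-! ### The constrained joint spectral radius -/

/-- Fekete's lemma for nonnegative submultiplicative sequences. -/
lemma exists_tendsto_rpow_of_submultiplicative {u : ℕ → ℝ} (h0 : ∀ k, 0 ≤ u k)
    (hu : ∀ j k, u (j + k) ≤ u j * u k) :
    ∃ L, Tendsto (fun k : ℕ => u k ^ (1 / (k : ℝ))) atTop (𝓝 L) := by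
  -- The sequence may vanish, so logarithms are taken after flooring u k at ε^k, which preserves
  -- submultiplicativity.
  have key : ∀ ε : ℝ, 0 < ε → ∃ L, Tendsto (fun k : ℕ => max (u k ^ (1 / (k : ℝ))) ε) atTop
      (𝓝 L) := by
    intro ε hε
    have hpos : ∀ k, 0 < max (u k) (ε ^ k) := fun k => lt_max_of_lt_right (pow_pos hε k)
    have hsub : Subadditive fun k => Real.log (max (u k) (ε ^ k)) := by
      intro j k
      rw [← Real.log_mul (hpos j).ne' (hpos k).ne']
      refine Real.log_le_log (hpos _) (max_le ?_ ?_)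
      · exact (hu j k).trans (mul_le_mul (le_max_left _ _) (le_max_left _ _) (h0 k) (hpos j).le)
      · rw [pow_add]
        exact mul_le_mul (le_max_right _ _) (le_max_right _ _) (pow_pos hε k).le (hpos j).le
    have hbdd : BddBelow (Set.range fun k : ℕ => Real.log (max (u k) (ε ^ k)) / k) := by
      -- The 0 covers k = 0, where division by zero gives the value 0.
      refine ⟨min 0 (Real.log ε), ?_⟩
      rintro _ ⟨k, rfl⟩
      rcases Nat.eq_zero_or_pos k with rfl | hk
      · simp
      · refine (min_le_right _ _).trans ?_
        have hk' : (0 : ℝ) < k := by exact_mod_cast hk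
        simp only
        rw [le_div_iff₀ hk', mul_comm, ← Real.log_pow]
        exact Real.log_le_log (pow_pos hε k) (le_max_right _ _)
    refine ⟨Real.exp hsub.lim, ?_⟩
    refine ((Real.continuous_exp.tendsto _).comp (hsub.tendsto_lim hbdd)).congr' ?_
    filter_upwards [eventually_gt_atTop 0] with k hk
    have hk' : (0 : ℝ) < k := by exact_mod_cast hk
    have hmax : max (u k ^ (1 / (k : ℝ))) ε = max (u k) (ε ^ k) ^ (1 / (k : ℝ)) := by
      have hε' : ε = (ε ^ k) ^ (1 / (k : ℝ)) := by
        rw [one_div, Real.pow_rpow_inv_natCast hε.le hk.ne']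
      nth_rewrite 1 [hε']
      exact ((Real.monotoneOn_rpow_Ici_of_exponent_nonneg (by positivity)).map_max
        (h0 k) (pow_pos hε k).le).symm
    rw [hmax, Function.comp_apply, Real.rpow_def_of_pos (hpos k)]
    congr 1
    ring
  have hv0 : ∀ k : ℕ, 0 ≤ u k ^ (1 / (k : ℝ)) := fun k => Real.rpow_nonneg (h0 k) _
  -- If some floored limit exceeds its floor, the floor is eventually inactive. Otherwise every
  -- floored limit is at most its floor, and the sequence tends to 0.
  by_cases hcase : ∃ ε, 0 < ε ∧ ∃ L, ε < L ∧
      Tendsto (fun k : ℕ => max (u k ^ (1 / (k : ℝ))) ε) atTop (𝓝 L)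
  · obtain ⟨ε, -, L, hL, hlim⟩ := hcase
    refine ⟨L, hlim.congr' ?_⟩
    filter_upwards [hlim.eventually_const_lt hL] with k hk
    rcases lt_max_iff.mp hk with h | h
    · exact max_eq_left h.le
    · exact absurd h (lt_irrefl _)
  · push Not at hcase
    refine ⟨0, ?_⟩
    rw [Metric.tendsto_atTop']
    intro ε hε
    obtain ⟨L, hL⟩ := key (ε / 2) (by positivity)
    have hLe : L ≤ ε / 2 := by
      by_contra hcon
      exact hcase (ε / 2) (by positivity) L (not_le.mp hcon) hL
    obtain ⟨K, hK⟩ := eventually_atTop.mp (hL.eventually_lt_const (show L < ε by linarith))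
    refine ⟨K, fun k hk => ?_⟩
    rw [Real.dist_eq, sub_zero, abs_of_nonneg (hv0 k)]
    exact (le_max_left _ _).trans_lt (hK k hk.le)

variable {U E : Type*} {n m : ℕ} (G : LabeledGraph U E m) (A : Fin m → Matrix (Fin n) (Fin n) ℝ)

lemma opNorm_mul_le (M M' : Matrix (Fin n) (Fin n) ℝ) :
    opNorm (M * M') ≤ opNorm M * opNorm M' := by
  unfold opNorm
  rw [map_mul]
  exact norm_mul_le _ _

lemma opNorm_nonneg (M : Matrix (Fin n) (Fin n) ℝ) : 0 ≤ opNorm M := norm_nonneg _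

lemma wordProd_add {j k : ℕ} (s : Fin (j + k) → Fin m) :
    wordProd A s = wordProd A (fun i => s (Fin.natAdd j i)) *
      wordProd A (fun i => s (Fin.castAdd k i)) := by
  unfold wordProd
  rw [List.ofFn_add, List.reverse_append, List.prod_append]
  rfl

variable {G} in
lemma mem_language_castAdd {j k : ℕ} {s : Fin (j + k) → Fin m} (hs : s ∈ G.language (j + k)) :
    (fun i => s (Fin.castAdd k i)) ∈ G.language j := by
  obtain ⟨e, he, hse⟩ := hs
  exact ⟨fun i => e (Fin.castAdd k i), fun a b hab => he _ _ (by simpa using hab),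
    fun i => hse _⟩

variable {G} in
lemma mem_language_natAdd {j k : ℕ} {s : Fin (j + k) → Fin m} (hs : s ∈ G.language (j + k)) :
    (fun i => s (Fin.natAdd j i)) ∈ G.language k := by
  obtain ⟨e, he, hse⟩ := hs
  refine ⟨fun i => e (Fin.natAdd j i), fun a b hab => he _ _ ?_, fun i => hse _⟩
  simp only [Fin.val_natAdd, hab]
  ring

lemma bddAbove_opNorm (k : ℕ) :
    BddAbove (Set.range fun s : G.language k => opNorm (wordProd A s.1)) :=
  (Set.finite_range _).bddAbove

/-- Prefixes and suffixes of a word of the language are again in the language. An empty language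
contributes the supremum 0. -/
lemma iSup_opNorm_add_le (j k : ℕ) :
    ⨆ s : G.language (j + k), opNorm (wordProd A s.1) ≤
      (⨆ s : G.language j, opNorm (wordProd A s.1)) *
        ⨆ s : G.language k, opNorm (wordProd A s.1) := by
  have h0 : ∀ k, 0 ≤ ⨆ s : G.language k, opNorm (wordProd A s.1) := fun k =>
    Real.iSup_nonneg fun s => opNorm_nonneg _
  refine Real.iSup_le (fun s => ?_) (mul_nonneg (h0 j) (h0 k))
  rw [wordProd_add, mul_comm]
  refine (opNorm_mul_le _ _).trans (mul_le_mul ?_ ?_ (opNorm_nonneg _) (h0 k))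
  · exact le_ciSup (bddAbove_opNorm G A k) ⟨_, mem_language_natAdd s.2⟩
  · exact le_ciSup (bddAbove_opNorm G A j) ⟨_, mem_language_castAdd s.2⟩

lemma iSup_rpow_opNorm {k : ℕ} (hk : 0 < k) :
    ⨆ s : G.language k, opNorm (wordProd A s.1) ^ (1 / (k : ℝ)) =
      (⨆ s : G.language k, opNorm (wordProd A s.1)) ^ (1 / (k : ℝ)) := by
  have hk' : (0 : ℝ) < k := by exact_mod_cast hk
  rcases isEmpty_or_nonempty (G.language k) with he | he
  · rw [Real.iSup_of_isEmpty, Real.iSup_of_isEmpty, Real.zero_rpow (by positivity)]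
  · obtain ⟨s₀, hs₀⟩ := Finite.exists_max fun s : G.language k => opNorm (wordProd A s.1)
    have h1 : ⨆ s : G.language k, opNorm (wordProd A s.1) = opNorm (wordProd A s₀.1) :=
      le_antisymm (ciSup_le hs₀) (le_ciSup (bddAbove_opNorm G A k) s₀)
    rw [h1]
    refine le_antisymm (ciSup_le fun s => ?_) (le_ciSup
      (f := fun s : G.language k => opNorm (wordProd A s.1) ^ (1 / (k : ℝ)))
      (Set.finite_range _).bddAbove s₀)
    exact Real.rpow_le_rpow (opNorm_nonneg _) (hs₀ s) (by positivity)

/-- `limUnder` carries no information until a limit is known to exist; Fekete's lemma supplies it.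
-/
lemma tendsto_cjsr :
    Tendsto (fun k : ℕ => ⨆ s : G.language k, opNorm (wordProd A s.1) ^ (1 / (k : ℝ))) atTop
      (𝓝 (cjsr G A)) := by
  obtain ⟨L, hL⟩ := exists_tendsto_rpow_of_submultiplicative
    (u := fun k => ⨆ s : G.language k, opNorm (wordProd A s.1))
    (fun k => Real.iSup_nonneg fun s => opNorm_nonneg _) (iSup_opNorm_add_le G A)
  refine tendsto_nhds_limUnder ⟨L, hL.congr' ?_⟩
  filter_upwards [eventually_gt_atTop 0] with k hk
  exact (iSup_rpow_opNorm G A hk).symm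

/-- Each of the j consecutive blocks of length l is itself a word of the language and contributes a
factor R. -/
lemma quadNorm_wordProd_le {l : ℕ} {P : Matrix (Fin n) (Fin n) ℝ} {R : ℝ} (hR : 0 ≤ R)
    (h : ∀ s ∈ G.language l, ∀ x, quadNorm P
      (Matrix.toEuclideanCLM (n := Fin n) (𝕜 := ℝ) (wordProd A s) x) ≤ R * quadNorm P x)
    (j : ℕ) {s : Fin (l * j) → Fin m} (hs : s ∈ G.language (l * j)) (x : EuclideanSpace ℝ (Fin n)) :
    quadNorm P (Matrix.toEuclideanCLM (n := Fin n) (𝕜 := ℝ) (wordProd A s) x) ≤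
      R ^ j * quadNorm P x := by
  induction j generalizing x with
  | zero => simp [wordProd]
  | succ j ih =>
    have hs' : (s : Fin (l * j + l) → Fin m) ∈ G.language (l * j + l) := hs
    have hw : wordProd A s = _ := wordProd_add (j := l * j) (k := l) A s
    rw [hw, map_mul, mul_apply_eq_comp]
    refine (h _ (mem_language_natAdd hs') _).trans ?_
    rw [pow_succ, mul_comm (R ^ j), mul_assoc]
    exact mul_le_mul_of_nonneg_left (ih (mem_language_castAdd hs') x) hR

/-- A contraction rate of the words of length `l` in a quadratic norm bounds the constrained joint
spectral radius. -/
theorem cjsr_le_rpow {l : ℕ} (hl : 0 < l) {P : Matrix (Fin n) (Fin n) ℝ}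
    (hP : (P - 1).PosSemidef) {R : ℝ} (hR : 0 < R)
    (h : ∀ s ∈ G.language l, ∀ x, quadNorm P
      (Matrix.toEuclideanCLM (n := Fin n) (𝕜 := ℝ) (wordProd A s) x) ≤ R * quadNorm P x) :
    cjsr G A ≤ R ^ (1 / (l : ℝ)) := by
  -- Compares the P-norm with the Euclidean norm; the summand 1 makes c positive, so that c^(1/(lj))
  -- tends to 1.
  set c := √(opNorm P) + 1
  have hc : 0 < c := by positivity
  have hlow : ∀ x, ‖x‖ ≤ quadNorm P x := fun x => by
    rw [quadNorm_eq_sqrt]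
    exact Real.le_sqrt_of_sq_le (sq_norm_le_quadForm hP x)
  have hup : ∀ x, quadNorm P x ≤ c * ‖x‖ := fun x => by
    rw [quadNorm_eq_sqrt]
    have h1 : quadForm P x ≤ opNorm P * ‖x‖ ^ 2 := by
      refine (real_inner_le_norm _ _).trans ?_
      have := (Matrix.toEuclideanCLM (n := Fin n) (𝕜 := ℝ) P).le_opNorm x
      calc ‖x‖ * _ ≤ ‖x‖ * (opNorm P * ‖x‖) := mul_le_mul_of_nonneg_left this (norm_nonneg _)
        _ = _ := by ring
    refine (Real.sqrt_le_sqrt h1).trans ?_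
    rw [Real.sqrt_mul (opNorm_nonneg P), Real.sqrt_sq (norm_nonneg _)]
    exact mul_le_mul_of_nonneg_right (by simp [c]) (norm_nonneg _)
  have hop : ∀ j, ∀ s : G.language (l * j), opNorm (wordProd A s.1) ≤ c * R ^ j := by
    intro j s
    refine ContinuousLinearMap.opNorm_le_bound _ (by positivity) fun x => ?_
    refine (hlow _).trans ((quadNorm_wordProd_le G A hR.le h j s.2 x).trans ?_)
    calc R ^ j * quadNorm P x ≤ R ^ j * (c * ‖x‖) :=
          mul_le_mul_of_nonneg_left (hup x) (by positivity)
      _ = _ := by ring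
  have hl' : (0 : ℝ) < l := by exact_mod_cast hl
  have hmul : Tendsto (fun j : ℕ => l * j) atTop atTop :=
    tendsto_id.const_mul_atTop' hl
  -- The full limit exists, so the lengths l * j suffice.
  have hlim := (tendsto_cjsr G A).comp hmul
  have hexp : Tendsto (fun j : ℕ => 1 / (((l * j : ℕ) : ℝ))) atTop (𝓝 0) := by
    simp only [one_div]
    exact tendsto_inv_atTop_zero.comp (tendsto_natCast_atTop_atTop.comp hmul)
  have hlim2 : Tendsto (fun j : ℕ => c ^ (1 / (((l * j : ℕ) : ℝ))) * R ^ (1 / (l : ℝ))) atTop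
      (𝓝 (c ^ (0 : ℝ) * R ^ (1 / (l : ℝ)))) :=
    (((Real.continuous_const_rpow hc.ne').tendsto 0).comp hexp).mul_const _
  rw [Real.rpow_zero, one_mul] at hlim2
  refine le_of_tendsto_of_tendsto hlim hlim2 ?_
  filter_upwards [eventually_gt_atTop 0] with j hj
  have hj' : (0 : ℝ) < j := by exact_mod_cast hj
  refine Real.iSup_le (fun s => ?_) (by positivity)
  refine (Real.rpow_le_rpow (opNorm_nonneg _) (hop j s) (by positivity)).trans (le_of_eq ?_)
  rw [Real.mul_rpow hc.le (by positivity), ← Real.rpow_natCast R j, ← Real.rpow_mul hR.le]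
  congr 2
  push_cast
  field_simp

end

section

/-! ### Incomplete beta integrals -/

lemma intervalIntegrable_betaIntegrand {a b : ℝ} (ha : 0 < a) (hb : 0 < b) :
    IntervalIntegrable (fun u : ℝ => u ^ (a - 1) * (1 - u) ^ (b - 1)) volume 0 1 := by
  have h := (Complex.betaIntegral_convergent (u := a) (v := b) (by simpa) (by simpa)).norm
  rw [intervalIntegrable_iff_integrableOn_Ioo_of_le zero_le_one] at h ⊢
  refine h.congr_fun (fun x hx => ?_) measurableSet_Ioo
  have h1 : 0 < 1 - x := by linarith [hx.2]
  simp only [norm_mul]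
  have h2 : (1 : ℂ) - x = ((1 - x : ℝ) : ℂ) := by push_cast; rfl
  rw [Complex.norm_cpow_eq_rpow_re_of_pos hx.1, h2, Complex.norm_cpow_eq_rpow_re_of_pos h1]
  simp

lemma integral_betaIntegrand_pos {a b : ℝ} (ha : 0 < a) (hb : 0 < b) :
    0 < ∫ u in (0 : ℝ)..1, u ^ (a - 1) * (1 - u) ^ (b - 1) := by
  refine intervalIntegral.intervalIntegral_pos_of_pos_on
    (intervalIntegrable_betaIntegrand ha hb) (fun x hx => ?_) one_pos
  have h1 : 0 < 1 - x := by linarith [hx.2]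
  have h2 := hx.1
  positivity

lemma continuousOn_integral_betaIntegrand {a b : ℝ} (ha : 0 < a) (hb : 0 < b) :
    ContinuousOn (fun t => ∫ u in (0 : ℝ)..t, u ^ (a - 1) * (1 - u) ^ (b - 1))
      (Set.Icc 0 1) := by
  have h := intervalIntegrable_betaIntegrand ha hb
  have := intervalIntegral.continuousOn_primitive_interval (μ := volume) (a := (0 : ℝ)) (b := 1)
    (f := fun u : ℝ => u ^ (a - 1) * (1 - u) ^ (b - 1))
    (by
      rw [Set.uIcc_of_le zero_le_one]
      rwa [intervalIntegrable_iff_integrableOn_Icc_of_le zero_le_one] at h)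
  rwa [Set.uIcc_of_le zero_le_one] at this

lemma continuousOn_regBeta {a b : ℝ} (ha : 0 < a) (hb : 0 < b) :
    ContinuousOn (fun t => regBeta t a b) (Set.Icc 0 1) :=
  (continuousOn_integral_betaIntegrand ha hb).div_const _

lemma regBeta_zero (a b : ℝ) : regBeta 0 a b = 0 := by simp [regBeta]

lemma regBeta_one {a b : ℝ} (ha : 0 < a) (hb : 0 < b) : regBeta 1 a b = 1 :=
  div_self (integral_betaIntegrand_pos ha hb).ne'

lemma hasDerivAt_integral_betaIntegrand {a b x : ℝ} (ha : 0 < a) (hb : 0 < b)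
    (hx : x ∈ Set.Ioo (0 : ℝ) 1) :
    HasDerivAt (fun t => ∫ u in (0 : ℝ)..t, u ^ (a - 1) * (1 - u) ^ (b - 1))
      (x ^ (a - 1) * (1 - x) ^ (b - 1)) x := by
  have h1 : 1 - x ≠ 0 := by linarith [hx.2]
  have hintg : IntervalIntegrable (fun u : ℝ => u ^ (a - 1) * (1 - u) ^ (b - 1)) volume 0 x :=
    (intervalIntegrable_betaIntegrand ha hb).mono_set (by
      rw [Set.uIcc_of_le zero_le_one, Set.uIcc_of_le hx.1.le]
      exact Set.Icc_subset_Icc_right hx.2.le)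
  have hmeas : StronglyMeasurable fun u : ℝ => u ^ (a - 1) * (1 - u) ^ (b - 1) :=
    (by fun_prop : Measurable fun u : ℝ => u ^ (a - 1) * (1 - u) ^ (b - 1)).stronglyMeasurable
  refine intervalIntegral.integral_hasDerivAt_right hintg
    (hmeas.stronglyMeasurableAtFilter) ?_
  exact (Real.continuousAt_rpow_const x _ (Or.inl hx.1.ne')).mul
    (ContinuousAt.rpow_const (by fun_prop) (Or.inl h1))

/-- The incomplete beta integral with parameters `k/2` and `1/2`, as it arises from slicing
a cone by hyperplanes. -/
lemma slice_integral_eq {k : ℕ} (hk : 0 < k) {t : ℝ} (ht : t ∈ Set.Icc (0 : ℝ) 1) :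
    t * √(1 - t ^ 2) ^ k / (k + 1) + ∫ s in t..1, √(1 - s ^ 2) ^ k =
      k / (2 * (k + 1)) *
        ∫ u in (0 : ℝ)..(1 - t ^ 2), u ^ ((k : ℝ) / 2 - 1) * (1 - u) ^ ((1 : ℝ) / 2 - 1) := by
  have hk' : (0 : ℝ) < k := by exact_mod_cast hk
  rcases ht.2.eq_or_lt with rfl | ht1
  · simp [hk.ne']
  set B : ℝ → ℝ := fun x =>
    ∫ u in (0 : ℝ)..x, u ^ ((k : ℝ) / 2 - 1) * (1 - u) ^ ((1 : ℝ) / 2 - 1) with hB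
  -- H is the difference of the two sides: it vanishes at 1 and has zero derivative on the open
  -- interval. The mean value theorem needs only continuity at the endpoints, where the beta
  -- integrand may be singular.
  let H : ℝ → ℝ := fun t => t * √(1 - t ^ 2) ^ k / (k + 1) - (∫ s in (1 : ℝ)..t, √(1 - s ^ 2) ^ k)
    - k / (2 * (k + 1)) * B (1 - t ^ 2)
  have hcont_int : Continuous fun s : ℝ => √(1 - s ^ 2) ^ k := by fun_prop
  have hH : ContinuousOn H (Set.Icc t 1) := by
    refine ContinuousOn.sub (ContinuousOn.sub ?_ ?_) (ContinuousOn.mul continuousOn_const ?_)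
    · exact Continuous.continuousOn (by fun_prop)
    · exact (intervalIntegral.continuous_primitive
        (fun a b => hcont_int.intervalIntegrable a b) 1).continuousOn
    · refine (continuousOn_integral_betaIntegrand (a := (k : ℝ) / 2) (b := 1 / 2)
        (by positivity) (by norm_num)).comp (Continuous.continuousOn (by fun_prop)) ?_
      intro s hs
      have h0 : 0 ≤ s := ht.1.trans hs.1
      constructor <;> nlinarith [hs.2]
  have hderiv : ∀ s ∈ Set.Ioo t 1, HasDerivAt H ((fun _ => (0 : ℝ)) s) s := by
    intro s hs
    have hs0 : 0 < s := ht.1.trans_lt hs.1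
    have hy : 0 < 1 - s ^ 2 := by nlinarith [hs.2]
    have hmem : 1 - s ^ 2 ∈ Set.Ioo (0 : ℝ) 1 := ⟨hy, by nlinarith⟩
    have hin : HasDerivAt (fun r : ℝ => 1 - r ^ 2) (-(2 * s)) s := by
      simpa using (hasDerivAt_pow 2 s).const_sub 1
    have hsq : ∀ y : ℝ, 0 ≤ y → √y ^ k = y ^ ((k : ℝ) / 2) := fun y hy => by
      rw [Real.rpow_div_two_eq_sqrt _ hy, Real.rpow_natCast]
    have h1' : HasDerivAt (fun r : ℝ => (1 - r ^ 2) ^ ((k : ℝ) / 2))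
        (-(2 * s) * ((k : ℝ) / 2) * (1 - s ^ 2) ^ ((k : ℝ) / 2 - 1)) s :=
      hin.rpow_const (Or.inl hy.ne')
    have h1 : HasDerivAt (fun r : ℝ => √(1 - r ^ 2) ^ k)
        (-(2 * s) * ((k : ℝ) / 2) * (1 - s ^ 2) ^ ((k : ℝ) / 2 - 1)) s := by
      refine h1'.congr_of_eventuallyEq ?_
      have : ∀ᶠ r in 𝓝 s, 0 < 1 - r ^ 2 :=
        (hin.continuousAt).eventually (lt_mem_nhds hy)
      filter_upwards [this] with r hr
      exact hsq _ hr.le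
    have h2 := ((hasDerivAt_id s).mul h1).div_const ((k : ℝ) + 1)
    have h3 : HasDerivAt (fun r => ∫ s in (1 : ℝ)..r, √(1 - s ^ 2) ^ k) (√(1 - s ^ 2) ^ k) s :=
      intervalIntegral.integral_hasDerivAt_right (hcont_int.intervalIntegrable _ _)
        (hcont_int.stronglyMeasurableAtFilter _ _) hcont_int.continuousAt
    have h4 : HasDerivAt (fun r => B (1 - r ^ 2)) ((1 - s ^ 2) ^ ((k : ℝ) / 2 - 1) *
        (1 - (1 - s ^ 2)) ^ ((1 : ℝ) / 2 - 1) * (-(2 * s))) s := by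
      have hBd : HasDerivAt B _ (1 - s ^ 2) := hasDerivAt_integral_betaIntegrand
        (a := (k : ℝ) / 2) (b := 1 / 2) (by positivity) (by norm_num) hmem
      exact hBd.comp s hin
    have h5 := (h2.sub h3).sub (h4.const_mul ((k : ℝ) / (2 * (k + 1))))
    refine h5.congr_deriv ?_
    have hs2 : (1 - (1 - s ^ 2)) ^ ((1 : ℝ) / 2 - 1) = s⁻¹ := by
      rw [sub_sub_cancel, ← Real.rpow_natCast s 2, ← Real.rpow_mul hs0.le, ← Real.rpow_neg_one]
      norm_num
    have hy2 : √(1 - s ^ 2) ^ k = (1 - s ^ 2) * (1 - s ^ 2) ^ ((k : ℝ) / 2 - 1) := by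
      rw [hsq _ hy.le]
      nth_rewrite 2 [← Real.rpow_one (1 - s ^ 2)]
      rw [← Real.rpow_add hy]
      congr 1; ring
    rw [hs2, hy2]
    generalize (1 - s ^ 2) ^ ((k : ℝ) / 2 - 1) = y
    simp only [id]
    field_simp
    ring
  obtain ⟨c, hc, hslope⟩ := exists_hasDerivAt_eq_slope H (fun _ => 0) ht1 hH hderiv
  have hH1 : H 1 = 0 := by simp [H, hB, hk.ne']
  have hHt : H t = 0 := by
    have h1 : (1 : ℝ) - t ≠ 0 := by linarith
    rw [eq_comm, div_eq_zero_iff] at hslope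
    rcases hslope with h | h
    · linarith
    · exact absurd h h1
  have hsymm := intervalIntegral.integral_symm (μ := volume) (f := fun s : ℝ => √(1 - s ^ 2) ^ k) t 1
  simp only [H, hsymm] at hHt
  change _ = k / (2 * (k + 1)) * B (1 - t ^ 2)
  linarith

end

section

/-! ### The uniform measure of cones and of double caps -/

-- The surface measure of a set is n times the volume of the open sector over it. For a cone this
-- sector is its part in the unit ball without the origin, and the factor n cancels on normalizing.
open scoped Pointwise in
lemma sphereUniform_cone {n : ℕ} [NeZero n] {D : Set (EuclideanSpace ℝ (Fin n))}
    (hD : MeasurableSet D) (hcone : ∀ c : ℝ, 0 < c → ∀ x, c • x ∈ D ↔ x ∈ D) :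
    sphereUniform n {x | x.1 ∈ D} =
      volume (D ∩ Metric.ball 0 1) / volume (Metric.ball (0 : EuclideanSpace ℝ (Fin n)) 1) := by
  have : Nonempty (Fin n) := ⟨0⟩
  have hset : Set.Ioo (0 : ℝ) 1 • (Subtype.val '' {x : Metric.sphere (0 : EuclideanSpace ℝ (Fin n)) 1 |
      x.1 ∈ D}) = (D ∩ Metric.ball 0 1) \ {0} := by
    ext y
    rw [Set.mem_smul]
    constructor
    · rintro ⟨c, hc, _, ⟨x, hx, rfl⟩, rfl⟩
      have hx1 : ‖(x : EuclideanSpace ℝ (Fin n))‖ = 1 := by simp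
      refine ⟨⟨(hcone c hc.1 _).mpr hx, ?_⟩, ?_⟩
      · rw [mem_ball_zero_iff, norm_smul, hx1, mul_one, Real.norm_of_nonneg hc.1.le]
        exact hc.2
      · rw [Set.mem_singleton_iff, ← norm_eq_zero, norm_smul, hx1, mul_one,
          Real.norm_of_nonneg hc.1.le]
        exact hc.1.ne'
    · rintro ⟨⟨hyD, hy1⟩, hy0⟩
      have hpos : 0 < ‖y‖ := norm_pos_iff.mpr hy0
      refine ⟨‖y‖, ⟨hpos, by simpa using hy1⟩, ‖y‖⁻¹ • y, ⟨⟨‖y‖⁻¹ • y, ?_⟩, ?_, rfl⟩, ?_⟩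
      · rw [mem_sphere_zero_iff_norm, norm_smul, norm_inv, norm_norm, inv_mul_cancel₀ hpos.ne']
      · exact (hcone _ (inv_pos.mpr hpos) _).mpr hyD
      · exact smul_inv_smul₀ hpos.ne' y
  have hn0 : (n : ℝ≥0∞) ≠ 0 := by exact_mod_cast NeZero.ne n
  have hm : MeasurableSet {x : Metric.sphere (0 : EuclideanSpace ℝ (Fin n)) 1 | x.1 ∈ D} :=
    measurable_subtype_coe hD
  rw [sphereUniform, Measure.smul_apply, smul_eq_mul, Measure.toSphere_apply_univ,
    Measure.toSphere_apply' _ hm, hset,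
    measure_sdiff_null (measure_singleton _), finrank_euclideanSpace_fin, ENNReal.div_eq_inv_mul,
    ENNReal.mul_inv (Or.inl hn0) (Or.inl (ENNReal.natCast_ne_top n)), mul_mul_mul_comm,
    ENNReal.inv_mul_cancel hn0 (ENNReal.natCast_ne_top n), one_mul]

/-- The radius of the slice at height `s` of the double cone with parameter `t`, cut by the unit
ball. -/
def sliceRadius (t s : ℝ) : ℝ := if s < t then s * (√(1 - t ^ 2) / t) else √(1 - s ^ 2)

lemma sliceRadius_nonneg {t s : ℝ} (hs : 0 ≤ s) : 0 ≤ sliceRadius t s := by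
  unfold sliceRadius
  split_ifs with h
  · have : 0 < t := hs.trans_lt h
    positivity
  · positivity

/-- Here s is the axial coordinate and r the norm of the others. Below height t the cone inequality
implies the ball inequality, and above it the reverse. The value s = 0 is excluded because the
formula fails there for t = 0. -/
lemma mem_slice_iff {t s r : ℝ} (ht : t ∈ Set.Icc (0 : ℝ) 1) (hs : s ≠ 0) (hr : 0 ≤ r) :
    (t * √(s ^ 2 + r ^ 2) < |s| ∧ √(s ^ 2 + r ^ 2) < 1) ↔ r < sliceRadius t |s| := by
  have hs' : 0 < |s| := abs_pos.mpr hs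
  have hs2 : s ^ 2 = |s| ^ 2 := (sq_abs s).symm
  rw [hs2]
  set a := |s|
  have h0 : 0 ≤ a ^ 2 + r ^ 2 := by positivity
  have hsq := Real.sq_sqrt h0
  have hsn := Real.sqrt_nonneg (a ^ 2 + r ^ 2)
  set w := √(a ^ 2 + r ^ 2)
  have haw : a ≤ w := by nlinarith
  unfold sliceRadius
  split_ifs with h
  · have ht0 : 0 < t := hs'.trans h
    have hq : 0 ≤ √(1 - t ^ 2) := Real.sqrt_nonneg _
    have hq2 : √(1 - t ^ 2) ^ 2 = 1 - t ^ 2 := Real.sq_sqrt (by nlinarith [ht.2])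
    rw [← mul_div_assoc, lt_div_iff₀ ht0]
    constructor
    · rintro ⟨h1, -⟩
      refine lt_of_pow_lt_pow_left₀ 2 (by positivity) ?_
      have h3 : (t * w) ^ 2 < a ^ 2 := pow_lt_pow_left₀ h1 (by positivity) two_ne_zero
      rw [mul_pow] at h3
      rw [mul_pow, mul_pow, hq2]
      nlinarith
    · intro h1
      have h2 : t * w < a := by
        refine lt_of_pow_lt_pow_left₀ 2 hs'.le ?_
        have h3 : (r * t) ^ 2 < (a * √(1 - t ^ 2)) ^ 2 :=
          pow_lt_pow_left₀ h1 (by positivity) two_ne_zero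
        rw [mul_pow, mul_pow, hq2] at h3
        rw [mul_pow]
        nlinarith
      refine ⟨h2, ?_⟩
      nlinarith
  · have h' := not_lt.mp h
    constructor
    · rintro ⟨-, h2⟩
      refine Real.lt_sqrt_of_sq_lt ?_
      nlinarith
    · intro h1
      have h2 := (Real.lt_sqrt hr).mp h1
      have hw1 : w < 1 := by nlinarith
      refine ⟨?_, hw1⟩
      rcases ht.1.eq_or_lt with h3 | h3
      · rw [← h3, zero_mul]; exact hs'
      · nlinarith

lemma measurable_sliceRadius (t : ℝ) : Measurable (sliceRadius t) := by
  unfold sliceRadius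
  exact Measurable.ite measurableSet_Iio (by fun_prop) (by fun_prop)

lemma sliceRadius_le_one {t s : ℝ} (hs : 0 ≤ s) :
    sliceRadius t s ≤ 1 := by
  unfold sliceRadius
  split_ifs with h
  · have ht0 : 0 < t := hs.trans_lt h
    rw [← mul_div_assoc, div_le_one ht0]
    have : √(1 - t ^ 2) ≤ 1 := Real.sqrt_le_one.mpr (by nlinarith)
    nlinarith [Real.sqrt_nonneg (1 - t ^ 2)]
  · exact Real.sqrt_le_one.mpr (by nlinarith)

lemma sliceRadius_eq_zero {t s : ℝ} (ht : t ∈ Set.Icc (0 : ℝ) 1) (hs : 1 ≤ s) :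
    sliceRadius t s = 0 := by
  unfold sliceRadius
  rw [if_neg (by linarith [ht.2])]
  exact Real.sqrt_eq_zero_of_nonpos (by nlinarith)

lemma integrable_sliceRadius {k : ℕ} (hk : 0 < k) {t : ℝ} (ht : t ∈ Set.Icc (0 : ℝ) 1) :
    Integrable fun s : ℝ => sliceRadius t |s| ^ k := by
  have hm : Measurable fun s : ℝ => sliceRadius t |s| ^ k :=
    ((measurable_sliceRadius t).comp (by fun_prop : Measurable fun s : ℝ => |s|)).pow_const k
  have hsupp : Function.support (fun s : ℝ => sliceRadius t |s| ^ k) ⊆ Set.Icc (-1) 1 := by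
    intro s hs
    by_contra hcon
    refine hs ?_
    have : 1 ≤ |s| := by
      by_contra h
      exact hcon (abs_le.mp (not_le.mp h).le)
    simp only [sliceRadius_eq_zero ht this, zero_pow hk.ne']
  rw [← integrableOn_iff_integrable_of_support_subset hsupp]
  refine Measure.integrableOn_of_bounded (M := 1) (by simp) hm.aestronglyMeasurable ?_
  refine Eventually.of_forall fun s => ?_
  have h0 := sliceRadius_nonneg (t := t) (abs_nonneg s)
  rw [Real.norm_of_nonneg (pow_nonneg h0 k)]
  exact pow_le_one₀ h0 (sliceRadius_le_one (abs_nonneg s))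

lemma integral_sliceRadius {k : ℕ} (hk : 0 < k) {t : ℝ} (ht : t ∈ Set.Icc (0 : ℝ) 1) :
    ∫ s : ℝ, sliceRadius t |s| ^ k =
      2 * (t * √(1 - t ^ 2) ^ k / (k + 1) + ∫ s in t..1, √(1 - s ^ 2) ^ k) := by
  rw [integral_comp_abs (f := fun s => sliceRadius t s ^ k)]
  congr 1
  have hsub : ∫ s in Set.Ioi (0 : ℝ), sliceRadius t s ^ k =
      ∫ s in Set.Ioc (0 : ℝ) 1, sliceRadius t s ^ k := by
    refine setIntegral_eq_of_subset_of_forall_sdiff_eq_zero measurableSet_Ioi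
      Set.Ioc_subset_Ioi_self fun s hs => ?_
    have hs1 : 1 ≤ s := by
      by_contra h
      exact hs.2 ⟨hs.1, (not_le.mp h).le⟩
    rw [sliceRadius_eq_zero ht hs1, zero_pow hk.ne']
  have hintg : IntervalIntegrable (fun s => sliceRadius t s ^ k) volume 0 1 := by
    rw [intervalIntegrable_iff_integrableOn_Ioc_of_le zero_le_one]
    refine ((integrable_sliceRadius hk ht).integrableOn (s := Set.Ioc 0 1)).congr_fun
      (fun s hs => ?_) measurableSet_Ioc
    simp only [abs_of_pos hs.1]
  rw [hsub, ← intervalIntegral.integral_of_le zero_le_one,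
    ← intervalIntegral.integral_add_adjacent_intervals (b := t)
      (hintg.mono_set (by
        rw [Set.uIcc_of_le zero_le_one, Set.uIcc_of_le ht.1]
        exact Set.Icc_subset_Icc_right ht.2))
      (hintg.mono_set (by
        rw [Set.uIcc_of_le zero_le_one, Set.uIcc_of_le ht.2]
        exact Set.Icc_subset_Icc_left ht.1))]
  congr 1
  · rcases ht.1.eq_or_lt with h0 | h0
    · simp [← h0]
    -- The two formulas for the radius agree at s = t, so the linear one holds on the closed
    -- interval.
    have hcongr : ∫ s in (0 : ℝ)..t, sliceRadius t s ^ k =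
        ∫ s in (0 : ℝ)..t, s ^ k * (√(1 - t ^ 2) / t) ^ k := by
      refine intervalIntegral.integral_congr fun s hs => ?_
      rw [Set.uIcc_of_le ht.1] at hs
      simp only [sliceRadius]
      split_ifs with h
      · rw [mul_pow]
      · have : s = t := le_antisymm hs.2 (not_lt.mp h)
        rw [this, ← mul_pow, mul_div_cancel₀ _ h0.ne']
    rw [hcongr, intervalIntegral.integral_mul_const, integral_pow]
    rw [div_pow]
    field_simp
    simp
    ring
  · refine intervalIntegral.integral_congr fun s hs => ?_
    rw [Set.uIcc_of_le ht.2] at hs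
    simp only [sliceRadius, if_neg (not_lt.mpr hs.1)]

/-- Splitting off the first coordinate. -/
def splitFirst (k : ℕ) (y : EuclideanSpace ℝ (Fin (k + 1))) : ℝ × EuclideanSpace ℝ (Fin k) :=
  (y 0, WithLp.toLp 2 fun i => y i.succ)

lemma measurePreserving_splitFirst (k : ℕ) :
    MeasurePreserving (splitFirst k) volume (volume.prod volume) := by
  have h1 := EuclideanSpace.volume_preserving_symm_measurableEquiv_toLp (Fin (k + 1))
  have h2 := measurePreserving_piFinSuccAbove (fun _ : Fin (k + 1) => (volume : Measure ℝ)) 0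
  have h3 := (MeasurePreserving.id (volume : Measure ℝ)).prod
    (EuclideanSpace.volume_preserving_symm_measurableEquiv_toLp (Fin k)).symm
  have h := h3.comp (h2.comp h1)
  exact h

lemma norm_eq_sqrt_splitFirst {k : ℕ} (y : EuclideanSpace ℝ (Fin (k + 1))) :
    ‖y‖ = √((splitFirst k y).1 ^ 2 + ‖(splitFirst k y).2‖ ^ 2) := by
  rw [EuclideanSpace.norm_eq, EuclideanSpace.norm_eq, Real.sq_sqrt (by positivity),
    Fin.sum_univ_succ]
  simp [splitFirst]

/-- Fubini along the axis: almost every slice is a ball of dimension k, of volume radius^k times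
that of the unit ball. -/
lemma volume_cone_coord {k : ℕ} (hk : 0 < k) {t : ℝ} (ht : t ∈ Set.Icc (0 : ℝ) 1) :
    volume {y : EuclideanSpace ℝ (Fin (k + 1)) | t * ‖y‖ < |y 0| ∧ ‖y‖ < 1} =
      ENNReal.ofReal (2 * (t * √(1 - t ^ 2) ^ k / (k + 1) + ∫ s in t..1, √(1 - s ^ 2) ^ k)) *
        volume (Metric.ball (0 : EuclideanSpace ℝ (Fin k)) 1) := by
  have : Nonempty (Fin k) := ⟨⟨0, hk⟩⟩
  let Q : Set (ℝ × EuclideanSpace ℝ (Fin k)) :=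
    {p | t * √(p.1 ^ 2 + ‖p.2‖ ^ 2) < |p.1| ∧ √(p.1 ^ 2 + ‖p.2‖ ^ 2) < 1}
  have hQ : MeasurableSet Q := by
    simp only [Q, Set.ofPred_and]
    exact (measurableSet_lt (by fun_prop) (by fun_prop)).inter
      (measurableSet_lt (by fun_prop) (by fun_prop))
  have hset : {y : EuclideanSpace ℝ (Fin (k + 1)) | t * ‖y‖ < |y 0| ∧ ‖y‖ < 1} =
      splitFirst k ⁻¹' Q := by
    ext y
    simp only [Set.mem_ofPred_eq, Set.mem_preimage, Q, norm_eq_sqrt_splitFirst y]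
    rfl
  rw [hset, (measurePreserving_splitFirst k).measure_preimage hQ.nullMeasurableSet,
    Measure.prod_apply hQ, ← integral_sliceRadius hk ht,
    ofReal_integral_eq_lintegral_ofReal (integrable_sliceRadius hk ht)
      (Eventually.of_forall fun s => pow_nonneg (sliceRadius_nonneg (abs_nonneg s)) k),
    ← lintegral_mul_const' _ _ measure_ball_lt_top.ne]
  refine lintegral_congr_ae ?_
  filter_upwards [Measure.ae_ne volume (0 : ℝ)] with s hs
  have hslice : Prod.mk s ⁻¹' Q = Metric.ball 0 (sliceRadius t |s|) := by
    ext v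
    rw [mem_ball_zero_iff, ← mem_slice_iff ht hs (norm_nonneg v)]
    rfl
  rw [hslice, Measure.addHaar_ball _ _ (sliceRadius_nonneg (abs_nonneg s)),
    finrank_euclideanSpace_fin]

/-- Rotation invariance: a is completed to an orthonormal basis whose coordinate map preserves
volume. -/
lemma volume_double_cone {n : ℕ} (a : EuclideanSpace ℝ (Fin (n + 1))) (ha : ‖a‖ = 1) (t : ℝ) :
    volume {y : EuclideanSpace ℝ (Fin (n + 1)) | t * ‖y‖ < |inner ℝ a y| ∧ ‖y‖ < 1} =
      volume {y : EuclideanSpace ℝ (Fin (n + 1)) | t * ‖y‖ < |y 0| ∧ ‖y‖ < 1} := by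
  obtain ⟨b, hb⟩ := Orthonormal.exists_orthonormalBasis_extension_of_card_eq (𝕜 := ℝ)
    (E := EuclideanSpace ℝ (Fin (n + 1))) (ι := Fin (n + 1)) (by simp)
    (v := fun _ => a) (s := {0}) (by
      rw [orthonormal_iff_ite]
      intro i j
      rw [Subsingleton.elim i j]
      simp [ha])
  have hb0 : b 0 = a := hb 0 rfl
  have hQ : MeasurableSet {y : EuclideanSpace ℝ (Fin (n + 1)) | t * ‖y‖ < |y 0| ∧ ‖y‖ < 1} := by
    rw [Set.ofPred_and]
    exact (measurableSet_lt (by fun_prop) (by fun_prop)).inter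
      (measurableSet_lt (by fun_prop) (by fun_prop))
  rw [← b.measurePreserving_repr.measure_preimage hQ.nullMeasurableSet]
  congr 1
  ext y
  simp only [Set.mem_ofPred_eq, Set.mem_preimage, LinearIsometryEquiv.norm_map,
    OrthonormalBasis.repr_apply_apply, hb0]

/-- The proportion of the unit ball in a double cone is a regularized incomplete beta function. -/
theorem volume_double_cap_div {n : ℕ} (hn : 2 ≤ n) {a : EuclideanSpace ℝ (Fin n)}
    (ha : ‖a‖ = 1) {t : ℝ} (ht : t ∈ Set.Icc (0 : ℝ) 1) :
    volume ({y | t * ‖y‖ < |inner ℝ a y|} ∩ Metric.ball 0 1) /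
        volume (Metric.ball (0 : EuclideanSpace ℝ (Fin n)) 1) =
      ENNReal.ofReal (regBeta (1 - t ^ 2) (((n : ℝ) - 1) / 2) (1 / 2)) := by
  obtain ⟨k, rfl⟩ : ∃ k, n = k + 1 := ⟨n - 1, by omega⟩
  have hk : 0 < k := by omega
  have hk' : (0 : ℝ) < k := by exact_mod_cast hk
  have hcap : ∀ s ∈ Set.Icc (0 : ℝ) 1,
      volume ({y : EuclideanSpace ℝ (Fin (k + 1)) | s * ‖y‖ < |inner ℝ a y|} ∩
        Metric.ball 0 1) = ENNReal.ofReal (2 * (k / (2 * (k + 1)) *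
          ∫ u in (0 : ℝ)..(1 - s ^ 2), u ^ ((k : ℝ) / 2 - 1) * (1 - u) ^ ((1 : ℝ) / 2 - 1))) *
        volume (Metric.ball (0 : EuclideanSpace ℝ (Fin k)) 1) := by
    intro s hs
    rw [← slice_integral_eq hk hs, ← volume_cone_coord hk hs, ← volume_double_cone a ha]
    congr 1
    ext y
    simp
  -- Up to a hyperplane the unit ball is the double cone with t = 0, so one formula gives both
  -- numerator and denominator and the constants cancel.
  have hball : volume (Metric.ball (0 : EuclideanSpace ℝ (Fin (k + 1))) 1) =
      volume {y : EuclideanSpace ℝ (Fin (k + 1)) | 0 * ‖y‖ < |y 0| ∧ ‖y‖ < 1} := by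
    refine le_antisymm ?_ (measure_mono fun y hy => by simpa using hy.2)
    have hsub : Metric.ball (0 : EuclideanSpace ℝ (Fin (k + 1))) 1 ⊆
        {y : EuclideanSpace ℝ (Fin (k + 1)) | 0 * ‖y‖ < |y 0| ∧ ‖y‖ < 1} ∪ {y | y 0 = 0} := by
      intro y hy
      by_cases h0 : y 0 = 0
      · exact Or.inr h0
      · exact Or.inl ⟨by simpa using h0, by simpa using hy⟩
    refine (measure_mono hsub).trans ((measure_union_le _ _).trans ?_)
    rw [volume_setOf_apply_eq, add_zero]
  have h0 : (0 : ℝ) ∈ Set.Icc (0 : ℝ) 1 := ⟨le_rfl, zero_le_one⟩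
  have hω0 : volume (Metric.ball (0 : EuclideanSpace ℝ (Fin k)) 1) ≠ 0 :=
    (Metric.measure_ball_pos _ _ one_pos).ne'
  have hωt : volume (Metric.ball (0 : EuclideanSpace ℝ (Fin k)) 1) ≠ ⊤ := measure_ball_lt_top.ne
  have hpos := integral_betaIntegrand_pos (a := (k : ℝ) / 2) (b := 1 / 2) (by positivity)
    (by norm_num)
  rw [hball, volume_cone_coord hk h0, slice_integral_eq hk h0, hcap t ht,
    ENNReal.mul_div_mul_right _ _ hω0 hωt]
  simp only [ne_eq, OfNat.ofNat_ne_zero, not_false_eq_true, zero_pow, sub_zero]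
  rw [← ENNReal.ofReal_div_of_pos (by positivity)]
  congr 1
  rw [mul_div_mul_left _ _ two_ne_zero, mul_div_mul_left _ _ (by positivity), regBeta]
  push_cast
  rw [add_sub_cancel_right]

end

section

variable {n : ℕ}

/-! ### Extreme eigenvalues -/

lemma posSemidef_sub_smul_one_iff {P : Matrix (Fin n) (Fin n) ℝ} (hP : P.IsHermitian) (c : ℝ) :
    (P - c • (1 : Matrix (Fin n) (Fin n) ℝ)).PosSemidef ↔ ∀ a ∈ spectrum ℝ P, c ≤ a := by
  rw [Matrix.posSemidef_iff_isHermitian_and_spectrum_nonneg, ← Algebra.algebraMap_eq_smul_one,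
    ← spectrum.sub_singleton_eq]
  have hh : (P - algebraMap ℝ (Matrix (Fin n) (Fin n) ℝ) c).IsHermitian := by
    refine hP.sub ?_
    rw [Algebra.algebraMap_eq_smul_one]
    ext i j
    simp [Matrix.one_apply, eq_comm]
  simp only [hh, true_and, Set.sub_singleton, Set.image_subset_iff]
  constructor
  · intro h a ha
    exact sub_nonneg.mp (h ha)
  · intro h a ha
    exact sub_nonneg.mpr (h a ha)

lemma posSemidef_smul_one_sub_iff {P : Matrix (Fin n) (Fin n) ℝ} (hP : P.IsHermitian) (c : ℝ) :
    (c • (1 : Matrix (Fin n) (Fin n) ℝ) - P).PosSemidef ↔ ∀ a ∈ spectrum ℝ P, a ≤ c := by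
  rw [Matrix.posSemidef_iff_isHermitian_and_spectrum_nonneg, ← Algebra.algebraMap_eq_smul_one,
    ← spectrum.singleton_sub_eq]
  have hh : (algebraMap ℝ (Matrix (Fin n) (Fin n) ℝ) c - P).IsHermitian := by
    refine Matrix.IsHermitian.sub ?_ hP
    rw [Algebra.algebraMap_eq_smul_one]
    ext i j
    simp [Matrix.one_apply, eq_comm]
  simp only [hh, true_and, Set.singleton_sub, Set.image_subset_iff]
  constructor
  · intro h a ha
    exact sub_nonneg.mp (h ha)
  · intro h a ha
    exact sub_nonneg.mpr (h a ha)

lemma finite_spectrum {P : Matrix (Fin n) (Fin n) ℝ} (hP : P.IsHermitian) :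
    (spectrum ℝ P).Finite := by
  rw [hP.spectrum_real_eq_range_eigenvalues]
  exact Set.finite_range _

lemma nonempty_spectrum [NeZero n] {P : Matrix (Fin n) (Fin n) ℝ} (hP : P.IsHermitian) :
    (spectrum ℝ P).Nonempty := by
  rw [hP.spectrum_real_eq_range_eigenvalues]
  exact Set.range_nonempty _

lemma one_le_eigMin [NeZero n] {P : Matrix (Fin n) (Fin n) ℝ} (hP : (P - 1).PosSemidef) :
    1 ≤ eigMin P := by
  have hH := (posSemidef_of_sub_one hP).1
  exact le_csInf (nonempty_spectrum hH)
    ((posSemidef_sub_smul_one_iff hH 1).mp (by simpa using hP))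

lemma eigMin_le_eigMax [NeZero n] {P : Matrix (Fin n) (Fin n) ℝ} (hP : P.IsHermitian) :
    eigMin P ≤ eigMax P :=
  csInf_le_csSup (nonempty_spectrum hP) (finite_spectrum hP).bddBelow (finite_spectrum hP).bddAbove

lemma eigMin_mul_le_quadForm {P : Matrix (Fin n) (Fin n) ℝ} (hP : P.IsHermitian)
    (x : EuclideanSpace ℝ (Fin n)) : eigMin P * ‖x‖ ^ 2 ≤ quadForm P x := by
  have h := quadForm_nonneg ((posSemidef_sub_smul_one_iff hP (eigMin P)).mpr
    fun a ha => csInf_le (finite_spectrum hP).bddBelow ha) x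
  have h2 := quadForm_add (P - eigMin P • 1) (eigMin P • 1) x
  rw [sub_add_cancel, quadForm_smul, quadForm_one] at h2
  linarith

lemma quadForm_le_eigMax_mul {P : Matrix (Fin n) (Fin n) ℝ} (hP : P.IsHermitian)
    (x : EuclideanSpace ℝ (Fin n)) : quadForm P x ≤ eigMax P * ‖x‖ ^ 2 := by
  have h := quadForm_nonneg ((posSemidef_smul_one_sub_iff hP (eigMax P)).mpr
    fun a ha => le_csSup (finite_spectrum hP).bddAbove ha) x
  have h2 := quadForm_add (eigMax P • 1 - P) P x
  rw [sub_add_cancel, quadForm_smul, quadForm_one] at h2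
  linarith

/-! ### From a small exceptional set of directions to an operator bound -/

lemma quadNorm_transpose_mul_self (B : Matrix (Fin n) (Fin n) ℝ) (x : EuclideanSpace ℝ (Fin n)) :
    quadNorm (B.transpose * B) x = ‖Matrix.toEuclideanCLM (n := Fin n) (𝕜 := ℝ) B x‖ := by
  rw [quadNorm_eq_sqrt, quadForm_transpose_mul_self, Real.sqrt_sq (norm_nonneg _)]

open scoped Pointwise in
lemma volume_cone_inter_ball_le {D : Set (EuclideanSpace ℝ (Fin n))}
    (hcone : ∀ c : ℝ, 0 < c → ∀ x, c • x ∈ D ↔ x ∈ D) {r : ℝ} (hr : 0 < r) :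
    volume (D ∩ Metric.ball 0 r) ≤ ENNReal.ofReal (r ^ n) * volume (D ∩ Metric.ball 0 1) := by
  have hsub : D ∩ Metric.ball 0 r ⊆ r • (D ∩ Metric.ball 0 1) := by
    rintro x ⟨hx, hxr⟩
    refine Set.mem_smul_set.mpr ⟨r⁻¹ • x, ⟨(hcone _ (inv_pos.mpr hr) x).mpr hx, ?_⟩,
      smul_inv_smul₀ hr.ne' x⟩
    rw [mem_ball_zero_iff] at hxr ⊢
    rw [norm_smul, norm_inv, Real.norm_of_nonneg hr.le, inv_mul_lt_iff₀ hr, mul_one]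
    exact hxr
  refine (measure_mono hsub).trans ?_
  rw [Measure.addHaar_smul, finrank_euclideanSpace_fin, abs_of_pos (pow_pos hr n)]

/-- Immediate from the definition as a supremum; monotonicity of the incomplete beta function is not
needed. -/
lemma le_regBetaInv {x y a b : ℝ} (hx : x ∈ Set.Icc (0 : ℝ) 1) (h : regBeta x a b ≤ y) :
    x ≤ regBetaInv y a b :=
  le_csSup ⟨1, fun _ ht => ht.1.2⟩ ⟨hx, h⟩

lemma regBetaInv_nonneg (y a b : ℝ) : 0 ≤ regBetaInv y a b :=
  Real.sSup_nonneg fun _ ht => ht.1.1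

lemma deltaFun_le_one (n : ℕ) (x : ℝ) : deltaFun n x ≤ 1 :=
  Real.sqrt_le_one.mpr (by linarith [regBetaInv_nonneg (2 * x) (((n : ℝ) - 1) / 2) (1 / 2)])

lemma kappa_nonneg (P : Matrix (Fin n) (Fin n) ℝ) : 0 ≤ kappa P := Real.sqrt_nonneg _

/-- The proportion of directions, measured in the coordinates that turn `P` into the identity, is
at most `κ(P)` times the proportion measured on the unit sphere. -/
lemma volume_double_cone_le (hn : 0 < n) {B : Matrix (Fin n) (Fin n) ℝ}
    (hB : (B.transpose * B - 1).PosSemidef) {D S : Set (EuclideanSpace ℝ (Fin n))}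
    (hD : MeasurableSet D) (hcone : ∀ c : ℝ, 0 < c → ∀ x, c • x ∈ D ↔ x ∈ D)
    (hS : ∀ y ∈ S, ∃ x ∈ D, Matrix.toEuclideanCLM (n := Fin n) (𝕜 := ℝ) B x = y) :
    volume (S ∩ Metric.ball 0 1) / volume (Metric.ball (0 : EuclideanSpace ℝ (Fin n)) 1) ≤
      ENNReal.ofReal (kappa (B.transpose * B)) * sphereUniform n {x | x.1 ∈ D} := by
  have : NeZero n := ⟨hn.ne'⟩
  set P := B.transpose * B with hP
  have hH := (posSemidef_of_sub_one hB).1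
  have hμ : 0 < eigMin P := one_pos.trans_le (one_le_eigMin hB)
  -- ‖B x‖ < 1 forces ‖x‖ < r, as λmin ‖x‖² ≤ ‖B x‖².
  set r : ℝ := (√(eigMin P))⁻¹ with hr
  have hsμ : 0 < √(eigMin P) := Real.sqrt_pos.mpr hμ
  have hr0 : 0 < r := inv_pos.mpr hsμ
  have hsub : S ∩ Metric.ball 0 1 ⊆ ((Matrix.toEuclideanCLM (n := Fin n) (𝕜 := ℝ) B :
      EuclideanSpace ℝ (Fin n) →ₗ[ℝ] EuclideanSpace ℝ (Fin n)) '' (D ∩ Metric.ball 0 r)) := by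
    rintro y ⟨hyS, hy1⟩
    obtain ⟨x, hxD, rfl⟩ := hS y hyS
    refine ⟨x, ⟨hxD, ?_⟩, rfl⟩
    have h1 := eigMin_mul_le_quadForm hH x
    rw [hP, quadForm_transpose_mul_self, ← hP] at h1
    rw [mem_ball_zero_iff] at hy1 ⊢
    rw [hr, ← one_div, lt_div_iff₀ hsμ]
    have h2 := Real.sq_sqrt hμ.le
    have h3 : ‖Matrix.toEuclideanCLM (n := Fin n) (𝕜 := ℝ) B x‖ ^ 2 < 1 :=
      pow_lt_one₀ (norm_nonneg _) hy1 two_ne_zero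
    refine lt_of_pow_lt_pow_left₀ 2 zero_le_one ?_
    rw [mul_pow, h2, one_pow, mul_comm]
    exact h1.trans_lt h3
  -- κ combines the Jacobian of B with the rescaling of the ball of radius r to the unit ball.
  have hdet : |B.det| * r ^ n = kappa P := by
    have hsq : √(eigMin P ^ n) = √(eigMin P) ^ n := by
      rw [Real.sqrt_eq_iff_mul_self_eq (by positivity) (by positivity), ← mul_pow,
        Real.mul_self_sqrt hμ.le]
    have hdetP : P.det = B.det * B.det := by rw [hP, Matrix.det_mul, Matrix.det_transpose]
    rw [kappa, hdetP, Real.sqrt_div' _ (by positivity), Real.sqrt_mul_self_eq_abs, hsq, hr,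
      inv_pow, div_eq_mul_inv]
  rw [sphereUniform_cone hD hcone, ← mul_div_assoc]
  refine ENNReal.div_le_div_right ?_ _
  refine (measure_mono hsub).trans ?_
  rw [Measure.addHaar_image_linearMap, det_toEuclideanCLM, ← hdet,
    ENNReal.ofReal_mul (abs_nonneg _), mul_assoc]
  exact mul_le_mul_right (volume_cone_inter_ball_le hcone hr0) _

/-- If `‖M x‖_P ≤ c ‖x‖_P` fails only for a proportion at most `η` of the directions, it holds in
all directions for the larger constant `c / δ(η κ(P) / 2)`. -/
theorem deltaFun_mul_quadNorm_le (hn : 2 ≤ n) {P : Matrix (Fin n) (Fin n) ℝ}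
    (hP : (P - 1).PosSemidef) (M : Matrix (Fin n) (Fin n) ℝ) {c η : ℝ} (hc : 0 < c) (hη : 0 ≤ η)
    (h : sphereUniform n {x | c * quadNorm P x.1 <
      quadNorm P (Matrix.toEuclideanCLM (n := Fin n) (𝕜 := ℝ) M x.1)} ≤ ENNReal.ofReal η)
    (x : EuclideanSpace ℝ (Fin n)) :
    deltaFun n (η * kappa P / 2) *
      quadNorm P (Matrix.toEuclideanCLM (n := Fin n) (𝕜 := ℝ) M x) ≤ c * quadNorm P x := by
  have hdetP := det_ne_zero_of_sub_one hP
  obtain ⟨B, rfl⟩ := exists_eq_transpose_mul_self (posSemidef_of_sub_one hP)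
  have hdet : IsUnit B.det := by
    rw [isUnit_iff_ne_zero]
    intro h0
    exact hdetP (by simp [h0])
  simp only [quadNorm_transpose_mul_self] at h ⊢
  set f := Matrix.toEuclideanCLM (n := Fin n) (𝕜 := ℝ) B with hf
  set g := Matrix.toEuclideanCLM (n := Fin n) (𝕜 := ℝ) M with hg
  -- T is M in the coordinates y = B x, in which the P-norm is Euclidean.
  set T := Matrix.toEuclideanCLM (n := Fin n) (𝕜 := ℝ) (B * M * B⁻¹) with hT
  have hTf : ∀ x, T (f x) = f (g x) := by
    intro x
    rw [hT, hf, hg, ← mul_apply_eq_comp, ← map_mul, mul_assoc, Matrix.nonsing_inv_mul B hdet,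
      mul_one, map_mul, mul_apply_eq_comp]
  have hsurj : ∀ y, ∃ x, f x = y := by
    intro y
    refine ⟨Matrix.toEuclideanCLM (n := Fin n) (𝕜 := ℝ) B⁻¹ y, ?_⟩
    rw [hf, ← mul_apply_eq_comp, ← map_mul, Matrix.mul_nonsing_inv B hdet, map_one]
    rfl
  set δ := deltaFun n (η * kappa (B.transpose * B) / 2) with hδ
  have hδ0 : 0 ≤ δ := Real.sqrt_nonneg _
  -- Bounding the adjoint on all unit vectors gives the bound on T without choosing a norming
  -- vector.
  have hkey : ∀ b, ‖b‖ = 1 → δ * ‖ContinuousLinearMap.adjoint T b‖ ≤ c := by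
    intro b hb
    set s := ‖ContinuousLinearMap.adjoint T b‖ with hs
    rcases le_or_gt s c with hsc | hsc
    · calc δ * s ≤ 1 * s := mul_le_mul_of_nonneg_right (deltaFun_le_one _ _) (norm_nonneg _)
        _ ≤ c := by rwa [one_mul]
    have hs0 : 0 < s := hc.trans hsc
    -- Since |⟨a, y⟩| = |⟨b, T y⟩| / s ≤ ‖T y‖ / s, the double cone |⟨a, y⟩| > (c/s) ‖y‖ consists of
    -- directions with ‖T y‖ > c ‖y‖.
    set a := s⁻¹ • ContinuousLinearMap.adjoint T b with ha
    have ha1 : ‖a‖ = 1 := by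
      rw [ha, norm_smul, norm_inv, Real.norm_of_nonneg hs0.le, ← hs, inv_mul_cancel₀ hs0.ne']
    have ht : c / s ∈ Set.Icc (0 : ℝ) 1 := ⟨by positivity, (div_le_one hs0).mpr hsc.le⟩
    have hD : MeasurableSet {x | c * ‖f x‖ < ‖f (g x)‖} :=
      (isOpen_lt (by fun_prop) (by fun_prop)).measurableSet
    have hle := volume_double_cone_le (by omega) hP (D := {x | c * ‖f x‖ < ‖f (g x)‖})
      (S := {y | c / s * ‖y‖ < |inner ℝ a y|}) hD ?_ ?_
    · rw [volume_double_cap_div hn ha1 ht] at hle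
      have hle2 := hle.trans (mul_le_mul_right h _)
      rw [← ENNReal.ofReal_mul (kappa_nonneg _), ENNReal.ofReal_le_ofReal_iff
        (mul_nonneg (kappa_nonneg _) hη)] at hle2
      have hmem : 1 - (c / s) ^ 2 ∈ Set.Icc (0 : ℝ) 1 :=
        ⟨by nlinarith [ht.1, ht.2], by nlinarith [ht.1]⟩
      -- The cap measure I_{1-(c/s)²} is at most η κ. The factor 2 in `deltaFun` cancels the halving
      -- of its argument, because the cap is double.
      have hinv := le_regBetaInv (y := 2 * (η * kappa (B.transpose * B) / 2)) hmem
        (hle2.trans (le_of_eq (by ring)))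
      have hδt : δ ≤ c / s := by
        rw [hδ, deltaFun, Real.sqrt_le_left ht.1]
        linarith
      rwa [le_div_iff₀ hs0] at hδt
    · intro k hk x
      simp only [Set.mem_ofPred_eq, map_smul, norm_smul, Real.norm_of_nonneg hk.le]
      rw [mul_left_comm, mul_lt_mul_iff_right₀ hk]
    · intro y hy
      obtain ⟨x, rfl⟩ := hsurj y
      refine ⟨x, ?_, rfl⟩
      have hy' : c / s * ‖f x‖ < |inner ℝ a (f x)| := hy
      rw [ha, real_inner_smul_left, ContinuousLinearMap.adjoint_inner_left, hTf, abs_mul,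
        abs_of_pos (inv_pos.mpr hs0), div_mul_eq_mul_div, div_lt_iff₀ hs0, mul_comm _ s,
        mul_inv_cancel_left₀ hs0.ne'] at hy'
      refine hy'.trans_le ((abs_real_inner_le_norm _ _).trans ?_)
      rw [hb, one_mul]
  rw [← hTf]
  rcases eq_or_ne (T (f x)) 0 with h0 | h0
  · rw [h0, norm_zero, mul_zero]
    positivity
  have hw : 0 < ‖T (f x)‖ := norm_pos_iff.mpr h0
  have hb : ‖‖T (f x)‖⁻¹ • T (f x)‖ = 1 := by
    rw [norm_smul, norm_inv, norm_norm, inv_mul_cancel₀ hw.ne']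
  have h1 := hkey _ hb
  have h2 := real_inner_le_norm (ContinuousLinearMap.adjoint T (‖T (f x)‖⁻¹ • T (f x))) (f x)
  rw [ContinuousLinearMap.adjoint_inner_left, real_inner_smul_left, real_inner_self_eq_norm_sq,
    pow_two, inv_mul_cancel_left₀ hw.ne'] at h2
  calc δ * ‖T (f x)‖ ≤ δ * (‖ContinuousLinearMap.adjoint T (‖T (f x)‖⁻¹ • T (f x))‖ * ‖f x‖) :=
        mul_le_mul_of_nonneg_left h2 hδ0
    _ = δ * ‖ContinuousLinearMap.adjoint T (‖T (f x)‖⁻¹ • T (f x))‖ * ‖f x‖ := by ring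
    _ ≤ c * ‖f x‖ := mul_le_mul_of_nonneg_right h1 (norm_nonneg _)

end

/-! ### Combining the spectral bound with the confidence bound. -/

section

variable {n m l : ℕ} {U E : Type*} (G : LabeledGraph U E m)
  (A : Fin m → Matrix (Fin n) (Fin n) ℝ) {C : ℝ}

/-! ### The spectral bound at a point of small violation probability -/

/-- Positivity makes a positive contraction rate available and turns the quotient by δ = 0 into ∞
rather than 0. -/
lemma lamBar_pos [NeZero n] {W : ℝ} (hW : 0 < W) {q : ℝ × Matrix (Fin n) (Fin n) ℝ}
    (hq : 0 ≤ q.1) (hP : (q.2 - 1).PosSemidef) : 0 < lamBar l W q := by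
  have h1 : 0 < eigMin q.2 := one_pos.trans_le (one_le_eigMin hP)
  have h2 : 0 < eigMax q.2 := h1.trans_le (eigMin_le_eigMax (posSemidef_of_sub_one hP).1)
  unfold lamBar
  positivity

lemma quadNorm_le_add {P : Matrix (Fin n) (Fin n) ℝ} (hP : P.PosSemidef)
    (x w : EuclideanSpace ℝ (Fin n)) : quadNorm P x ≤ quadNorm P (x + w) + quadNorm P w := by
  obtain ⟨B, rfl⟩ := exists_eq_transpose_mul_self hP
  simp only [quadNorm_transpose_mul_self, map_add]
  simpa using norm_sub_le (Matrix.toEuclideanCLM (n := Fin n) (𝕜 := ℝ) B x +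
    Matrix.toEuclideanCLM (n := Fin n) (𝕜 := ℝ) B w) (Matrix.toEuclideanCLM (n := Fin n) (𝕜 := ℝ) B w)

/-- A sample with bounded noise whose constraint holds satisfies the noise-free constraint with the
rate `lamBar`. -/
lemma quadNorm_le_lamBar_of_slack [NeZero n] {W : ℝ} {q : ℝ × Matrix (Fin n) (Fin n) ℝ}
    (hq : 0 ≤ q.1) (hP : (q.2 - 1).PosSemidef) {z : Sample n m l} (hz : ‖z.2.2‖ ≤ W)
    (hs : slack A z q.1 q.2 ≤ 0) :
    quadNorm q.2 (Matrix.toEuclideanCLM (n := Fin n) (𝕜 := ℝ) (wordProd A z.2.1) z.1.1) ≤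
      lamBar l W q * quadNorm q.2 z.1.1 := by
  have hH := (posSemidef_of_sub_one hP).1
  have h1 : 0 < eigMin q.2 := one_pos.trans_le (one_le_eigMin hP)
  have h2 : 0 < eigMax q.2 := h1.trans_le (eigMin_le_eigMax hH)
  have hcon := (quadNorm_le_iff_slack A hP hq z).mpr hs
  have htri := quadNorm_le_add (posSemidef_of_sub_one hP)
    (Matrix.toEuclideanCLM (n := Fin n) (𝕜 := ℝ) (wordProd A z.2.1) z.1.1) z.2.2
  have hw : quadNorm q.2 z.2.2 ≤ √(eigMax q.2) * W := by
    rw [quadNorm_eq_sqrt]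
    refine (Real.sqrt_le_sqrt (quadForm_le_eigMax_mul hH _)).trans ?_
    rw [Real.sqrt_mul h2.le, Real.sqrt_sq (norm_nonneg _)]
    exact mul_le_mul_of_nonneg_left hz (Real.sqrt_nonneg _)
  -- As ‖x‖ = 1, this lower bound converts the additive noise term into a multiple of ‖x‖_P.
  have hx : √(eigMin q.2) ≤ quadNorm q.2 z.1.1 := by
    rw [quadNorm_eq_sqrt]
    refine Real.sqrt_le_sqrt ?_
    simpa using eigMin_mul_le_quadForm hH z.1.1
  have hW : 0 ≤ W := (norm_nonneg _).trans hz
  have hs1 : 0 < √(eigMin q.2) := Real.sqrt_pos.mpr h1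
  have hwx : quadNorm q.2 z.2.2 ≤ √(eigMax q.2 / eigMin q.2) * W * quadNorm q.2 z.1.1 := by
    refine hw.trans ?_
    calc √(eigMax q.2) * W = √(eigMax q.2 / eigMin q.2) * W * √(eigMin q.2) := by
          rw [Real.sqrt_div h2.le]
          field_simp
      _ ≤ _ := mul_le_mul_of_nonneg_left hx (by positivity)
  calc _ ≤ _ := htri
    _ ≤ q.1 ^ l * quadNorm q.2 z.1.1 + √(eigMax q.2 / eigMin q.2) * W * quadNorm q.2 z.1.1 :=
        add_le_add hcon hwx
    _ = _ := by rw [lamBar]; ring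

lemma uniformOn_language_singleton {s : Fin l → Fin m} (hs : s ∈ G.language l) :
    ProbabilityTheory.uniformOn (G.language l) {s} = ((G.language l).ncard : ℝ≥0∞)⁻¹ := by
  have hfin := Set.toFinite (G.language l)
  rw [ProbabilityTheory.uniformOn, ProbabilityTheory.cond_apply hfin.measurableSet,
    Set.inter_eq_right.mpr (Set.singleton_subset_iff.mpr hs), Measure.count_singleton, mul_one,
    Measure.count_apply hfin.measurableSet, ← hfin.cast_ncard_eq]
  rfl

/-- A state at which the rate `lamBar` fails for s violates the sampled constraint for every noise
of norm at most W. These samples form a product set, in which {s} has mass one over the number of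
words. -/
lemma sphereUniform_le_of_violation [NeZero n] (hG : (G.language l).Nonempty) {W : ℝ}
    (μw : Measure (EuclideanSpace ℝ (Fin n))) [IsProbabilityMeasure μw]
    (hμW : ∀ᵐ w ∂μw, ‖w‖ ≤ W) {q : ℝ × Matrix (Fin n) (Fin n) ℝ} (hq : 0 ≤ q.1)
    (hP : (q.2 - 1).PosSemidef) {ε : ℝ} (hε : 0 ≤ ε)
    (hV : sampleLaw G l μw {z | 0 < slack A z q.1 q.2} ≤ ENNReal.ofReal ε)
    {s : Fin l → Fin m} (hs : s ∈ G.language l) :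
    sphereUniform n {x | lamBar l W q * quadNorm q.2 x.1 <
      quadNorm q.2 (Matrix.toEuclideanCLM (n := Fin n) (𝕜 := ℝ) (wordProd A s) x.1)} ≤
      ENNReal.ofReal (ε * (G.language l).ncard) := by
  have := isProbabilityMeasure_uniformOn G hG
  have hK : (G.language l).ncard ≠ 0 := (Set.ncard_pos (Set.toFinite _)).mpr hG |>.ne'
  set X : Set (Metric.sphere (0 : EuclideanSpace ℝ (Fin n)) 1) :=
    {x | lamBar l W q * quadNorm q.2 x.1 <
      quadNorm q.2 (Matrix.toEuclideanCLM (n := Fin n) (𝕜 := ℝ) (wordProd A s) x.1)} with hX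
  have hsub : X ×ˢ ({s} ×ˢ {w | ‖w‖ ≤ W}) ⊆
      {z : Sample n m l | 0 < slack A z q.1 q.2} := by
    rintro ⟨x, s', w⟩ ⟨hx, hs', hw⟩
    obtain rfl : s' = s := hs'
    by_contra hcon
    have := quadNorm_le_lamBar_of_slack A (W := W) hq hP (z := (x, s', w)) hw (not_lt.mp hcon)
    exact absurd hx (not_lt.mpr this)
  have hle := (measure_mono hsub).trans hV
  have hw1 : μw {w | ‖w‖ ≤ W} = 1 := prob_compl_eq_zero_iff
    (measurableSet_le measurable_norm measurable_const) |>.mp hμW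
  rw [sampleLaw, Measure.prod_prod, Measure.prod_prod, uniformOn_language_singleton G hs, hw1,
    mul_one, ← ENNReal.div_eq_inv_mul.trans (mul_comm _ _),
    ENNReal.div_le_iff_le_mul (Or.inl (by exact_mod_cast hK)) (Or.inl (ENNReal.natCast_ne_top _))]
    at hle
  rwa [ENNReal.ofReal_mul hε, ENNReal.ofReal_natCast]

/-- The spectral bound holds at every point of violation probability at most `ε(β, N)`. -/
theorem ofReal_cjsr_le_rhoBar (hn : 2 ≤ n) (hl : 0 < l) (hG : (G.language l).Nonempty) {W : ℝ}
    (hW : 0 < W) (μw : Measure (EuclideanSpace ℝ (Fin n))) [IsProbabilityMeasure μw]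
    (hμW : ∀ᵐ w ∂μw, ‖w‖ ≤ W) {q : ℝ × Matrix (Fin n) (Fin n) ℝ} (hq : 0 ≤ q.1)
    (hP : (q.2 - 1).PosSemidef) {N : ℕ} {β : ℝ} (hε : 0 ≤ epsLevel n N β)
    (hV : sampleLaw G l μw {z | 0 < slack A z q.1 q.2} ≤ ENNReal.ofReal (epsLevel n N β)) :
    ENNReal.ofReal (cjsr G A) ≤ rhoBar l N (G.language l).ncard W β q := by
  have : NeZero n := ⟨by omega⟩
  have hlam : 0 < lamBar l W q := lamBar_pos hW hq hP
  have hl' : (0 : ℝ) < l := by exact_mod_cast hl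
  unfold rhoBar
  set δ := deltaFun n (epsLevel n N β * (G.language l).ncard * kappa q.2 / 2) with hδ
  have hδ0 : 0 ≤ δ := Real.sqrt_nonneg _
  rcases hδ0.eq_or_lt with h0 | hpos
  · rw [← h0, ENNReal.ofReal_zero, ENNReal.div_zero (by simpa using hlam),
      ENNReal.top_rpow_of_pos (by positivity)]
    exact le_top
  · rw [← ENNReal.ofReal_div_of_pos hpos, ENNReal.ofReal_rpow_of_pos (by positivity)]
    refine ENNReal.ofReal_le_ofReal (cjsr_le_rpow G A hl hP (by positivity) fun s hs x => ?_)
    have := deltaFun_mul_quadNorm_le hn hP (wordProd A s) hlam (by positivity)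
      (sphereUniform_le_of_violation G A hG μw hμW hq hP hε hV hs) x
    rw [← hδ] at this
    rw [div_mul_eq_mul_div, le_div_iff₀ hpos, mul_comm]
    exact this

/-! ### The confidence bound -/

lemma regBetaInv_mem_Icc {y a b : ℝ} (hy : 0 ≤ y) : regBetaInv y a b ∈ Set.Icc (0 : ℝ) 1 :=
  ⟨regBetaInv_nonneg y a b, csSup_le ⟨0, ⟨le_rfl, zero_le_one⟩, by rwa [regBeta_zero]⟩
    fun _ ht => ht.1.2⟩

/-- If the value at the supremum were below y, continuity would place slightly larger points in the
set as well. At the endpoint 1 the value is 1 ≥ y. -/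
lemma le_regBeta_regBetaInv {y a b : ℝ} (ha : 0 < a) (hb : 0 < b) (hy : y ∈ Set.Icc (0 : ℝ) 1) :
    y ≤ regBeta (regBetaInv y a b) a b := by
  have hmem := regBetaInv_mem_Icc (a := a) (b := b) hy.1
  set s := regBetaInv y a b with hs
  by_contra hlt
  rw [not_le] at hlt
  have hs1 : s < 1 := by
    refine hmem.2.lt_of_ne fun h => ?_
    rw [h, regBeta_one ha hb] at hlt
    exact absurd hy.2 (not_le.mpr hlt)
  have hev : ∀ᶠ t in 𝓝[Set.Icc 0 1] s, regBeta t a b < y :=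
    (continuousOn_regBeta ha hb s hmem).eventually_lt_const hlt
  have hev' : ∀ᶠ t in 𝓝[>] s, regBeta t a b < y := by
    have h1 : 𝓝[Set.Ioc s 1] s = 𝓝[>] s := nhdsWithin_Ioc_eq_nhdsGT hs1
    rw [← h1]
    have hsub : Set.Ioc s 1 ⊆ Set.Icc 0 1 := fun t ht => ⟨hmem.1.trans ht.1.le, ht.2⟩
    exact nhdsWithin_mono s hsub hev
  have hev1 : ∀ᶠ t in 𝓝[>] s, t < 1 := nhdsWithin_le_nhds (gt_mem_nhds hs1)
  obtain ⟨t, ⟨h1, h2⟩, h3⟩ := ((hev'.and hev1).and self_mem_nhdsWithin).exists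
  have h3' : s < t := h3
  exact absurd (le_regBetaInv ⟨hmem.1.trans h3'.le, h2.le⟩ h1.le) (not_le.mpr h3')

lemma measurableSet_displaces (hl : 0 < l) (hC : √(n : ℝ) ≤ C) (i₀ : Fin n) (d : ℕ) :
    MeasurableSet {p : (Fin d → Sample n m l) × Sample n m l |
      Displaces A C (noiseCoord i₀) (Set.range p.1) p.2} := by
  have hset : {p : (Fin d → Sample n m l) × Sample n m l |
      Displaces A C (noiseCoord i₀) (Set.range p.1) p.2} =
      {p | 0 < slack A p.2 (optimum A C (Set.range p.1)).1 (optimum A C (Set.range p.1)).2} ∪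
      ⋃ k : Fin d, ({p | slack A (p.1 k) (optimum A C (Set.range p.1)).1
        (optimum A C (Set.range p.1)).2 = 0}ᶜ ∩
        {p | noiseCoord i₀ (p.1 k) < noiseCoord i₀ p.2}) := by
    ext p
    simp [Displaces]
  rw [hset]
  refine MeasurableSet.union ?_ (MeasurableSet.iUnion fun k => MeasurableSet.inter ?_ ?_)
  · exact measurableSet_lt measurable_const
      (measurable_slack_optimum A hl hC measurable_snd measurable_fst)
  · have hk : Measurable fun p : (Fin d → Sample n m l) × Sample n m l => p.1 k :=
      (measurable_pi_apply k).comp measurable_fst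
    exact (measurable_slack_optimum A hl hC hk measurable_fst (measurableSet_singleton 0)).compl
  · have hk : Measurable fun p : (Fin d → Sample n m l) × Sample n m l => p.1 k :=
      (measurable_pi_apply k).comp measurable_fst
    exact measurableSet_lt ((measurable_noiseCoord i₀).comp hk)
      ((measurable_noiseCoord i₀).comp measurable_snd)

/-- With probability at least `1 - β` the optimum has violation probability at most `ε(β, N)`. -/
theorem measure_violation_gt_le [NeZero n] (hl : 0 < l) (hC : √(n : ℝ) ≤ C)
    (hG : (G.language l).Nonempty) (μw : Measure (EuclideanSpace ℝ (Fin n)))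
    [IsProbabilityMeasure μw] (hμac : μw ≪ volume) {N : ℕ} (hN : symDim n ≤ N) {β : ℝ}
    (hβ : β ∈ Set.Ioo (0 : ℝ) 1) :
    Measure.pi (fun _ : Fin N => sampleLaw G l μw)
      {ω | ¬ sampleLaw G l μw {z | 0 < slack A z (optimum A C (Set.range ω)).1
        (optimum A C (Set.range ω)).2} ≤ ENNReal.ofReal (epsLevel n N β)} ≤
      ENNReal.ofReal β := by
  have hn := NeZero.pos n
  have hd := symDim_pos hn
  have := isProbabilityMeasure_sampleLaw G μw hG
  set π := sampleLaw G l μw with hπ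
  set R := Displaces A C (noiseCoord (0 : Fin n)) (l := l) with hR
  have hy : 1 - β ∈ Set.Icc (0 : ℝ) 1 := ⟨by linarith [hβ.2], by linarith [hβ.1]⟩
  have hε : epsLevel n N β ∈ Set.Icc (0 : ℝ) 1 := regBetaInv_mem_Icc hy.1
  have hnd : ∀ M : ℕ, ∀ᵐ ω ∂Measure.pi (fun _ : Fin M => π),
      Nondegenerate A C (noiseCoord (0 : Fin n)) ω := fun M =>
    ae_nondegenerate G μw A hl hC hG hμac 0
  have hU : ∀ M, symDim n ≤ M → ∀ᵐ ω ∂Measure.pi (fun _ : Fin M => π),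
      ∃! J : Finset (Fin M), J.card = symDim n ∧ ∀ i ∉ J, ¬ R (ω '' J) (ω i) := by
    intro M hM
    filter_upwards [hnd M] with ω hω
    exact Nondegenerate.existsUnique A hn hl hC (by simpa using hM) hω
  have hbound := measure_exists_stable_lt π R hd hN
    (measurableSet_displaces A hl hC 0 (symDim n)) hU hε
  have hreg : 1 - β ≤ regBeta (epsLevel n N β) (symDim n) ((N : ℝ) - symDim n + 1) := by
    have h1 : (0 : ℝ) < symDim n := by exact_mod_cast hd
    have h2 : (symDim n : ℝ) ≤ N := by exact_mod_cast hN
    exact le_regBeta_regBetaInv h1 (by linarith) hy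
  refine (measure_mono_ae ?_).trans (hbound.trans (ENNReal.ofReal_le_ofReal (by linarith)))
  filter_upwards [hU N hN] with ω hω hbad
  obtain ⟨J, ⟨hJ, hJR⟩, -⟩ := hω
  refine ⟨J, hJ, hJR, ?_⟩
  by_contra hkeep
  refine hbad ?_
  have hopt := optimum_eq_of_not_displaces A hl hC hJR
  rw [hopt]
  set q := optimum A C (ω '' J)
  have hc : Continuous fun z : Sample n m l => slack A z q.1 q.2 :=
    continuous_slack A continuous_id continuous_const continuous_const
  have hm : MeasurableSet {z : Sample n m l | slack A z q.1 q.2 ≤ 0} :=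
    (isClosed_le hc continuous_const).measurableSet
  have hcompl : {z : Sample n m l | 0 < slack A z q.1 q.2} =
      {z : Sample n m l | slack A z q.1 q.2 ≤ 0}ᶜ := by
    ext z; simp
  -- A violating sample displaces, so an undisturbed family bounds the violation probability by 1 -
  -- `keepProb`.
  have hsub : keepProb π R (ω '' J) ≤ π {z : Sample n m l | slack A z q.1 q.2 ≤ 0} :=
    measure_mono fun z hz => not_lt.mp fun h => hz (Or.inl h)
  rw [hcompl, prob_compl_eq_one_sub hm]
  have h1 : ENNReal.ofReal (1 - epsLevel n N β) ≤ π {z : Sample n m l | slack A z q.1 q.2 ≤ 0} :=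
    (not_le.mp hkeep).le.trans hsub
  rw [tsub_le_iff_right]
  calc (1 : ℝ≥0∞) = ENNReal.ofReal (epsLevel n N β) + ENNReal.ofReal (1 - epsLevel n N β) := by
        rw [← ENNReal.ofReal_add hε.1 (by linarith [hε.2]), add_sub_cancel, ENNReal.ofReal_one]
    _ ≤ _ := by gcongr

end

end CSLS

end

/-! ### The probabilistic bound on the constrained joint spectral radius. -/

theorem theorem2 {U E : Type*} [Finite U] [Finite E] {m n : ℕ} (hn : 2 ≤ n)
    (G : CSLS.LabeledGraph U E m) (A : Fin m → Matrix (Fin n) (Fin n) ℝ)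
    (l : ℕ) (hl : 0 < l) (hG : (G.language l).Nonempty)
    (W : ℝ) (hW : 0 < W) (μw : Measure (EuclideanSpace ℝ (Fin n))) [IsProbabilityMeasure μw]
    (hμW : ∀ᵐ w ∂μw, ‖w‖ ≤ W) (hμac : μw ≪ volume)
    (C : ℝ) (hC : √(n : ℝ) ≤ C)
    (N : ℕ) (hN : n * (n + 1) / 2 ≤ N) (β : ℝ) (hβ : β ∈ Set.Ioo (0 : ℝ) 1) :
    (∀ ω : Fin N → CSLS.Sample n m l, ∃! q, CSLS.IsOptimal A C ω q) ∧
    ENNReal.ofReal (1 - β) ≤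
      Measure.pi (fun _ : Fin N => CSLS.sampleLaw G l μw)
        {ω | ∀ q, CSLS.IsOptimal A C ω q →
          ENNReal.ofReal (CSLS.cjsr G A) ≤
            CSLS.rhoBar l N (G.language l).ncard W β q} := by
  have : NeZero n := ⟨by omega⟩
  have hprob := CSLS.isProbabilityMeasure_sampleLaw G μw hG
  refine ⟨fun ω => ?_, ?_⟩
  · simp only [CSLS.isOptimal_iff]
    exact CSLS.existsUnique_optimalOn A hl hC (Set.finite_range ω)
  · have hε : 0 ≤ CSLS.epsLevel n N β := CSLS.regBetaInv_nonneg _ _ _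
    have hbad := CSLS.measure_violation_gt_le G A hl hC hG μw hμac hN hβ
    -- The whole space is covered by the event of the theorem and the event of large violation.
    -- Subadditivity of the outer measure then suffices, without measurability of either event.
    have hsub : (Set.univ : Set (Fin N → CSLS.Sample n m l)) ⊆
        {ω | ∀ q, CSLS.IsOptimal A C ω q → ENNReal.ofReal (CSLS.cjsr G A) ≤
          CSLS.rhoBar l N (G.language l).ncard W β q} ∪
        {ω | ¬ CSLS.sampleLaw G l μw {z | 0 < CSLS.slack A z
          (CSLS.optimum A C (Set.range ω)).1 (CSLS.optimum A C (Set.range ω)).2} ≤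
            ENNReal.ofReal (CSLS.epsLevel n N β)} := by
      intro ω _
      refine or_iff_not_imp_right.mpr fun hV q hq => ?_
      rw [CSLS.isOptimal_iff] at hq
      have hV' := not_not.mp hV
      rw [CSLS.OptimalOn.eq_optimum A hq] at hV'
      exact CSLS.ofReal_cjsr_le_rhoBar G A hn hl hG hW μw hμW hq.1.1 hq.1.2.1.1 hε hV'
    have h1 := (measure_mono hsub).trans (measure_union_le (μ := Measure.pi
      (fun _ : Fin N => CSLS.sampleLaw G l μw)) _ _)
    rw [measure_univ] at h1
    rw [ENNReal.ofReal_sub _ hβ.1.le, ENNReal.ofReal_one, tsub_le_iff_right]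
    exact h1.trans (add_le_add le_rfl hbad)
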